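/- Let $f:\mathbb C^N\times\mathbb R\to\mathbb C^N$ be continuous and complex differentiable in $x$, and let $\Theta(x,t)$ be invertible complex $N\times N$ matrices whose entries are $C^1$ in $(x,t)$ (in the real sense). Put $M=\Theta^{*T}\Theta$ and $$F(x,t)=\Big(\dot\Theta+\Theta\,\frac{\partial f}{\partial x}\Big)\Theta^{-1},$$ where $\dot\Theta=\partial_t\Theta+D_x\Theta[f]$ is the derivative along $\dot x=f(x,t)$. For each $t$ let $d_t(x,y)$ be the infimum of $\int_0^1\sqrt{\gamma'^{*T}M(\gamma,t)\gamma'}\,du$ over all $C^1$ paths $\gamma$ from $x$ to $y$. Let $x_1,x_2$ be trajectories of $\dot x=f(x,t)$ on a nondegenerate interval $J$, and put $s(t)=d_t(x_1(t),x_2(t))$ and $B_t=\{y: d_t(x_2(t),y)\le s(t)\}$. Let $\lambda_{\max}(t)$ and $\lambda_{\min}(t)$ be the supremum and the infimum, over $y\in B_t$, of the eigenvalues of the Hermitian part of $F(y,t)$; these are extended real numbers. (1) Let $t\in J$, $x_1(t)\ne x_2(t)$, and suppose the distance $s(t)$ is attained by a connecting $C^1$ path. Then the upper right Dini derivative of $s$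 at $t$, divided by $s(t)$, is at most $\lambda_{\max}(t)$, and the lower left Dini derivative, divided by $s(t)$, is at least $\lambda_{\min}(t)$. In particular, if $t$ is interior to $J$ and $\dot s(t)$ exists, then $\lambda_{\min}(t)\le\dot s/s\le\lambda_{\max}(t)$. (2) Let $t\in J$, $x_1(t)\ne x_2(t)$, and let $B_t$ be compact. Then $s(t)>0$ and $$\lambda_{\min}(t)\le\liminf_{\tau\to t}\frac{s(\tau)-s(t)}{(\tau-t)\,s(t)},\qquad \limsup_{\tau\to t}\frac{s(\tau)-s(t)}{(\tau-t)\,s(t)}\le\lambda_{\max}(t)\qquad(\tau\in J\setminus\{t\}).$$ So $\lambda_{\min}\le\dot s/s\le\lambda_{\max}$ whenever the derivative $\dot s(t)$ (within $J$) exists. (3) If $t_0\le t$ lie in $J$ and $B_\tau$ is compact for all $\tau\in[t_0,t]$, then $\lambda_{\min}$ and $\lambda_{\max}$ are integrable on $[t_0,t]$ (with value $0$ in the trivial case $N=0$) and $$e^{\int_{t_0}^t\lambda_{\min}d\tau}\,s(t_0)\le s(t)\le e^{\int_{t_0}^t\lambda_{\max}d\tau}\,s(t_0).$$ (4) Call the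 system contracting (diverging) if for some $\beta>0$ all eigenvalues of the Hermitian part of $F$ on $\mathbb C^N\times J$ are $\le-\beta$ ($\ge\beta$), semi-contracting (semi-diverging) if they are all $\le0$ ($\ge0$), and indifferent if they are all $0$. Let $B_t$ be compact for all $t\in J$. If the system is contracting (diverging), there is $\beta>0$ with $s(t)\le e^{-\beta(t-t_0)}s(t_0)$ (respectively $s(t)\ge e^{\beta(t-t_0)}s(t_0)$) for all $t_0\le t$ in $J$. On $J$, $s$ is nonincreasing for semi-contracting, nondecreasing for semi-diverging, and constant for indifferent systems. (5) Let the metric be uniformly positive definite and bounded, i.e. $a\,v^{*T}v\le v^{*T}M(x,t)v\le b\,v^{*T}v$ for all $x,v\in\mathbb C^N$, $t\in J$, with a constant $a>0$ and a constant $b$. Then, for all $t_0\le t$ in $J$, every $B_\tau$ with $\tau\in[t_0,t]$ is compact, and the distance $e(t)$ of $x_1(t),x_2(t)$ in the identity metric (infimum of $\int\sqrt{\delta x^{*T}\delta x}$ over connecting paths) satisfies $$\sqrt{a/b}\;e^{\int_{t_0}^t\lambda_{\min}d\tau}\,e(t_0)\le e(t)\le\sqrt{b/a}\;e^{\int_{t_0}^t\lambda_{\max}d\tau}\,e(t_0).$$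 (6) Suppose explicit orthonormal Cartesian coordinates $z(x,t)\in\mathbb C^K$, $K\ge N$, exist: $z$ is $C^1$ in $(x,t)$ (in the real sense) and, for each $t\in J$, $z(\cdot,t)$ is a topological embedding with $\delta z^{*T}\delta z=\delta x^{*T}M\,\delta x$. Write $z_i=z(x_i(t),t)$, $\dot z_i=\frac{d}{dt}z_i$, and let $s_z(t)$ be the infimum of $\int\sqrt{\delta z^{*T}\delta z}$ over all $C^1$ paths in $\mathbb C^K$ from $z_1$ to $z_2$. Then $s_z=|z_1-z_2|\le s$ on $J$, and wherever $x_1\neq x_2$ we have $s_z>0$, $s_z$ is differentiable (within $J$), and $$\frac{\dot s_z}{s_z}=\rho:=\frac{\Re\big((\dot z_1-\dot z_2)^{*T}(z_1-z_2)\big)}{(z_1-z_2)^{*T}(z_1-z_2)}.$$ This gives convergence without any assumption on $F$: for $r\in\mathbb R$ and $t_0\le t$ in $J$, if $\rho\le r$ on $[t_0,t]$ then $s_z(t)\le e^{r(t-t_0)}s_z(t_0)$, and if $\rho\ge r$ on $[t_0,t]$ then $s_z(t)\ge e^{r(t-t_0)}s_z(t_0)$ (with $\rho=0$ where $z_1=z_2$).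 If, for every $t\in J$, the straight segment from $z_1$ to $z_2$ lies in the range of $z(\cdot,t)$, then $s=s_z$ on $J$, so $s$ is differentiable (within $J$) and $\dot s/s=\rho$ wherever $x_1\ne x_2$. -/

import Mathlib

open scoped Matrix Topology

noncomputable section

/-- The quadratic form `v*ᵀ M v` (real part; for Hermitian `M` the value is real). -/
def quadForm {N : ℕ} (M : Matrix (Fin N) (Fin N) ℂ) (v : EuclideanSpace ℂ (Fin N)) : ℝ :=
  (star v.ofLp ⬝ᵥ (M *ᵥ v.ofLp)).re

/-- The metric `M(x,t) = Θ(x,t)*ᵀ Θ(x,t)`. -/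
def metricOf {N : ℕ} (Θ : EuclideanSpace ℂ (Fin N) → ℝ → Matrix (Fin N) (Fin N) ℂ)
    (x : EuclideanSpace ℂ (Fin N)) (t : ℝ) : Matrix (Fin N) (Fin N) ℂ :=
  (Θ x t)ᴴ * Θ x t

/-- The path integral `∫ √(δx*ᵀ M δx)` along `γ : [0,1] → ℂ^N`. -/
def pathLength {N : ℕ} (M : EuclideanSpace ℂ (Fin N) → Matrix (Fin N) (Fin N) ℂ)
    (γ : ℝ → EuclideanSpace ℂ (Fin N)) : ℝ :=
  ∫ u in (0 : ℝ)..1, √(quadForm (M (γ u)) (deriv γ u))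

/-- `γ` restricted to `[0,1]` is a continuously differentiable path from `x` to `y`. -/
def IsPath {N : ℕ} (x y : EuclideanSpace ℂ (Fin N)) (γ : ℝ → EuclideanSpace ℂ (Fin N)) : Prop :=
  ContDiff ℝ 1 γ ∧ γ 0 = x ∧ γ 1 = y

/-- The distance of `x` and `y`: the infimum of the path integral over all connecting paths
(the set of lengths is never empty and is bounded below by `0`). -/
def pathDist {N : ℕ} (M : EuclideanSpace ℂ (Fin N) → Matrix (Fin N) (Fin N) ℂ)
    (x y : EuclideanSpace ℂ (Fin N)) : ℝ :=
  sInf {L | ∃ γ, IsPath x y γ ∧ pathLength M γ = L}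

/-- The distance of `x` and `y` is attained by a connecting path, that is, it is a minimum. -/
def HasMinimizer {N : ℕ} (M : EuclideanSpace ℂ (Fin N) → Matrix (Fin N) (Fin N) ℂ)
    (x y : EuclideanSpace ℂ (Fin N)) : Prop :=
  ∃ γ, IsPath x y γ ∧ pathLength M γ = pathDist M x y

/-- The closed ball of radius `r` around `x` for the path-integral distance. -/
def pathBall {N : ℕ} (M : EuclideanSpace ℂ (Fin N) → Matrix (Fin N) (Fin N) ℂ)
    (x : EuclideanSpace ℂ (Fin N)) (r : ℝ) : Set (EuclideanSpace ℂ (Fin N)) :=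
  {y | pathDist M x y ≤ r}

/-- The total time derivative `∂g/∂t + (∂g/∂x) f` of `g(x,t)` along `ẋ = f(x,t)`. -/
def flowDeriv {N : ℕ} {G : Type*} [NormedAddCommGroup G] [NormedSpace ℝ G]
    (f : EuclideanSpace ℂ (Fin N) → ℝ → EuclideanSpace ℂ (Fin N))
    (g : EuclideanSpace ℂ (Fin N) → ℝ → G) (x : EuclideanSpace ℂ (Fin N)) (t : ℝ) : G :=
  fderiv ℝ (fun p : EuclideanSpace ℂ (Fin N) × ℝ => g p.1 p.2) (x, t) (f x t, 1)

/-- The complex Jacobian matrix `∂f/∂x`. -/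
def jacobian {N : ℕ} (f : EuclideanSpace ℂ (Fin N) → ℝ → EuclideanSpace ℂ (Fin N))
    (x : EuclideanSpace ℂ (Fin N)) (t : ℝ) : Matrix (Fin N) (Fin N) ℂ :=
  Matrix.of fun i j => (fderiv ℂ (fun y => f y t) x (EuclideanSpace.single j 1)) i

/-- The generalized Jacobian `F = (Θ̇ + Θ ∂f/∂x) Θ⁻¹`. -/
def genJacobian {N : ℕ} (f : EuclideanSpace ℂ (Fin N) → ℝ → EuclideanSpace ℂ (Fin N))
    (Θ : EuclideanSpace ℂ (Fin N) → ℝ → Matrix (Fin N) (Fin N) ℂ)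
    (x : EuclideanSpace ℂ (Fin N)) (t : ℝ) : Matrix (Fin N) (Fin N) ℂ :=
  (Matrix.of (fun i j => flowDeriv f (fun y τ => Θ y τ i j) x t) + Θ x t * jacobian f x t)
    * (Θ x t)⁻¹

/-- The Hermitian part `(A + A*ᵀ)/2`. -/
def hermPart {N : ℕ} (A : Matrix (Fin N) (Fin N) ℂ) : Matrix (Fin N) (Fin N) ℂ :=
  (1 / 2 : ℂ) • (A + Aᴴ)

theorem hermPart_isHermitian {N : ℕ} (A : Matrix (Fin N) (Fin N) ℂ) :
    (hermPart A).IsHermitian := by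
  ext i j
  simp [hermPart, Matrix.conjTranspose_apply, mul_add, add_comm]

/-- The (real) eigenvalues of the Hermitian part of `A`. -/
def hermEig {N : ℕ} (A : Matrix (Fin N) (Fin N) ℂ) : Fin N → ℝ :=
  (hermPart_isHermitian A).eigenvalues

/-- The distance `s(t)` of the two trajectories. -/
def trajDist {N : ℕ} (Θ : EuclideanSpace ℂ (Fin N) → ℝ → Matrix (Fin N) (Fin N) ℂ)
    (x₁ x₂ : ℝ → EuclideanSpace ℂ (Fin N)) (t : ℝ) : ℝ :=
  pathDist (fun x => metricOf Θ x t) (x₁ t) (x₂ t)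

/-- The ball of radius `s(t)` around `x₂(t)`. -/
def trajBall {N : ℕ} (Θ : EuclideanSpace ℂ (Fin N) → ℝ → Matrix (Fin N) (Fin N) ℂ)
    (x₁ x₂ : ℝ → EuclideanSpace ℂ (Fin N)) (t : ℝ) : Set (EuclideanSpace ℂ (Fin N)) :=
  pathBall (fun x => metricOf Θ x t) (x₂ t) (trajDist Θ x₁ x₂ t)

/-- `λ_max(t)`: the largest eigenvalue of the Hermitian part of `F(·,t)` in the ball of radius
`s(t)` around `x₂(t)` (a supremum in the extended reals). -/
def rateMax {N : ℕ} (f : EuclideanSpace ℂ (Fin N) → ℝ → EuclideanSpace ℂ (Fin N))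
    (Θ : EuclideanSpace ℂ (Fin N) → ℝ → Matrix (Fin N) (Fin N) ℂ)
    (x₁ x₂ : ℝ → EuclideanSpace ℂ (Fin N)) (t : ℝ) : EReal :=
  ⨆ y ∈ trajBall Θ x₁ x₂ t, ⨆ i, ((hermEig (genJacobian f Θ y t) i : ℝ) : EReal)

/-- `λ_min(t)`: the smallest eigenvalue of the Hermitian part of `F(·,t)` in the ball of radius
`s(t)` around `x₂(t)` (an infimum in the extended reals). -/
def rateMin {N : ℕ} (f : EuclideanSpace ℂ (Fin N) → ℝ → EuclideanSpace ℂ (Fin N))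
    (Θ : EuclideanSpace ℂ (Fin N) → ℝ → Matrix (Fin N) (Fin N) ℂ)
    (x₁ x₂ : ℝ → EuclideanSpace ℂ (Fin N)) (t : ℝ) : EReal :=
  ⨅ y ∈ trajBall Θ x₁ x₂ t, ⨅ i, ((hermEig (genJacobian f Θ y t) i : ℝ) : EReal)

/-- The upper Dini version of `ṡ/s` at `t`, over times in `S`. -/
def upperLogRate (s : ℝ → ℝ) (S : Set ℝ) (t : ℝ) : EReal :=
  Filter.limsup (fun τ => (((s τ - s t) / (τ - t) / s t : ℝ) : EReal)) (𝓝[S \ {t}] t)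

/-- The lower Dini version of `ṡ/s` at `t`, over times in `S`. -/
def lowerLogRate (s : ℝ → ℝ) (S : Set ℝ) (t : ℝ) : EReal :=
  Filter.liminf (fun τ => (((s τ - s t) / (τ - t) / s t : ℝ) : EReal)) (𝓝[S \ {t}] t)

/-- `λ_max` is uniformly negative. -/
def IsContracting {N : ℕ} (f : EuclideanSpace ℂ (Fin N) → ℝ → EuclideanSpace ℂ (Fin N))
    (Θ : EuclideanSpace ℂ (Fin N) → ℝ → Matrix (Fin N) (Fin N) ℂ) (J : Set ℝ) : Prop :=
  ∃ β : ℝ, 0 < β ∧ ∀ t ∈ J, ∀ x i, hermEig (genJacobian f Θ x t) i ≤ -β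

/-- `λ_min` is uniformly positive. -/
def IsDiverging {N : ℕ} (f : EuclideanSpace ℂ (Fin N) → ℝ → EuclideanSpace ℂ (Fin N))
    (Θ : EuclideanSpace ℂ (Fin N) → ℝ → Matrix (Fin N) (Fin N) ℂ) (J : Set ℝ) : Prop :=
  ∃ β : ℝ, 0 < β ∧ ∀ t ∈ J, ∀ x i, β ≤ hermEig (genJacobian f Θ x t) i

/-- The Hermitian part of `F` is negative semidefinite. -/
def IsSemiContracting {N : ℕ} (f : EuclideanSpace ℂ (Fin N) → ℝ → EuclideanSpace ℂ (Fin N))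
    (Θ : EuclideanSpace ℂ (Fin N) → ℝ → Matrix (Fin N) (Fin N) ℂ) (J : Set ℝ) : Prop :=
  ∀ t ∈ J, ∀ x i, hermEig (genJacobian f Θ x t) i ≤ 0

/-- The Hermitian part of `F` is positive semidefinite. -/
def IsSemiDiverging {N : ℕ} (f : EuclideanSpace ℂ (Fin N) → ℝ → EuclideanSpace ℂ (Fin N))
    (Θ : EuclideanSpace ℂ (Fin N) → ℝ → Matrix (Fin N) (Fin N) ℂ) (J : Set ℝ) : Prop :=
  ∀ t ∈ J, ∀ x i, 0 ≤ hermEig (genJacobian f Θ x t) i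

/-- `λ_max = λ_min = 0`. -/
def IsIndifferent {N : ℕ} (f : EuclideanSpace ℂ (Fin N) → ℝ → EuclideanSpace ℂ (Fin N))
    (Θ : EuclideanSpace ℂ (Fin N) → ℝ → Matrix (Fin N) (Fin N) ℂ) (J : Set ℝ) : Prop :=
  ∀ t ∈ J, ∀ x i, hermEig (genJacobian f Θ x t) i = 0

/-- `z(x,t)`, with values in `ℂ^K`, `K ≥ N`, are orthonormal Cartesian coordinates for the metric
`M = Θ*ᵀ Θ` at times in `J`: they are coordinates (a topological embedding at each time),
continuously differentiable, and orthonormal, `δz*ᵀ δz = δx*ᵀ M δx`. -/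
structure IsOrthonormalCoord {N K : ℕ}
    (Θ : EuclideanSpace ℂ (Fin N) → ℝ → Matrix (Fin N) (Fin N) ℂ) (J : Set ℝ)
    (z : EuclideanSpace ℂ (Fin N) → ℝ → EuclideanSpace ℂ (Fin K)) : Prop where
  dim_le : N ≤ K
  contDiff : ContDiff ℝ 1 (fun p : EuclideanSpace ℂ (Fin N) × ℝ => z p.1 p.2)
  embedding : ∀ t ∈ J, Topology.IsEmbedding (fun x => z x t)
  orthonormal : ∀ t ∈ J, ∀ x v,
    quadForm 1 (fderiv ℝ (fun y => z y t) x v) = quadForm (metricOf Θ x t) v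

/-- The distance of the two trajectories in the space `ℂ^K` of the coordinates `z`: the infimum of
`∫ √(δz*ᵀ δz)` over all paths of `ℂ^K` from `z₁` to `z₂`. -/
def coordDist {N K : ℕ} (z : EuclideanSpace ℂ (Fin N) → ℝ → EuclideanSpace ℂ (Fin K))
    (x₁ x₂ : ℝ → EuclideanSpace ℂ (Fin N)) (t : ℝ) : ℝ :=
  pathDist (fun _ => 1) (z (x₁ t) t) (z (x₂ t) t)

/-- `Re((ż₁ - ż₂)*ᵀ (z₁ - z₂)) / ((z₁ - z₂)*ᵀ (z₁ - z₂))`. -/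
def coordRate {N K : ℕ} (f : EuclideanSpace ℂ (Fin N) → ℝ → EuclideanSpace ℂ (Fin N))
    (z : EuclideanSpace ℂ (Fin N) → ℝ → EuclideanSpace ℂ (Fin K))
    (x₁ x₂ : ℝ → EuclideanSpace ℂ (Fin N)) (t : ℝ) : ℝ :=
  (star (flowDeriv f z (x₁ t) t - flowDeriv f z (x₂ t) t).ofLp
      ⬝ᵥ (z (x₁ t) t - z (x₂ t) t).ofLp).re
    / quadForm 1 (z (x₁ t) t - z (x₂ t) t)

end

/-! Let `w = Θ v` be the frame coordinates of a tangent vector `v`. The Euler map `x ↦ x + h f(x,t)`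
carries a curve at time `t` to a curve at time `t + h`, and in the moved frame the tangent vector
becomes `w + h F w` up to `o(h)`. Since `‖w + h F w‖² = ‖w‖² + 2h Re⟨w, F w⟩ + O(h²)`, and `Re⟨w, F
w⟩ / ‖w‖²` lies between the extreme eigenvalues of the Hermitian part of `F`, lengths change at a
relative rate between these eigenvalues (`FramedFlow.eventually_stretch_le`). The end points miss
the trajectories by `o(h)` only, which a small linear correction of the curve repairs
(`FramedFlow.exists_transport`). Thus curves are moved without a flow map, whose existence for
positive time is not guaranteed.

Transporting a minimizer away from time `t` gives (1). For two-sided rates, near-minimal curves at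
nearby times `τ` must also be transported back to `t`, with uniform eigenvalue bounds on them.
Compactness of the ball supplies these: near-minimal curves at time `τ` stay in any prescribed
neighbourhood of it (`FramedFlow.exists_confinement`). This yields (2) through
`FramedFlow.eventually_slope_le`.

For (3), uniqueness of solutions leaves two cases: `s` vanishes identically, or it is positive
throughout. In the second case `log s` is Lipschitz on a compact interval, hence the integral of its
almost everywhere derivative, which (2) bounds. The extreme rates are semicontinuous and bounded,
hence integrable. Part (4) compares these integrals with constants. Part (5) compares lengths in two
metrics; the lower metric bound also puts the balls inside Euclidean balls.

In (6) the coordinates preserve length, so `s` dominates the straight-line distance `|z₁ - z₂|`,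
whose square is differentiated directly. If the segment lies in the chart, its lift is `C¹` because
`z` is both an embedding and an immersion, and the two distances agree. -/

/-! ### Length distance of a field of frames. -/

section Curves

variable {E G : Type*} [NormedAddCommGroup E] [NormedSpace ℝ E]
  [NormedAddCommGroup G] [NormedSpace ℝ G]

/-- The speed of a curve `γ`, measured by the frame field `T`. -/
noncomputable def curveSpeed (T : E → E →L[ℝ] G) (γ : ℝ → E) (u : ℝ) : ℝ := ‖T (γ u) (deriv γ u)‖

/-- The distance induced by a frame field: the infimum of the lengths of the `C¹` curves on
`[0,1]` that join two points. -/
noncomputable def curveDist (T : E → E →L[ℝ] G) (x y : E) : ℝ :=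
  sInf {L | ∃ γ : ℝ → E, (ContDiff ℝ 1 γ ∧ γ 0 = x ∧ γ 1 = y) ∧
    ∫ u in (0 : ℝ)..1, curveSpeed T γ u = L}

variable {T : E → E →L[ℝ] G} {γ : ℝ → E}

theorem curveSpeed_nonneg (T : E → E →L[ℝ] G) (γ : ℝ → E) (u : ℝ) : 0 ≤ curveSpeed T γ u :=
  norm_nonneg _

theorem continuous_curveSpeed (hT : Continuous T) (hγ : ContDiff ℝ 1 γ) :
    Continuous (curveSpeed T γ) := by
  have h1 : Continuous (deriv γ) := hγ.continuous_deriv le_rfl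
  have h2 : Continuous γ := hγ.continuous
  unfold curveSpeed
  exact ((hT.comp h2).clm_apply h1).norm

theorem curveLength_nonneg (T : E → E →L[ℝ] G) (γ : ℝ → E) {a b : ℝ} (hab : a ≤ b) :
    0 ≤ ∫ u in a..b, curveSpeed T γ u :=
  intervalIntegral.integral_nonneg hab fun u _ => curveSpeed_nonneg T γ u

theorem curveDist_nonneg (T : E → E →L[ℝ] G) (x y : E) : 0 ≤ curveDist T x y := by
  refine Real.sInf_nonneg ?_
  rintro L ⟨γ, -, rfl⟩
  exact curveLength_nonneg T γ zero_le_one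

theorem curveDist_le (hγ : ContDiff ℝ 1 γ) :
    curveDist T (γ 0) (γ 1) ≤ ∫ u in (0 : ℝ)..1, curveSpeed T γ u := by
  refine csInf_le ⟨0, ?_⟩ ⟨γ, ⟨hγ, rfl, rfl⟩, rfl⟩
  rintro L ⟨γ, -, rfl⟩
  exact curveLength_nonneg T γ zero_le_one

theorem exists_curve_of_curveDist_lt {x y : E} {r : ℝ} (h : curveDist T x y < r) :
    ∃ γ : ℝ → E, ContDiff ℝ 1 γ ∧ γ 0 = x ∧ γ 1 = y ∧
      ∫ u in (0 : ℝ)..1, curveSpeed T γ u < r := by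
  have hne : {L | ∃ γ : ℝ → E, (ContDiff ℝ 1 γ ∧ γ 0 = x ∧ γ 1 = y) ∧
      ∫ u in (0 : ℝ)..1, curveSpeed T γ u = L}.Nonempty :=
    ⟨_, fun u => x + u • (y - x), ⟨by fun_prop, by simp, by simp⟩, rfl⟩
  obtain ⟨L, ⟨γ, ⟨h1, h2, h3⟩, rfl⟩, hL⟩ := exists_lt_of_csInf_lt hne h
  exact ⟨γ, h1, h2, h3, hL⟩

theorem curveDist_self (x : E) : curveDist T x x = 0 := by
  refine le_antisymm ?_ (curveDist_nonneg T x x)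
  have := curveDist_le (T := T) (γ := fun _ : ℝ => x) contDiff_const
  simpa [curveSpeed] using this

/-- Change of variables. The reparametrization may be stationary, which later allows curves to come
to rest before they are glued. -/
theorem curveLength_comp (hT : Continuous T) (hγ : ContDiff ℝ 1 γ) {φ : ℝ → ℝ}
    (hφ : ContDiff ℝ 1 φ) (hφ' : ∀ u, 0 ≤ deriv φ u) (a b : ℝ) :
    ∫ u in a..b, curveSpeed T (γ ∘ φ) u = ∫ u in (φ a)..(φ b), curveSpeed T γ u := by
  have h1 : ∀ u, HasDerivAt φ (deriv φ u) u := fun u =>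
    ((hφ.differentiable one_ne_zero) u).hasDerivAt
  have h2 : ∀ u, HasDerivAt γ (deriv γ u) u := fun u =>
    ((hγ.differentiable one_ne_zero) u).hasDerivAt
  rw [← intervalIntegral.integral_comp_mul_deriv (fun x _ => h1 x)
    (hφ.continuous_deriv le_rfl).continuousOn (continuous_curveSpeed hT hγ)]
  congr 1
  ext u
  have h3 := (h2 (φ u)).scomp u (h1 u)
  simp only [curveSpeed, Function.comp_apply]
  rw [h3.deriv, map_smul, norm_smul, Real.norm_of_nonneg (hφ' u), mul_comm]

theorem curveDist_le_arc (hT : Continuous T) (hγ : ContDiff ℝ 1 γ) {a b : ℝ} (hab : a ≤ b) :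
    curveDist T (γ a) (γ b) ≤ ∫ u in a..b, curveSpeed T γ u := by
  have hφ : ContDiff ℝ 1 (fun u : ℝ => a + u * (b - a)) := by fun_prop
  have hd : ∀ u, HasDerivAt (fun u : ℝ => a + u * (b - a)) (b - a) u := fun u => by
    simpa using ((hasDerivAt_id u).mul_const (b - a)).const_add a
  have h := curveLength_comp hT hγ hφ (fun u => by rw [(hd u).deriv]; linarith) 0 1
  have h' := curveDist_le (T := T) (hγ.comp hφ)
  rw [h] at h'
  simpa using h'

theorem curveDist_comm (T : E → E →L[ℝ] G) (x y : E) : curveDist T x y = curveDist T y x := by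
  have key : ∀ x y, curveDist T x y ≤ curveDist T y x := by
    intro x y
    refine le_of_forall_gt fun r hr => ?_
    obtain ⟨γ, h1, h2, h3, h4⟩ := exists_curve_of_curveDist_lt hr
    have h5 : ContDiff ℝ 1 (fun u : ℝ => γ (1 - u)) := h1.comp (by fun_prop)
    have h6 := curveDist_le (T := T) h5
    simp only [sub_zero, sub_self, h2, h3] at h6
    refine h6.trans_lt (lt_of_eq_of_lt ?_ h4)
    have h7 : ∀ u, curveSpeed T (fun u : ℝ => γ (1 - u)) u = curveSpeed T γ (1 - u) := by
      intro u
      have : deriv (fun u : ℝ => γ (1 - u)) u = - deriv γ (1 - u) := deriv_comp_const_sub ..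
      simp [curveSpeed, this]
    simp only [h7]
    rw [intervalIntegral.integral_comp_sub_left (fun u => curveSpeed T γ u) 1]
    simp
  exact le_antisymm (key x y) (key y x)

theorem deriv_smoothTransition_nonneg (u : ℝ) : 0 ≤ deriv Real.smoothTransition u :=
  Real.smoothTransition.monotone.deriv_nonneg

/-- A plain concatenation has a corner at `y`. Reparametrizing by smooth steps makes both curves
stop there, so that the glued curve is `C¹` and lengths are unchanged. -/
theorem curveDist_triangle (hT : Continuous T) (x y z : E) :
    curveDist T x z ≤ curveDist T x y + curveDist T y z := by
  refine le_of_forall_pos_lt_add fun ε hε => ?_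
  obtain ⟨γ₁, h1, h10, h11, hL1⟩ := exists_curve_of_curveDist_lt
    (show curveDist T x y < curveDist T x y + ε / 2 by linarith)
  obtain ⟨γ₂, h2, h20, h21, hL2⟩ := exists_curve_of_curveDist_lt
    (show curveDist T y z < curveDist T y z + ε / 2 by linarith)
  set φ : ℝ → ℝ := fun u => Real.smoothTransition (2 * u) with hφ
  set ψ : ℝ → ℝ := fun u => Real.smoothTransition (2 * u - 1) with hψ
  have cφ : ContDiff ℝ 1 φ := Real.smoothTransition.contDiff.comp (by fun_prop)
  have cψ : ContDiff ℝ 1 ψ := Real.smoothTransition.contDiff.comp (by fun_prop)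
  have dφ : ∀ u, 0 ≤ deriv φ u := fun u =>
    Monotone.deriv_nonneg fun a b hab => Real.smoothTransition.monotone (by linarith)
  have dψ : ∀ u, 0 ≤ deriv ψ u := fun u =>
    Monotone.deriv_nonneg fun a b hab => Real.smoothTransition.monotone (by linarith)
  -- On each half of the interval one summand is constantly `y` and cancels, so a single formula
  -- gives the concatenation.
  set γ : ℝ → E := fun u => γ₁ (φ u) + γ₂ (ψ u) - y with hγ
  have cγ : ContDiff ℝ 1 γ := ((h1.comp cφ).add (h2.comp cψ)).sub contDiff_const
  have e1 : ∀ u < 1 / 2, γ =ᶠ[𝓝 u] γ₁ ∘ φ := by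
    intro u hu
    filter_upwards [Iio_mem_nhds hu] with v hv
    have : ψ v = 0 := Real.smoothTransition.zero_of_nonpos
      (by have := Set.mem_Iio.1 hv; linarith)
    simp [hγ, this, h20]
  have e2 : ∀ u > 1 / 2, γ =ᶠ[𝓝 u] γ₂ ∘ ψ := by
    intro u hu
    filter_upwards [Ioi_mem_nhds hu] with v hv
    have : φ v = 1 := Real.smoothTransition.one_of_one_le
      (by have := Set.mem_Ioi.1 hv; linarith)
    simp [hγ, this, h11]
  have hs := continuous_curveSpeed hT cγ
  have hle := curveDist_le (T := T) cγ
  have g0 : γ 0 = x := by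
    have := (e1 0 (by norm_num)).self_of_nhds
    rw [this]; simp [hφ, h10]
  have g1 : γ 1 = z := by
    have := (e2 1 (by norm_num)).self_of_nhds
    rw [this]; simp only [hψ, Function.comp_apply]; norm_num [h21]
  rw [g0, g1, ← intervalIntegral.integral_add_adjacent_intervals
    (hs.intervalIntegrable 0 (1/2)) (hs.intervalIntegrable (1/2) 1)] at hle
  have i1 : ∫ u in (0 : ℝ)..(1/2), curveSpeed T γ u = ∫ u in (0:ℝ)..1, curveSpeed T γ₁ u := by
    have := curveLength_comp hT h1 cφ dφ 0 (1/2)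
    have p0 : φ 0 = 0 := by simp [hφ]
    have p1 : φ (1/2) = 1 := by simp [hφ]
    rw [p0, p1] at this
    rw [← this]
    refine intervalIntegral.integral_congr_Ioo_of_le (by norm_num) fun u hu => ?_
    have := e1 u hu.2
    simp only [curveSpeed]
    rw [this.deriv_eq, this.self_of_nhds]
  have i2 : ∫ u in (1/2 : ℝ)..1, curveSpeed T γ u = ∫ u in (0:ℝ)..1, curveSpeed T γ₂ u := by
    have := curveLength_comp hT h2 cψ dψ (1/2) 1
    have p0 : ψ (1/2) = 0 := by simp [hψ]
    have p1 : ψ 1 = 1 := by simp only [hψ]; norm_num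
    rw [p0, p1] at this
    rw [← this]
    refine intervalIntegral.integral_congr_Ioo_of_le (by norm_num) fun u hu => ?_
    have := e2 u hu.1
    simp only [curveSpeed]
    rw [this.deriv_eq, this.self_of_nhds]
  rw [i1, i2] at hle
  linarith

theorem curveDist_le_of_segment {x y : E} {C : ℝ}
    (hC : ∀ z ∈ segment ℝ x y, ‖T z‖ ≤ C) : curveDist T x y ≤ C * ‖y - x‖ := by
  have hγ : ContDiff ℝ 1 (fun u : ℝ => x + u • (y - x)) := by fun_prop
  have h := curveDist_le (T := T) hγ
  simp only [zero_smul, add_zero, one_smul, add_sub_cancel] at h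
  refine h.trans ?_
  have hd : ∀ u, deriv (fun u : ℝ => x + u • (y - x)) u = y - x := fun u => by
    have := ((hasDerivAt_id u).smul_const (y - x)).const_add x
    simpa using this.deriv
  have := intervalIntegral.norm_integral_le_of_norm_le_const (a := 0) (b := 1)
    (f := fun u => curveSpeed T (fun u : ℝ => x + u • (y - x)) u) (C := C * ‖y - x‖) ?_
  · simpa using (le_abs_self _).trans this
  · intro u hu
    rw [Set.uIoc_of_le zero_le_one] at hu
    rw [Real.norm_of_nonneg (curveSpeed_nonneg _ _ _)]
    simp only [curveSpeed, hd]
    refine (ContinuousLinearMap.le_opNorm _ _).trans ?_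
    refine mul_le_mul_of_nonneg_right (hC _ ?_) (norm_nonneg _)
    rw [segment_eq_image']
    exact ⟨u, ⟨hu.1.le, hu.2⟩, rfl⟩

theorem norm_sub_le_curveLength [CompleteSpace E] (hT : Continuous T) (hγ : ContDiff ℝ 1 γ)
    {C b : ℝ} (hb : 0 ≤ b)
    (hC : ∀ u ∈ Set.Icc 0 b, ∀ v, ‖v‖ ≤ C * ‖T (γ u) v‖) :
    ‖γ b - γ 0‖ ≤ C * ∫ u in (0 : ℝ)..b, curveSpeed T γ u := by
  have h2 : ∀ u, HasDerivAt γ (deriv γ u) u := fun u =>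
    ((hγ.differentiable one_ne_zero) u).hasDerivAt
  have hs := continuous_curveSpeed hT hγ
  have hd : Continuous (deriv γ) := hγ.continuous_deriv le_rfl
  rw [← intervalIntegral.integral_eq_sub_of_hasDerivAt (fun u _ => h2 u)
    (hd.intervalIntegrable _ _), ← intervalIntegral.integral_const_mul]
  refine (intervalIntegral.norm_integral_le_integral_norm hb).trans ?_
  exact intervalIntegral.integral_mono_on hb (hd.norm.intervalIntegrable _ _)
    ((hs.const_mul C).intervalIntegrable _ _) fun u hu => hC u hu _

/-- The exit time is the least time outside `U`. Up to it the curve stays in `closure U`, where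
compactness gives uniform constants. -/
theorem exists_first_exit {X : Type*} [TopologicalSpace X] {γ : ℝ → X} (hγ : Continuous γ)
    {U : Set X} (hU : IsOpen U) (h0 : γ 0 ∈ U) {b : ℝ} (hb : 0 ≤ b) (h1 : γ b ∉ U) :
    ∃ u ∈ Set.Icc 0 b, γ u ∈ closure U \ U ∧ ∀ v ∈ Set.Icc 0 u, γ v ∈ closure U := by
  set S : Set ℝ := Set.Icc 0 b ∩ γ ⁻¹' Uᶜ with hS
  have hSc : IsCompact S := isCompact_Icc.inter_right (hU.isClosed_compl.preimage hγ)
  have hSn : S.Nonempty := ⟨b, ⟨hb, le_rfl⟩, h1⟩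
  have hm : sInf S ∈ S := hSc.sInf_mem hSn
  have hlt : ∀ v, 0 ≤ v → v < sInf S → γ v ∈ U := by
    intro v hv0 hv
    by_contra hvU
    exact absurd (csInf_le hSc.bddBelow (show v ∈ S from ⟨⟨hv0, hv.le.trans hm.1.2⟩, hvU⟩))
      (not_le.2 hv)
  have hpos : 0 < sInf S := by
    refine lt_of_le_of_ne hm.1.1 fun h => hm.2 ?_
    rw [← h]; exact h0
  have hcl : γ (sInf S) ∈ closure U := by
    have h3 : Filter.Tendsto γ (𝓝[<] (sInf S)) (𝓝 (γ (sInf S))) :=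
      hγ.continuousAt.continuousWithinAt
    refine mem_closure_of_tendsto h3 ?_
    filter_upwards [Ioo_mem_nhdsLT hpos] with v hv
    exact hlt v hv.1.le hv.2
  refine ⟨sInf S, hm.1, ⟨hcl, hm.2⟩, fun v hv => ?_⟩
  rcases hv.2.eq_or_lt with h | h
  · rw [h]; exact hcl
  · exact subset_closure (hlt v hv.1 h)

theorem tendsto_curveDist_self (hT : Continuous T) (x : E) :
    Filter.Tendsto (fun y => curveDist T x y) (𝓝 x) (𝓝 0) := by
  have h1 : ∀ᶠ y in 𝓝 x, ‖T y‖ < ‖T x‖ + 1 :=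
    hT.norm.continuousAt.eventually_lt continuousAt_const (by simp)
  obtain ⟨r, hr, hball⟩ := Metric.eventually_nhds_iff_ball.1 h1
  have h2 : ∀ᶠ y in 𝓝 x, curveDist T x y ≤ (‖T x‖ + 1) * ‖y - x‖ := by
    filter_upwards [Metric.ball_mem_nhds x hr] with y hy
    refine curveDist_le_of_segment fun z hz => (hball z ?_).le
    exact (convex_ball x r).segment_subset (Metric.mem_ball_self hr) hy hz
  have h3 : Filter.Tendsto (fun y => (‖T x‖ + 1) * ‖y - x‖) (𝓝 x) (𝓝 0) := by
    have : Continuous fun y => (‖T x‖ + 1) * ‖y - x‖ := by fun_prop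
    simpa using this.tendsto x
  exact tendsto_of_tendsto_of_tendsto_of_le_of_le' tendsto_const_nhds h3
    (Filter.Eventually.of_forall fun y => curveDist_nonneg T x y) h2

theorem continuous_curveDist (hT : Continuous T) (x : E) :
    Continuous fun y => curveDist T x y := by
  rw [continuous_iff_continuousAt]
  intro y
  rw [ContinuousAt, tendsto_iff_dist_tendsto_zero]
  refine squeeze_zero (fun _ => dist_nonneg) (fun z => ?_) (tendsto_curveDist_self hT y)
  rw [Real.dist_eq, abs_le]
  have h1 := curveDist_triangle hT x z y
  have h2 := curveDist_triangle hT x y z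
  rw [curveDist_comm T z y] at h1
  constructor <;> linarith

/-- Every curve from `x` to `y` leaves the open ball of radius `‖y - x‖`. Until then `S` is bounded
on the curve, so the length is at least a fixed multiple of that radius. -/
theorem curveDist_pos [CompleteSpace E] [ProperSpace E] (hT : Continuous T) {S : E → G →L[ℝ] E}
    (hS : Continuous S) (hST : ∀ x v, S x (T x v) = v) {x y : E} (hxy : x ≠ y) :
    0 < curveDist T x y := by
  set r := ‖y - x‖ with hr
  have hr0 : 0 < r := norm_pos_iff.2 (sub_ne_zero.2 hxy.symm)
  obtain ⟨C, hC⟩ := (isCompact_closedBall x r).exists_bound_of_continuousOn hS.continuousOn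
  have hC0 : 0 ≤ C := (norm_nonneg _).trans (hC x (Metric.mem_closedBall_self hr0.le))
  have key : r / (C + 1) ≤ curveDist T x y := by
    refine le_of_forall_gt fun L hL => ?_
    obtain ⟨γ, h1, h2, h3, h4⟩ := exists_curve_of_curveDist_lt hL
    obtain ⟨u, hu, ⟨-, hu2⟩, hu3⟩ := exists_first_exit h1.continuous
      (Metric.isOpen_ball (x := x) (ε := r)) (by rw [h2]; exact Metric.mem_ball_self hr0)
      zero_le_one (by rw [h3, Metric.mem_ball, dist_eq_norm, ← hr]; exact lt_irrefl _)
    have h5 := norm_sub_le_curveLength hT h1 (C := C + 1) hu.1 fun w hw v => by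
      have h6 := hC _ (Metric.closure_ball_subset_closedBall (hu3 w hw))
      calc ‖v‖ = ‖S (γ w) (T (γ w) v)‖ := by rw [hST]
        _ ≤ ‖S (γ w)‖ * ‖T (γ w) v‖ := ContinuousLinearMap.le_opNorm _ _
        _ ≤ (C + 1) * ‖T (γ w) v‖ := by gcongr; linarith
    have h7 : r ≤ ‖γ u - γ 0‖ := by
      rw [h2]; simpa [dist_eq_norm] using hu2
    have hs := continuous_curveSpeed hT h1
    have h8 : ∫ w in (0:ℝ)..u, curveSpeed T γ w ≤ ∫ w in (0:ℝ)..1, curveSpeed T γ w := by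
      rw [← intervalIntegral.integral_add_adjacent_intervals
        (hs.intervalIntegrable 0 u) (hs.intervalIntegrable u 1)]
      have := curveLength_nonneg T γ hu.2
      linarith
    rw [div_lt_iff₀ (by linarith)]
    nlinarith
  exact lt_of_lt_of_le (by positivity) key

end Curves

/-! ### Framed flows and first-order transport of curves. -/

/-- A time-dependent vector field `f` with Jacobian `A`, together with a time-dependent frame field
`T` with left inverse `S`. -/
structure FramedFlow (E G : Type*) [NormedAddCommGroup E] [NormedSpace ℝ E]
    [NormedAddCommGroup G] [InnerProductSpace ℝ G] where
  /-- the vector field -/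
  f : E → ℝ → E
  /-- its Jacobian -/
  A : E → ℝ → E →L[ℝ] E
  /-- the frame -/
  T : E → ℝ → E →L[ℝ] G
  /-- the left inverse of the frame -/
  S : E → ℝ → G →L[ℝ] E
  continuous_f : Continuous fun p : E × ℝ => f p.1 p.2
  hasFDerivAt_f : ∀ x t, HasFDerivAt (fun y => f y t) (A x t) x
  continuous_A : Continuous fun p : E × ℝ => A p.1 p.2
  contDiff_T : ContDiff ℝ 1 fun p : E × ℝ => T p.1 p.2
  continuous_S : Continuous fun p : E × ℝ => S p.1 p.2
  S_T : ∀ x t v, S x t (T x t v) = v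

namespace FramedFlow

variable {E G : Type*} [NormedAddCommGroup E] [NormedSpace ℝ E]
    [NormedAddCommGroup G] [InnerProductSpace ℝ G] (Φ : FramedFlow E G)

/-- The total time derivative of the frame. -/
noncomputable def Tdot (x : E) (t : ℝ) : E →L[ℝ] G :=
  fderiv ℝ (fun p : E × ℝ => Φ.T p.1 p.2) (x, t) (Φ.f x t, 1)

/-- The generalized Jacobian. -/
noncomputable def F (x : E) (t : ℝ) : G →L[ℝ] G :=
  (Φ.Tdot x t + (Φ.T x t).comp (Φ.A x t)).comp (Φ.S x t)

theorem continuous_T : Continuous fun p : E × ℝ => Φ.T p.1 p.2 := Φ.contDiff_T.continuous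

theorem continuous_T_left (t : ℝ) : Continuous fun x => Φ.T x t :=
  Φ.continuous_T.comp (by fun_prop : Continuous fun x : E => (x, t))

theorem continuous_S_left (t : ℝ) : Continuous fun x => Φ.S x t :=
  Φ.continuous_S.comp (by fun_prop : Continuous fun x : E => (x, t))

theorem continuous_Tdot : Continuous fun p : E × ℝ => Φ.Tdot p.1 p.2 :=
  (Φ.contDiff_T.continuous_fderiv one_ne_zero).clm_apply
    (Φ.continuous_f.prodMk continuous_const)

theorem continuous_F : Continuous fun p : E × ℝ => Φ.F p.1 p.2 :=
  (Φ.continuous_Tdot.add (Φ.continuous_T.clm_comp Φ.continuous_A)).clm_comp Φ.continuous_S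

theorem contDiff_f (t : ℝ) : ContDiff ℝ 1 fun x => Φ.f x t := by
  rw [contDiff_one_iff_fderiv]
  refine ⟨fun x => (Φ.hasFDerivAt_f x t).differentiableAt, ?_⟩
  have : (fderiv ℝ fun x => Φ.f x t) = fun x => Φ.A x t :=
    funext fun x => (Φ.hasFDerivAt_f x t).fderiv
  rw [this]
  exact Φ.continuous_A.comp (by fun_prop : Continuous fun x : E => (x, t))

theorem F_T (x : E) (t : ℝ) (v : E) :
    Φ.F x t (Φ.T x t v) = Φ.Tdot x t v + Φ.T x t (Φ.A x t v) := by
  simp [F, Φ.S_T]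

/-- The variable is `((h, p), (x, t))`, where `p` is an end-point correction per unit time. Strict
differentiability is what makes the expansion uniform in the moving base point `(x, t)`. -/
theorem isLittleO_frame (x₀ : E) (t₀ : ℝ) :
    (fun z : (ℝ × E) × E × ℝ =>
      Φ.T (z.2.1 + z.1.1 • (Φ.f z.2.1 z.2.2 + z.1.2)) (z.2.2 + z.1.1) - Φ.T z.2.1 z.2.2
        - z.1.1 • Φ.Tdot x₀ t₀) =o[𝓝 ((0, 0), (x₀, t₀))] fun z => z.1.1 := by
  have hf := Φ.continuous_f
  have hfz : Continuous fun z : (ℝ × E) × E × ℝ => Φ.f z.2.1 z.2.2 := hf.comp continuous_snd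
  have hst := (Φ.contDiff_T.contDiffAt (x := (x₀, t₀))).hasStrictFDerivAt one_ne_zero
  set D := fderiv ℝ (fun p : E × ℝ => Φ.T p.1 p.2) (x₀, t₀) with hD
  set g : (ℝ × E) × E × ℝ → (E × ℝ) × (E × ℝ) := fun z =>
    ((z.2.1 + z.1.1 • (Φ.f z.2.1 z.2.2 + z.1.2), z.2.2 + z.1.1), z.2) with hg
  have hgc : Continuous g := by fun_prop
  have hgt : Filter.Tendsto g (𝓝 ((0, 0), (x₀, t₀))) (𝓝 ((x₀, t₀), (x₀, t₀))) := by
    have := hgc.tendsto ((0, 0), (x₀, t₀))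
    simpa [hg] using this
  have h1 := hst.isLittleO.comp_tendsto hgt
  have hdiff : ∀ z : (ℝ × E) × E × ℝ, (g z).1 - (g z).2 =
      z.1.1 • ((Φ.f z.2.1 z.2.2 + z.1.2, 1) : E × ℝ) := by
    intro z
    ext <;> simp [hg]
  have hO : ((fun p : (E × ℝ) × (E × ℝ) => p.1 - p.2) ∘ g)
      =O[𝓝 ((0, 0), (x₀, t₀))] fun z => z.1.1 := by
    have hc : Continuous fun z : (ℝ × E) × E × ℝ => ((Φ.f z.2.1 z.2.2 + z.1.2, 1) : E × ℝ) := by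
      fun_prop
    have := (Asymptotics.isBigO_refl (fun z : (ℝ × E) × E × ℝ => z.1.1)
      (𝓝 ((0, 0), (x₀, t₀)))).smul ((hc.tendsto ((0, 0), (x₀, t₀))).isBigO_one ℝ)
    refine (this.congr_left fun z => ?_).congr_right fun z => ?_
    · simp only [Function.comp_apply, hdiff]
    · simp
  have h2 := h1.trans_isBigO hO
  have h3 : (fun z : (ℝ × E) × E × ℝ =>
      z.1.1 • (D (Φ.f z.2.1 z.2.2 + z.1.2, 1) - Φ.Tdot x₀ t₀))
      =o[𝓝 ((0, 0), (x₀, t₀))] fun z => z.1.1 := by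
    have hc : Continuous fun z : (ℝ × E) × E × ℝ =>
        D (Φ.f z.2.1 z.2.2 + z.1.2, 1) - Φ.Tdot x₀ t₀ := by
      fun_prop
    have h0 := hc.tendsto ((0, 0), (x₀, t₀))
    simp only [add_zero, Tdot, ← hD, sub_self] at h0
    have := (Asymptotics.isBigO_refl (fun z : (ℝ × E) × E × ℝ => z.1.1)
      (𝓝 ((0, 0), (x₀, t₀)))).smul_isLittleO ((Asymptotics.isLittleO_one_iff ℝ).2 h0)
    refine this.congr_right fun z => ?_
    simp
  refine (h2.add h3).congr_left fun z => ?_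
  simp only [Function.comp_apply, hdiff, map_smul, smul_sub]
  simp only [hg]
  abel

theorem eventually_frame_expansion (x₀ : E) (t₀ : ℝ) {ε : ℝ} (hε : 0 < ε) :
    ∀ᶠ z : (ℝ × E) × E × ℝ in 𝓝 ((0, 0), (x₀, t₀)), ∀ v : E,
      ‖Φ.T (z.2.1 + z.1.1 • (Φ.f z.2.1 z.2.2 + z.1.2)) (z.2.2 + z.1.1)
          (v + z.1.1 • Φ.A z.2.1 z.2.2 v)
        - (Φ.T z.2.1 z.2.2 v + z.1.1 • Φ.F z.2.1 z.2.2 (Φ.T z.2.1 z.2.2 v))‖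
        ≤ ε * |z.1.1| * ‖v‖ := by
  have hfz : Continuous fun z : (ℝ × E) × E × ℝ => Φ.f z.2.1 z.2.2 :=
    Φ.continuous_f.comp continuous_snd
  have h1 := (Φ.isLittleO_frame x₀ t₀).def (show 0 < ε / 3 by positivity)
  have c1 : Continuous fun z : (ℝ × E) × E × ℝ =>
      ‖(Φ.T (z.2.1 + z.1.1 • (Φ.f z.2.1 z.2.2 + z.1.2)) (z.2.2 + z.1.1)
        - Φ.T z.2.1 z.2.2).comp (Φ.A z.2.1 z.2.2)‖ := by
    have a1 : Continuous fun z : (ℝ × E) × E × ℝ =>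
        Φ.T (z.2.1 + z.1.1 • (Φ.f z.2.1 z.2.2 + z.1.2)) (z.2.2 + z.1.1) :=
      Φ.continuous_T.comp (f := fun z : (ℝ × E) × E × ℝ =>
        (z.2.1 + z.1.1 • (Φ.f z.2.1 z.2.2 + z.1.2), z.2.2 + z.1.1)) (by fun_prop)
    have a2 : Continuous fun z : (ℝ × E) × E × ℝ => Φ.T z.2.1 z.2.2 :=
      Φ.continuous_T.comp continuous_snd
    have a3 : Continuous fun z : (ℝ × E) × E × ℝ => Φ.A z.2.1 z.2.2 :=
      Φ.continuous_A.comp continuous_snd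
    exact ((a1.sub a2).clm_comp a3).norm
  have c2 : Continuous fun z : (ℝ × E) × E × ℝ => ‖Φ.Tdot x₀ t₀ - Φ.Tdot z.2.1 z.2.2‖ :=
    (continuous_const.sub (Φ.continuous_Tdot.comp continuous_snd)).norm
  have h2 := c1.continuousAt.eventually_lt (x₀ := (((0, 0), (x₀, t₀)) : (ℝ × E) × E × ℝ))
    (continuousAt_const (y := ε / 3)) (by simpa using hε)
  have h3 := c2.continuousAt.eventually_lt (x₀ := (((0, 0), (x₀, t₀)) : (ℝ × E) × E × ℝ))
    (continuousAt_const (y := ε / 3)) (by simpa using hε)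
  filter_upwards [h1, h2, h3] with z h1 h2 h3 v
  obtain ⟨⟨h, p⟩, ⟨x, t⟩⟩ := z
  simp only at h1 h2 h3 ⊢
  rw [F_T]
  set T' := Φ.T (x + h • (Φ.f x t + p)) (t + h)
  -- The error splits into the frame remainder, the change of frame acting on `A v`, and the
  -- variation of `Tdot`. Each is at most `(ε / 3) |h| ‖v‖`.
  have e : T' (v + h • Φ.A x t v) - (Φ.T x t v + h • (Φ.Tdot x t v + Φ.T x t (Φ.A x t v)))
      = (T' - Φ.T x t - h • Φ.Tdot x₀ t₀) v + h • ((T' - Φ.T x t).comp (Φ.A x t)) v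
        + h • (Φ.Tdot x₀ t₀ - Φ.Tdot x t) v := by
    simp only [map_add, map_smul, sub_apply, smul_apply,
      ContinuousLinearMap.comp_apply, smul_add, smul_sub]
    abel
  rw [e]
  refine (norm_add₃_le).trans ?_
  have k1 := (T' - Φ.T x t - h • Φ.Tdot x₀ t₀).le_opNorm v
  have k2 := ((T' - Φ.T x t).comp (Φ.A x t)).le_opNorm v
  have k3 := (Φ.Tdot x₀ t₀ - Φ.Tdot x t).le_opNorm v
  rw [norm_smul, norm_smul, Real.norm_eq_abs]
  rw [Real.norm_eq_abs] at h1
  have hv := norm_nonneg v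
  have hh := abs_nonneg h
  calc _ ≤ (ε / 3 * |h|) * ‖v‖ + |h| * (ε / 3 * ‖v‖) + |h| * (ε / 3 * ‖v‖) := by
        refine add_le_add_three ?_ ?_ ?_
        · exact k1.trans (by gcongr)
        · exact mul_le_mul_of_nonneg_left (k2.trans (by gcongr)) hh
        · exact mul_le_mul_of_nonneg_left (k3.trans (by gcongr)) hh
    _ = _ := by ring

end FramedFlow

/-- Expand the square: the cross term contributes `2|h|c`, and the quadratic term at most `2|h|ε` by
`h2`. Together with 1 these stay below `(1 + |h|(c + ε))²`. -/
theorem norm_add_smul_apply_le {G : Type*} [NormedAddCommGroup G] [InnerProductSpace ℝ G]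
    {L : G →L[ℝ] G} {w : G} {h c ε B : ℝ} (hε : 0 ≤ ε) (hB : ‖L‖ ≤ B) (h1 : |h| * B ≤ 1)
    (h2 : |h| * B ^ 2 ≤ 2 * ε) (hc : h * inner ℝ w (L w) ≤ |h| * c * ‖w‖ ^ 2) :
    ‖w + h • L w‖ ≤ (1 + |h| * (c + ε)) * ‖w‖ := by
  rcases eq_or_ne w 0 with rfl | hw
  · simp
  have hw0 : 0 < ‖w‖ ^ 2 := by positivity
  have hLw : ‖L w‖ ≤ B * ‖w‖ := (L.le_opNorm w).trans (by gcongr)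
  have hh := abs_nonneg h
  have hB0 : 0 ≤ B := (norm_nonneg _).trans hB
  -- A numerical-range bound `c` cannot be far below `-B`. Hence the factor on the right is
  -- nonnegative and squares may be compared.
  have hlow : -(|h| * B) ≤ |h| * c := by
    have i1 : |h * inner ℝ w (L w)| ≤ |h| * B * ‖w‖ ^ 2 := by
      rw [abs_mul]
      have := abs_real_inner_le_norm w (L w)
      calc |h| * |inner ℝ w (L w)| ≤ |h| * (‖w‖ * (B * ‖w‖)) := by gcongr; exact this.trans (by gcongr)
        _ = _ := by ring
    have i2 := (abs_le.1 i1).1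
    have : -(|h| * B) * ‖w‖ ^ 2 ≤ |h| * c * ‖w‖ ^ 2 := by linarith
    exact le_of_mul_le_mul_right this hw0
  have hpos : 0 ≤ 1 + |h| * (c + ε) := by nlinarith [mul_nonneg hh hε]
  refine le_of_sq_le_sq ?_ (by positivity)
  rw [norm_add_sq_real, real_inner_smul_right, norm_smul, Real.norm_eq_abs, mul_pow, mul_pow]
  have i3 : |h| ^ 2 * ‖L w‖ ^ 2 ≤ |h| * (2 * ε) * ‖w‖ ^ 2 := by
    calc |h| ^ 2 * ‖L w‖ ^ 2 ≤ |h| ^ 2 * (B * ‖w‖) ^ 2 := by gcongr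
      _ = |h| * (|h| * B ^ 2) * ‖w‖ ^ 2 := by ring
      _ ≤ _ := by gcongr
  have i4 : 0 ≤ (|h| * (c + ε)) ^ 2 * ‖w‖ ^ 2 := by positivity
  nlinarith

namespace FramedFlow

variable {E G : Type*} [NormedAddCommGroup E] [NormedSpace ℝ E]
    [NormedAddCommGroup G] [InnerProductSpace ℝ G] (Φ : FramedFlow E G)

/-- The left inverse `S` turns the error in `‖v‖` into one in `‖T v‖`, so the estimate becomes
purely multiplicative. The neighbourhood does not depend on `c`. -/
theorem eventually_stretch_le (x₀ : E) (t₀ : ℝ) {ε : ℝ} (hε : 0 < ε) :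
    ∀ᶠ z : (ℝ × E) × E × ℝ in 𝓝 ((0, 0), (x₀, t₀)), ∀ c : ℝ,
      (∀ w, z.1.1 * inner ℝ w (Φ.F z.2.1 z.2.2 w) ≤ |z.1.1| * c * ‖w‖ ^ 2) → ∀ v : E,
      ‖Φ.T (z.2.1 + z.1.1 • (Φ.f z.2.1 z.2.2 + z.1.2)) (z.2.2 + z.1.1)
          (v + z.1.1 • Φ.A z.2.1 z.2.2 v)‖ ≤ (1 + |z.1.1| * (c + ε)) * ‖Φ.T z.2.1 z.2.2 v‖ := by
  set B := ‖Φ.F x₀ t₀‖ + 1 with hB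
  set C := ‖Φ.S x₀ t₀‖ + 1 with hC
  have hB0 : 0 < B := by positivity
  have hC0 : 0 < C := by positivity
  have h1 := Φ.eventually_frame_expansion x₀ t₀ (ε := ε / (2 * C)) (by positivity)
  have h2 : ∀ᶠ z : (ℝ × E) × E × ℝ in 𝓝 ((0, 0), (x₀, t₀)), ‖Φ.F z.2.1 z.2.2‖ < B :=
    (Φ.continuous_F.comp continuous_snd).norm.continuousAt.eventually_lt continuousAt_const
      (by simp [hB])
  have h3 : ∀ᶠ z : (ℝ × E) × E × ℝ in 𝓝 ((0, 0), (x₀, t₀)), ‖Φ.S z.2.1 z.2.2‖ < C :=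
    (Φ.continuous_S.comp continuous_snd).norm.continuousAt.eventually_lt continuousAt_const
      (by simp [hC])
  have c4 : Continuous fun z : (ℝ × E) × E × ℝ => |z.1.1| * B := by fun_prop
  have c5 : Continuous fun z : (ℝ × E) × E × ℝ => |z.1.1| * B ^ 2 := by fun_prop
  have h4 : ∀ᶠ z : (ℝ × E) × E × ℝ in 𝓝 ((0, 0), (x₀, t₀)), |z.1.1| * B < 1 :=
    c4.continuousAt.eventually_lt continuousAt_const (by simp)
  have h5 : ∀ᶠ z : (ℝ × E) × E × ℝ in 𝓝 ((0, 0), (x₀, t₀)), |z.1.1| * B ^ 2 < 2 * (ε / 2) :=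
    c5.continuousAt.eventually_lt continuousAt_const (by simpa using hε)
  filter_upwards [h1, h2, h3, h4, h5] with z h1 h2 h3 h4 h5 c hc v
  obtain ⟨⟨h, p⟩, ⟨x, t⟩⟩ := z
  simp only at h1 h2 h3 h4 h5 hc ⊢
  have k1 := norm_add_smul_apply_le (ε := ε / 2) (by positivity) h2.le h4.le h5.le
    (hc (Φ.T x t v))
  have k2 : ‖v‖ ≤ C * ‖Φ.T x t v‖ := by
    calc ‖v‖ = ‖Φ.S x t (Φ.T x t v)‖ := by rw [Φ.S_T]
      _ ≤ ‖Φ.S x t‖ * ‖Φ.T x t v‖ := ContinuousLinearMap.le_opNorm _ _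
      _ ≤ _ := by gcongr
  have k3 := h1 v
  have k4 := norm_le_norm_add_norm_sub' (Φ.T (x + h • (Φ.f x t + p)) (t + h) (v + h • Φ.A x t v))
    (Φ.T x t v + h • Φ.F x t (Φ.T x t v))
  have k5 : ε / (2 * C) * |h| * ‖v‖ ≤ |h| * (ε / 2) * ‖Φ.T x t v‖ := by
    calc ε / (2 * C) * |h| * ‖v‖ ≤ ε / (2 * C) * |h| * (C * ‖Φ.T x t v‖) := by gcongr
      _ = _ := by field_simp
  calc _ ≤ _ := k4
    _ ≤ (1 + |h| * (c + ε / 2)) * ‖Φ.T x t v‖ + |h| * (ε / 2) * ‖Φ.T x t v‖ := by linarith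
    _ = _ := by ring

/-- Transport of curves by the first-order approximation of the flow, with corrections `r₀`, `r₁`
of the end points. -/
theorem exists_transport {Q : Set (E × ℝ)} (hQ : IsCompact Q) {ε : ℝ} (hε : 0 < ε) :
    ∃ δ > 0, ∀ (h t c : ℝ) (γ : ℝ → E) (r₀ r₁ : E), |h| ≤ δ → ContDiff ℝ 1 γ →
      (∀ u ∈ Set.Icc (0 : ℝ) 1, (γ u, t) ∈ Q) →
      (∀ u ∈ Set.Icc (0 : ℝ) 1, ∀ w,
        h * inner ℝ w (Φ.F (γ u) t w) ≤ |h| * c * ‖w‖ ^ 2) →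
      ‖r₀‖ ≤ δ * |h| → ‖r₁‖ ≤ δ * |h| →
      curveDist (fun x => Φ.T x (t + h)) (γ 0 + h • Φ.f (γ 0) t + r₀) (γ 1 + h • Φ.f (γ 1) t + r₁)
        ≤ (1 + |h| * (c + ε)) * (∫ u in (0 : ℝ)..1, curveSpeed (fun x => Φ.T x t) γ u)
          + ε * |h| := by
  obtain ⟨C, hC⟩ := hQ.exists_bound_of_continuousOn Φ.continuous_T.continuousOn
  have hfz : Continuous fun z : (ℝ × E) × E × ℝ => Φ.f z.2.1 z.2.2 :=
    Φ.continuous_f.comp continuous_snd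
  have a1 : Continuous fun z : (ℝ × E) × E × ℝ =>
      Φ.T (z.2.1 + z.1.1 • (Φ.f z.2.1 z.2.2 + z.1.2)) (z.2.2 + z.1.1) :=
    Φ.continuous_T.comp (f := fun z : (ℝ × E) × E × ℝ =>
      (z.2.1 + z.1.1 • (Φ.f z.2.1 z.2.2 + z.1.2), z.2.2 + z.1.1)) (by fun_prop)
  have hev := hQ.eventually_forall_of_forall_eventually (x₀ := ((0 : ℝ), (0 : E)))
    (P := fun hp xt =>
      (∀ c : ℝ, (∀ w, hp.1 * inner ℝ w (Φ.F xt.1 xt.2 w) ≤ |hp.1| * c * ‖w‖ ^ 2) → ∀ v : E,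
        ‖Φ.T (xt.1 + hp.1 • (Φ.f xt.1 xt.2 + hp.2)) (xt.2 + hp.1) (v + hp.1 • Φ.A xt.1 xt.2 v)‖
          ≤ (1 + |hp.1| * (c + ε)) * ‖Φ.T xt.1 xt.2 v‖) ∧
      ‖Φ.T (xt.1 + hp.1 • (Φ.f xt.1 xt.2 + hp.2)) (xt.2 + hp.1)‖ < |C| + 1)
    (fun xt hxt => (Φ.eventually_stretch_le xt.1 xt.2 hε).and
      (a1.norm.continuousAt.eventually_lt continuousAt_const (by
        have := (hC xt hxt).trans (le_abs_self C)
        simp only [zero_smul, add_zero]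
        linarith)))
  obtain ⟨ρ, hρ, hball⟩ := Metric.eventually_nhds_iff_ball.1 hev
  have hC1 : 0 < |C| + 1 := by positivity
  -- The first bound keeps `h` and the correction `p` inside the ball of radius `ρ`. The second
  -- makes the extra velocity `r₁ - r₀` cost at most `ε |h|` in length.
  refine ⟨min (ρ / 2) (ε / (2 * (|C| + 1))), by positivity, ?_⟩
  intro h t c γ r₀ r₁ hh hγ hγQ hc hr₀ hr₁
  have hh1 : |h| ≤ ρ / 2 := hh.trans (min_le_left _ _)
  -- The end-point errors are spread linearly along the curve.
  set r : ℝ → E := fun u => (1 - u) • r₀ + u • r₁ with hr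
  have hrd : ∀ u, HasDerivAt r (r₁ - r₀) u := fun u => by
    have := (((hasDerivAt_id u).const_sub 1).smul_const r₀).add
      ((hasDerivAt_id u).smul_const r₁)
    exact this.congr_deriv (by simp [sub_eq_neg_add])
  have hrc : ContDiff ℝ 1 r := by fun_prop
  have hrn : ∀ u ∈ Set.Icc (0:ℝ) 1, ‖r u‖ ≤ min (ρ / 2) (ε / (2 * (|C| + 1))) * |h| := by
    intro u hu
    calc ‖r u‖ ≤ ‖(1 - u) • r₀‖ + ‖u • r₁‖ := norm_add_le _ _
      _ = (1 - u) * ‖r₀‖ + u * ‖r₁‖ := by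
        rw [norm_smul, norm_smul, Real.norm_of_nonneg hu.1,
          Real.norm_of_nonneg (by linarith [hu.2])]
      _ ≤ (1 - u) * (min (ρ / 2) (ε / (2 * (|C| + 1))) * |h|)
          + u * (min (ρ / 2) (ε / (2 * (|C| + 1))) * |h|) := by
        have := hu.1
        have := hu.2
        gcongr
      _ = _ := by ring
  set η : ℝ → E := fun u => γ u + h • Φ.f (γ u) t + r u with hη
  have hηc : ContDiff ℝ 1 η :=
    (hγ.add (((Φ.contDiff_f t).comp hγ).const_smul h)).add hrc
  have hγd : ∀ u, HasDerivAt γ (deriv γ u) u := fun u =>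
    ((hγ.differentiable one_ne_zero) u).hasDerivAt
  have hηd : ∀ u, deriv η u = (deriv γ u + h • Φ.A (γ u) t (deriv γ u)) + (r₁ - r₀) := fun u =>
    (((hγd u).add (((Φ.hasFDerivAt_f (γ u) t).comp_hasDerivAt u (hγd u)).const_smul h)).add
      (hrd u)).deriv
  have hT := Φ.continuous_T_left
  have hle := curveDist_le (T := fun x => Φ.T x (t + h)) hηc
  have e0 : η 0 = γ 0 + h • Φ.f (γ 0) t + r₀ := by simp [hη, hr]
  have e1 : η 1 = γ 1 + h • Φ.f (γ 1) t + r₁ := by simp [hη, hr]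
  rw [e0, e1] at hle
  refine hle.trans ?_
  have hs := continuous_curveSpeed (hT t) hγ
  have hs' := continuous_curveSpeed (hT (t + h)) hηc
  have hb : ∫ u in (0:ℝ)..1, ((1 + |h| * (c + ε)) * curveSpeed (fun x => Φ.T x t) γ u + ε * |h|)
      = (1 + |h| * (c + ε)) * (∫ u in (0 : ℝ)..1, curveSpeed (fun x => Φ.T x t) γ u)
          + ε * |h| := by
    rw [intervalIntegral.integral_add ((hs.const_mul _).intervalIntegrable _ _)
      (by simp), intervalIntegral.integral_const_mul]
    simp
  rw [← hb]
  refine intervalIntegral.integral_mono_on zero_le_one (hs'.intervalIntegrable _ _)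
    (((hs.const_mul _).add continuous_const).intervalIntegrable _ _) fun u hu => ?_
  -- The correction is written as `h • p` to fit the stretch estimate. For `h = 0` it vanishes,
  -- since its size is at most a multiple of `|h|`.
  obtain ⟨p, hp, hpr⟩ : ∃ p : E, ‖p‖ ≤ ρ / 2 ∧ h • p = r u := by
    rcases eq_or_ne h 0 with rfl | hne
    · have := hrn u hu
      simp only [abs_zero, mul_zero, norm_le_zero_iff] at this
      exact ⟨0, by simpa using by positivity, by simp [this]⟩
    · refine ⟨h⁻¹ • r u, ?_, by rw [smul_smul, mul_inv_cancel₀ hne, one_smul]⟩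
      rw [norm_smul, norm_inv, Real.norm_eq_abs, inv_mul_le_iff₀ (abs_pos.2 hne), mul_comm]
      exact (hrn u hu).trans (by gcongr; exact min_le_left _ _)
  have hmem : ((h, p) : ℝ × E) ∈ Metric.ball (0, 0) ρ := by
    rw [mem_ball_iff_norm]
    simp only [Prod.mk_sub_mk, sub_zero, Prod.norm_mk, Real.norm_eq_abs]
    exact max_lt (by linarith) (by linarith)
  obtain ⟨k1, k2⟩ := hball _ hmem _ (hγQ u hu)
  have k3 := k1 c (hc u hu) (deriv γ u)
  have hη' : η u = γ u + h • (Φ.f (γ u) t + p) := by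
    simp only [hη, smul_add, hpr]; abel
  simp only at k2 k3
  rw [← hη'] at k2 k3
  have k4 : ‖r₁ - r₀‖ ≤ 2 * (ε / (2 * (|C| + 1)) * |h|) := by
    have m : min (ρ / 2) (ε / (2 * (|C| + 1))) * |h| ≤ ε / (2 * (|C| + 1)) * |h| := by
      gcongr; exact min_le_right _ _
    have := norm_sub_le r₁ r₀
    linarith
  simp only [curveSpeed, hηd]
  rw [map_add]
  refine (norm_add_le _ _).trans (add_le_add k3 ?_)
  calc _ ≤ ‖Φ.T (η u) (t + h)‖ * ‖r₁ - r₀‖ := ContinuousLinearMap.le_opNorm _ _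
    _ ≤ (|C| + 1) * (2 * (ε / (2 * (|C| + 1)) * |h|)) := by gcongr
    _ = ε * |h| := by field_simp

end FramedFlow

/-! ### First-order expansions of trajectories. -/

section Trajectory

variable {E : Type*} [NormedAddCommGroup E] [NormedSpace ℝ E] {f : E → ℝ → E} {J : Set ℝ}
  {x : ℝ → E}

theorem eventually_taylor_from {t : ℝ} (hx : HasDerivWithinAt x (f (x t) t) J t) {δ : ℝ}
    (hδ : 0 < δ) :
    ∀ᶠ τ in 𝓝[J] t, ‖x τ - x t - (τ - t) • f (x t) t‖ ≤ δ * |τ - t| := by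
  have := (hasDerivWithinAt_iff_isLittleO.1 hx).def hδ
  simpa only [Real.norm_eq_abs] using this

/-- Here the velocity is taken at the moving time `τ`, as needed to transport curves from `τ` back
to `t`. Continuity of `f` along the trajectory bridges the two velocities. -/
theorem eventually_taylor_to (hf : Continuous fun p : E × ℝ => f p.1 p.2) {t : ℝ}
    (hx : HasDerivWithinAt x (f (x t) t) J t) {δ : ℝ} (hδ : 0 < δ) :
    ∀ᶠ τ in 𝓝[J] t, ‖x t - x τ - (t - τ) • f (x τ) τ‖ ≤ δ * |τ - t| := by
  have h1 := eventually_taylor_from hx (δ := δ / 2) (by positivity)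
  have h2 : Filter.Tendsto (fun τ => (x τ, τ)) (𝓝[J] t) (𝓝 (x t, t)) :=
    hx.continuousWithinAt.tendsto.prodMk_nhds (nhdsWithin_le_nhds)
  have h3 := (hf.tendsto (x t, t)).comp h2
  have h4 : ∀ᶠ τ in 𝓝[J] t, ‖f (x τ) τ - f (x t) t‖ < δ / 2 := by
    have := h3.eventually (Metric.ball_mem_nhds _ (show 0 < δ / 2 by positivity))
    filter_upwards [this] with τ hτ
    simpa [dist_eq_norm] using hτ
  filter_upwards [h1, h4] with τ h1 h4
  have e : x t - x τ - (t - τ) • f (x τ) τ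
      = -(x τ - x t - (τ - t) • f (x t) t) + (τ - t) • (f (x τ) τ - f (x t) t) := by
    module
  rw [e]
  refine (norm_add_le _ _).trans ?_
  rw [norm_neg, norm_smul, Real.norm_eq_abs]
  have : |τ - t| * ‖f (x τ) τ - f (x t) t‖ ≤ |τ - t| * (δ / 2) := by gcongr
  linarith

end Trajectory

/-! ### Difference quotients of the distance of two trajectories. -/

namespace FramedFlow

variable {E G : Type*} [NormedAddCommGroup E] [NormedSpace ℝ E]
    [NormedAddCommGroup G] [InnerProductSpace ℝ G] (Φ : FramedFlow E G)

/-- The distance of two curves, as a function of time. -/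
noncomputable def dist (x₁ x₂ : ℝ → E) (t : ℝ) : ℝ := curveDist (fun x => Φ.T x t) (x₁ t) (x₂ t)

theorem dist_nonneg (x₁ x₂ : ℝ → E) (t : ℝ) : 0 ≤ Φ.dist x₁ x₂ t := curveDist_nonneg _ _ _

/-- The closed ball around the second curve of radius the distance of the two curves. -/
def ball (x₁ x₂ : ℝ → E) (t : ℝ) : Set E :=
  {y | curveDist (fun x => Φ.T x t) (x₂ t) y ≤ Φ.dist x₁ x₂ t}

theorem self_mem_ball (x₁ x₂ : ℝ → E) (t : ℝ) : x₂ t ∈ Φ.ball x₁ x₂ t := by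
  simp only [ball, Set.mem_ofPred_eq, curveDist_self]
  exact Φ.dist_nonneg x₁ x₂ t

variable {Φ} {J : Set ℝ} {x₁ x₂ : ℝ → E}
  (hx₁ : ∀ t ∈ J, HasDerivWithinAt x₁ (Φ.f (x₁ t) t) J t)
  (hx₂ : ∀ t ∈ J, HasDerivWithinAt x₂ (Φ.f (x₂ t) t) J t)

/-- The sign `σ` handles both estimates at once: `σ = 1` uses the upper bound of the form for steps
forward in time, `σ = -1` the lower bound for steps backward. -/
theorem mul_inner_le_of_sign {σ h c : ℝ} (hσ : |σ| = 1) (hh : 0 ≤ σ * h) {L : G →L[ℝ] G}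
    (hc : ∀ w, σ * inner ℝ w (L w) ≤ c * ‖w‖ ^ 2) (w : G) :
    h * inner ℝ w (L w) ≤ |h| * c * ‖w‖ ^ 2 := by
  have e : h = |h| * σ := by
    have h1 : σ * h = |h| := by rw [← abs_of_nonneg hh, abs_mul, hσ, one_mul]
    have h2 : σ * σ = 1 := by rw [← abs_mul_abs_self, hσ, one_mul]
    rw [← h1, mul_right_comm, h2, one_mul]
  calc h * inner ℝ w (L w) = |h| * (σ * inner ℝ w (L w)) := by rw [← mul_assoc, ← e]
    _ ≤ |h| * (c * ‖w‖ ^ 2) := mul_le_mul_of_nonneg_left (hc w) (abs_nonneg h)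
    _ = _ := by ring

include hx₁ hx₂ in
theorem eventually_dist_le_of_curve {t : ℝ} (ht : t ∈ J) {γ : ℝ → E} (hγ : ContDiff ℝ 1 γ)
    (h0 : γ 0 = x₁ t) (h1 : γ 1 = x₂ t) {σ c ε : ℝ} (hσ : |σ| = 1) (hε : 0 < ε)
    (hc : ∀ u ∈ Set.Icc (0 : ℝ) 1, ∀ w, σ * inner ℝ w (Φ.F (γ u) t w) ≤ c * ‖w‖ ^ 2) :
    ∀ᶠ τ in 𝓝[J] t, 0 ≤ σ * (τ - t) → Φ.dist x₁ x₂ τ ≤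
      (1 + |τ - t| * (c + ε)) * (∫ u in (0 : ℝ)..1, curveSpeed (fun x => Φ.T x t) γ u)
        + ε * |τ - t| := by
  have hQ : IsCompact ((γ '' Set.Icc 0 1) ×ˢ {t}) :=
    (isCompact_Icc.image hγ.continuous).prod isCompact_singleton
  obtain ⟨δ, hδ, H⟩ := Φ.exists_transport hQ hε
  have e3 : ∀ᶠ τ in 𝓝[J] t, |τ - t| ≤ δ := by
    refine nhdsWithin_le_nhds ?_
    filter_upwards [Metric.closedBall_mem_nhds t hδ] with τ hτ
    simpa [Real.dist_eq] using hτ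
  filter_upwards [eventually_taylor_from (hx₁ t ht) hδ, eventually_taylor_from (hx₂ t ht) hδ, e3]
    with τ e1 e2 e3 hs
  have := H (τ - t) t c γ _ _ e3 hγ (fun u hu => ⟨⟨u, hu, rfl⟩, rfl⟩)
    (fun u hu w => mul_inner_le_of_sign hσ hs (hc u hu) w) e1 e2
  rw [h0, h1] at this
  simpa [dist] using this

theorem mul_inner_le_opNorm {σ C : ℝ} (hσ : |σ| = 1) {L : G →L[ℝ] G} (hC : ‖L‖ ≤ C) (w : G) :
    σ * inner ℝ w (L w) ≤ C * ‖w‖ ^ 2 := by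
  calc σ * inner ℝ w (L w) ≤ |σ * inner ℝ w (L w)| := le_abs_self _
    _ = |inner ℝ w (L w)| := by rw [abs_mul, hσ, one_mul]
    _ ≤ ‖w‖ * ‖L w‖ := abs_real_inner_le_norm _ _
    _ ≤ ‖w‖ * (C * ‖w‖) := by
      gcongr
      exact (L.le_opNorm w).trans (by gcongr)
    _ = _ := by ring

include hx₁ hx₂ in
-- Upper semicontinuity of the distance: one near-minimal curve at time `t` is transported both
-- ways, with the crude bound `‖F‖ ≤ C` along it. No compactness of balls is involved.
theorem eventually_dist_lt {t : ℝ} (ht : t ∈ J) {r : ℝ} (hr : Φ.dist x₁ x₂ t < r) :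
    ∀ᶠ τ in 𝓝[J] t, Φ.dist x₁ x₂ τ < r := by
  obtain ⟨γ, hγ, h0, h1, hL⟩ := exists_curve_of_curveDist_lt hr
  obtain ⟨C, hC⟩ := (isCompact_Icc (a := (0 : ℝ)) (b := 1)).exists_bound_of_continuousOn
    (f := fun u => Φ.F (γ u) t)
    (Φ.continuous_F.comp (hγ.continuous.prodMk continuous_const)).continuousOn
  have e1 := eventually_dist_le_of_curve hx₁ hx₂ ht hγ h0 h1 (σ := 1) (ε := 1) (by simp) one_pos
    (fun u hu w => mul_inner_le_opNorm (by simp) (hC u hu) w)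
  have e2 := eventually_dist_le_of_curve hx₁ hx₂ ht hγ h0 h1 (σ := -1) (ε := 1) (by simp) one_pos
    (fun u hu w => mul_inner_le_opNorm (by simp) (hC u hu) w)
  set L := ∫ u in (0 : ℝ)..1, curveSpeed (fun x => Φ.T x t) γ u
  have hcont : Continuous fun τ => (1 + |τ - t| * (C + 1)) * L + 1 * |τ - t| := by fun_prop
  have e3 : ∀ᶠ τ in 𝓝[J] t, (1 + |τ - t| * (C + 1)) * L + 1 * |τ - t| < r :=
    nhdsWithin_le_nhds (hcont.continuousAt.eventually_lt continuousAt_const (by simpa using hL))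
  filter_upwards [e1, e2, e3] with τ e1 e2 e3
  rcases le_total 0 (τ - t) with h | h
  · exact (e1 (by linarith)).trans_lt e3
  · exact (e2 (by linarith)).trans_lt e3

theorem eventually_norm_T_le (Φ : FramedFlow E G) {K : Set E} (hK : IsCompact K) (t : ℝ) {κ : ℝ}
    (hκ : 0 < κ) :
    ∀ᶠ τ in 𝓝 t, ∀ x ∈ K, ∀ v, ‖Φ.T x t v‖ ≤ (1 + κ) * ‖Φ.T x τ v‖ := by
  refine hK.eventually_forall_of_forall_eventually
    (P := fun τ x => ∀ v, ‖Φ.T x t v‖ ≤ (1 + κ) * ‖Φ.T x τ v‖) fun y _ => ?_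
  have c1 : Continuous fun z : ℝ × E => ‖Φ.T z.2 t - Φ.T z.2 z.1‖ * ‖Φ.S z.2 z.1‖ := by
    have a1 : Continuous fun z : ℝ × E => Φ.T z.2 t :=
      Φ.continuous_T.comp (f := fun z : ℝ × E => (z.2, t)) (by fun_prop)
    have a2 : Continuous fun z : ℝ × E => Φ.T z.2 z.1 :=
      Φ.continuous_T.comp (f := fun z : ℝ × E => (z.2, z.1)) (by fun_prop)
    have a3 : Continuous fun z : ℝ × E => Φ.S z.2 z.1 :=
      Φ.continuous_S.comp (f := fun z : ℝ × E => (z.2, z.1)) (by fun_prop)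
    exact (a1.sub a2).norm.mul a3.norm
  have h1 := c1.continuousAt.eventually_lt (x₀ := (t, y)) (continuousAt_const (y := κ))
    (by simpa using hκ)
  filter_upwards [h1] with z hz v
  calc ‖Φ.T z.2 t v‖ = ‖Φ.T z.2 z.1 v + (Φ.T z.2 t - Φ.T z.2 z.1) v‖ := by simp
    _ ≤ ‖Φ.T z.2 z.1 v‖ + ‖Φ.T z.2 t - Φ.T z.2 z.1‖ * ‖v‖ :=
      (norm_add_le _ _).trans (by gcongr; exact ContinuousLinearMap.le_opNorm _ _)
    _ ≤ ‖Φ.T z.2 z.1 v‖ + ‖Φ.T z.2 t - Φ.T z.2 z.1‖ * (‖Φ.S z.2 z.1‖ * ‖Φ.T z.2 z.1 v‖) := by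
      gcongr
      calc ‖v‖ = ‖Φ.S z.2 z.1 (Φ.T z.2 z.1 v)‖ := by rw [Φ.S_T]
        _ ≤ _ := ContinuousLinearMap.le_opNorm _ _
    _ = (1 + ‖Φ.T z.2 t - Φ.T z.2 z.1‖ * ‖Φ.S z.2 z.1‖) * ‖Φ.T z.2 z.1 v‖ := by ring
    _ ≤ _ := by gcongr

include hx₁ hx₂ in
/-- Near-minimal curves at nearby times stay near the ball. -/
theorem exists_confinement [ProperSpace E] {t : ℝ} (ht : t ∈ J)
    (hB : IsCompact (Φ.ball x₁ x₂ t)) {U : Set E} (hU : IsOpen U) (hBU : Φ.ball x₁ x₂ t ⊆ U) :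
    ∃ η > 0, ∀ᶠ τ in 𝓝[J] t, ∀ γ : ℝ → E, ContDiff ℝ 1 γ → γ 0 = x₂ τ →
      ∫ u in (0 : ℝ)..1, curveSpeed (fun x => Φ.T x τ) γ u ≤ Φ.dist x₁ x₂ τ + η →
      ∀ u ∈ Set.Icc (0 : ℝ) 1, γ u ∈ U := by
  obtain ⟨K, hK, hBK, hKU⟩ := exists_compact_between hB hU hBU
  set V := interior K with hV
  have hVo : IsOpen V := isOpen_interior
  have hclV : closure V ⊆ K := closure_minimal interior_subset hK.isClosed
  have hcpt : IsCompact (closure V \ V) :=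
    (hK.of_isClosed_subset isClosed_closure hclV).diff hVo
  have hT := Φ.continuous_T_left
  set s := Φ.dist x₁ x₂ with hs
  -- The boundary of `V` is compact and misses the ball, so its distance from `x₂ t` exceeds `s t`
  -- by a definite gap `g`.
  obtain ⟨m, hm, hmin⟩ := hcpt.exists_forall_le' (a := s t)
    (continuous_curveDist (hT t) (x₂ t)).continuousOn (fun y hy => by
      by_contra hcon
      exact hy.2 (hBK (not_lt.1 hcon)))
  set g := m - s t with hg
  have hg0 : 0 < g := sub_pos.2 hm
  have hs0 : 0 ≤ s t := Φ.dist_nonneg x₁ x₂ t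
  -- Chosen so that `κ (s t + g / 4) ≤ g / 8`. A curve leaving `V` would then reach the boundary
  -- within distance `g/8 + (s t + g/4) + g/8 = s t + g/2 < m`, a contradiction.
  set κ := g / (8 * (s t + g)) with hκ
  have hκ0 : 0 < κ := by positivity
  have e1 : ∀ᶠ τ in 𝓝[J] t, x₂ τ ∈ V :=
    (hx₂ t ht).continuousWithinAt.eventually_mem
      (hVo.mem_nhds (hBK (Φ.self_mem_ball x₁ x₂ t)))
  have e2 : ∀ᶠ τ in 𝓝[J] t, curveDist (fun x => Φ.T x t) (x₂ t) (x₂ τ) < g / 8 :=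
    ((tendsto_curveDist_self (hT t) (x₂ t)).comp
      (hx₂ t ht).continuousWithinAt.tendsto).eventually_lt_const (by positivity)
  have e3 := eventually_dist_lt hx₁ hx₂ ht (r := s t + g / 8) (by simp only [← hs]; linarith)
  have e4 : ∀ᶠ τ in 𝓝[J] t, _ := nhdsWithin_le_nhds (Φ.eventually_norm_T_le hK t hκ0)
  refine ⟨g / 8, by positivity, ?_⟩
  filter_upwards [e1, e2, e3, e4] with τ e1 e2 e3 e4 γ hγ h0 hL u hu
  by_contra hout
  have hout' : γ u ∉ V := fun h => hout (hKU (interior_subset h))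
  obtain ⟨b, hb, hb1, hb2⟩ := exists_first_exit hγ.continuous hVo (by rw [h0]; exact e1) hu.1 hout'
  have hcs := continuous_curveSpeed (hT τ) hγ
  have hcs' := continuous_curveSpeed (hT t) hγ
  have k1 := hmin _ hb1
  have k2 := curveDist_triangle (hT t) (x₂ t) (γ 0) (γ b)
  have k3 := curveDist_le_arc (hT t) hγ hb.1
  have k4 : ∫ u in (0 : ℝ)..b, curveSpeed (fun x => Φ.T x t) γ u ≤
      (1 + κ) * ∫ u in (0 : ℝ)..b, curveSpeed (fun x => Φ.T x τ) γ u := by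
    rw [← intervalIntegral.integral_const_mul]
    exact intervalIntegral.integral_mono_on hb.1 (hcs'.intervalIntegrable _ _)
      ((hcs.const_mul _).intervalIntegrable _ _) fun v hv => e4 _ (hclV (hb2 v hv)) _
  have k5 : ∫ u in (0 : ℝ)..b, curveSpeed (fun x => Φ.T x τ) γ u ≤
      ∫ u in (0 : ℝ)..1, curveSpeed (fun x => Φ.T x τ) γ u := by
    rw [← intervalIntegral.integral_add_adjacent_intervals
      (hcs.intervalIntegrable 0 b) (hcs.intervalIntegrable b 1)]
    have := curveLength_nonneg (fun x => Φ.T x τ) γ (hb.2.trans hu.2)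
    linarith
  rw [h0] at k2 k3
  have k6 : (1 + κ) * ∫ u in (0 : ℝ)..b, curveSpeed (fun x => Φ.T x τ) γ u
      ≤ (1 + κ) * (s t + g / 4) := by gcongr; linarith
  have k7 : κ * (s t + g / 4) ≤ g / 8 := by
    rw [hκ, div_mul_eq_mul_div, div_le_iff₀ (by positivity)]
    nlinarith
  linarith

include hx₁ hx₂ in
-- On one side of `t` a near-minimal curve at `t` is moved to `τ`; on the other a near-minimal curve
-- at `τ` is moved to `t`. In both cases `σ` times the time step is nonnegative, so one bound on `σ
-- F` controls both sides.
theorem eventually_two_sided [ProperSpace E] {t : ℝ} (ht : t ∈ J)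
    (hB : IsCompact (Φ.ball x₁ x₂ t)) {U : Set E} (hU : IsOpen U) (hBU : Φ.ball x₁ x₂ t ⊆ U)
    {σ c ε : ℝ} (hσ : |σ| = 1) (hε : 0 < ε)
    (hc : ∀ᶠ τ in 𝓝[J] t, ∀ y ∈ U, ∀ w, σ * inner ℝ w (Φ.F y τ w) ≤ c * ‖w‖ ^ 2) :
    ∀ᶠ τ in 𝓝[J] t,
      (0 ≤ σ * (τ - t) → Φ.dist x₁ x₂ τ ≤
        (1 + |τ - t| * (c + ε)) * (Φ.dist x₁ x₂ t + ε * |τ - t|) + ε * |τ - t|) ∧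
      (σ * (τ - t) ≤ 0 → Φ.dist x₁ x₂ t ≤
        (1 + |τ - t| * (c + ε)) * (Φ.dist x₁ x₂ τ + ε * |τ - t|) + ε * |τ - t|) := by
  obtain ⟨K, hK, hBK, hKU⟩ := exists_compact_between hB hU hBU
  obtain ⟨η, hη, hconf⟩ := exists_confinement hx₁ hx₂ ht hB isOpen_interior hBK
  have hQ : IsCompact (K ×ˢ Set.Icc (t - 1) (t + 1)) := hK.prod isCompact_Icc
  obtain ⟨δ, hδ, H⟩ := Φ.exists_transport hQ hε
  have near : ∀ r > 0, ∀ᶠ τ in 𝓝[J] t, |τ - t| ≤ r := fun r hr => by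
    refine nhdsWithin_le_nhds ?_
    filter_upwards [Metric.closedBall_mem_nhds t hr] with τ hτ
    simpa [Real.dist_eq] using hτ
  -- The confinement is also needed at `τ = t` itself.
  have hconf' := hconf.self_of_nhdsWithin ht
  have hc' := hc.self_of_nhdsWithin ht
  have e7 : ∀ᶠ τ in 𝓝[J] t, 0 ≤ 1 + |τ - t| * (c + ε) := by
    have hcont : Continuous fun τ => 1 + |τ - t| * (c + ε) := by fun_prop
    refine nhdsWithin_le_nhds ?_
    filter_upwards [continuousAt_const.eventually_lt hcont.continuousAt
      (show (0 : ℝ) < 1 + |t - t| * (c + ε) by simp)] with τ h using h.le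
  have curve : ∀ τ, (∀ γ : ℝ → E, ContDiff ℝ 1 γ → γ 0 = x₂ τ →
      ∫ u in (0 : ℝ)..1, curveSpeed (fun x => Φ.T x τ) γ u ≤ Φ.dist x₁ x₂ τ + η →
      ∀ u ∈ Set.Icc (0 : ℝ) 1, γ u ∈ interior K) → ∀ a : ℝ, 0 < a →
      ∃ γ : ℝ → E, ContDiff ℝ 1 γ ∧ γ 0 = x₂ τ ∧ γ 1 = x₁ τ ∧
      ∫ u in (0 : ℝ)..1, curveSpeed (fun x => Φ.T x τ) γ u ≤ Φ.dist x₁ x₂ τ + a ∧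
      ∀ u ∈ Set.Icc (0 : ℝ) 1, γ u ∈ K := by
    intro τ hcf a ha
    obtain ⟨γ, h1, h2, h3, h4⟩ := exists_curve_of_curveDist_lt
      (show curveDist (fun x => Φ.T x τ) (x₂ τ) (x₁ τ) < Φ.dist x₁ x₂ τ + min a η by
        rw [curveDist_comm]
        have : 0 < min a η := lt_min ha hη
        simp only [dist]; linarith)
    have ha' := min_le_left a η
    have hη' := min_le_right a η
    exact ⟨γ, h1, h2, h3, by linarith, fun u hu =>
      interior_subset (hcf γ h1 h2 (by linarith) u hu)⟩
  filter_upwards [hconf, hc, near δ hδ, near 1 one_pos, eventually_taylor_from (hx₁ t ht) hδ,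
    eventually_taylor_from (hx₂ t ht) hδ, eventually_taylor_to Φ.continuous_f (hx₁ t ht) hδ,
    eventually_taylor_to Φ.continuous_f (hx₂ t ht) hδ, e7]
    with τ e1 e2 e3 e4 f1 f2 b1 b2 e7
  rcases eq_or_ne τ t with rfl | hne
  · simp
  have hpos : 0 < |τ - t| := abs_pos.2 (sub_ne_zero.2 hne)
  have hmem := abs_le.1 e4
  constructor
  · intro hs
    obtain ⟨γ, h1, h2, h3, h4, h5⟩ := curve t hconf' (ε * |τ - t|) (by positivity)
    have := H (τ - t) t c γ (x₂ τ - x₂ t - (τ - t) • Φ.f (x₂ t) t)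
      (x₁ τ - x₁ t - (τ - t) • Φ.f (x₁ t) t) e3 h1 (fun u hu => ⟨h5 u hu, by constructor <;> linarith⟩)
      (fun u hu => mul_inner_le_of_sign hσ hs (hc' _ (hKU (h5 u hu))))
      f2 f1
    have e : ∀ a b c : E, a + c + (b - a - c) = b := fun a b c => by abel
    rw [h2, h3, e, e, add_sub_cancel, curveDist_comm] at this
    refine this.trans ?_
    gcongr
  · intro hs
    obtain ⟨γ, h1, h2, h3, h4, h5⟩ := curve τ e1 (ε * |τ - t|) (by positivity)
    have habs : |t - τ| = |τ - t| := abs_sub_comm _ _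
    have := H (t - τ) τ c γ (x₂ t - x₂ τ - (t - τ) • Φ.f (x₂ τ) τ)
      (x₁ t - x₁ τ - (t - τ) • Φ.f (x₁ τ) τ) (habs.trans_le e3) h1
      (fun u hu => ⟨h5 u hu, by constructor <;> linarith⟩)
      (fun u hu => mul_inner_le_of_sign hσ (by linarith) (e2 _ (hKU (h5 u hu))))
      (by rw [habs]; exact b2) (by rw [habs]; exact b1)
    have e : ∀ a b c : E, a + c + (b - a - c) = b := fun a b c => by abel
    rw [h2, h3, e, e, add_sub_cancel, curveDist_comm, habs] at this
    refine this.trans ?_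
    gcongr

include hx₁ hx₂ in
theorem eventually_slope_le [ProperSpace E] {t : ℝ} (ht : t ∈ J)
    (hB : IsCompact (Φ.ball x₁ x₂ t)) {U : Set E} (hU : IsOpen U) (hBU : Φ.ball x₁ x₂ t ⊆ U)
    {σ c ε : ℝ} (hσ : |σ| = 1) (hε : 0 < ε)
    (hc : ∀ᶠ τ in 𝓝[J] t, ∀ y ∈ U, ∀ w, σ * inner ℝ w (Φ.F y τ w) ≤ c * ‖w‖ ^ 2) :
    ∀ᶠ τ in 𝓝[J \ {t}] t,
      σ * ((Φ.dist x₁ x₂ τ - Φ.dist x₁ x₂ t) / (τ - t)) ≤ c * Φ.dist x₁ x₂ t + ε := by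
  set s := Φ.dist x₁ x₂ with hs
  have hs0 : ∀ τ, 0 ≤ s τ := fun τ => Φ.dist_nonneg x₁ x₂ τ
  -- `a` is the tolerance of the transport and `b` below the allowed oscillation of `s`. Each is
  -- responsible for at most `ε / 2` of the final error.
  set a := min 1 (ε / (2 * (s t + 4))) with ha
  have ha0 : 0 < a := by have := hs0 t; positivity
  have ha1 : a ≤ 1 := min_le_left _ _
  have ha2 : a * (s t + 4) ≤ ε / 2 := by
    have h1 : a ≤ ε / (2 * (s t + 4)) := min_le_right _ _
    have h2 : 0 < s t + 4 := by linarith [hs0 t]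
    calc a * (s t + 4) ≤ ε / (2 * (s t + 4)) * (s t + 4) := by gcongr
      _ = ε / 2 := by field_simp
  set b := min 1 (ε / (2 * (|c| + 1))) with hb
  have hb0 : 0 < b := by positivity
  have hb1 : b ≤ 1 := min_le_left _ _
  have hb2 : |c| * b ≤ ε / 2 := by
    have h1 : b ≤ ε / (2 * (|c| + 1)) := min_le_right _ _
    calc |c| * b ≤ (|c| + 1) * (ε / (2 * (|c| + 1))) := by gcongr; linarith
      _ = ε / 2 := by field_simp
  have near : ∀ r > 0, ∀ᶠ τ in 𝓝[J] t, |τ - t| ≤ r := fun r hr => by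
    refine nhdsWithin_le_nhds ?_
    filter_upwards [Metric.closedBall_mem_nhds t hr] with τ hτ
    simpa [Real.dist_eq] using hτ
  set M := (|c| + 1) * (s t + 1) + 3 with hM
  have hM0 : 0 < M := by have := hs0 t; positivity
  have key := eventually_two_sided hx₁ hx₂ ht hB hU hBU hσ ha0 hc
  have e2 := eventually_dist_lt hx₁ hx₂ ht (r := s t + b) (by simp only [← hs]; linarith)
  have hsub : 𝓝[J \ {t}] t ≤ 𝓝[J] t := nhdsWithin_mono _ Set.sdiff_subset
  filter_upwards [hsub key, hsub e2, hsub (near (b / M) (by positivity)),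
    hsub (near (1 / (|c| + 1)) (by positivity)), self_mem_nhdsWithin]
    with τ key e2 e3 e4 hτ
  have hne : τ - t ≠ 0 := sub_ne_zero.2 hτ.2
  have hpos : 0 < |τ - t| := abs_pos.2 hne
  set h := |τ - t| with hh
  have hca := le_abs_self c
  have hca0 := abs_nonneg c
  have h1 : h * (|c| + 1) ≤ 1 := by rwa [le_div_iff₀ (by positivity)] at e4
  have h2 : h * M ≤ b := by rwa [le_div_iff₀ hM0] at e3
  have h3 : h * (c + a) ≤ 1 := le_trans (by gcongr) h1
  -- The second-order term `h (c + a) · a h` is at most `a h`, because `h (c + a) ≤ 1`.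
  have expand : ∀ S : ℝ, (1 + h * (c + a)) * (S + a * h) + a * h ≤ S + h * (c * S + a * S + 3 * a) := by
    intro S
    have := mul_le_mul_of_nonneg_right h3 (mul_nonneg ha0.le hpos.le)
    nlinarith
  have hσ2 : σ * σ = 1 := by rw [← abs_mul_abs_self, hσ, one_mul]
  rcases le_total 0 (σ * (τ - t)) with hsg | hsg
  · have k1 := (key.1 hsg).trans (expand (s t))
    have hst : σ * (τ - t) = h := by rw [← abs_of_nonneg hsg, abs_mul, hσ, one_mul]
    have : σ * ((s τ - s t) / (τ - t)) = (s τ - s t) / h := by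
      rw [← hst, eq_div_iff (by rw [hst]; exact hpos.ne'), ← mul_div_assoc, div_mul_eq_mul_div,
        div_eq_iff hne]
      linear_combination (s τ - s t) * (τ - t) * hσ2
    rw [this, div_le_iff₀ hpos]
    nlinarith
  · have k1 := (key.2 hsg).trans (expand (s τ))
    have hst : σ * (τ - t) = -h := by
      rw [eq_comm, neg_eq_iff_eq_neg, ← abs_of_nonpos hsg, abs_mul, hσ, one_mul]
    have : σ * ((s τ - s t) / (τ - t)) = (s t - s τ) / h := by
      have hst' : h = -(σ * (τ - t)) := by rw [hst, neg_neg]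
      rw [eq_div_iff hpos.ne', hst', ← mul_div_assoc, div_mul_eq_mul_div, div_eq_iff hne]
      linear_combination (s t - s τ) * (τ - t) * hσ2
    rw [this, div_le_iff₀ hpos]
    -- Transport back to `t` produces the rate at `s τ` instead of `s t`. The bound `M` gives `s t ≤
    -- s τ + h M ≤ s τ + b`, which with upper semicontinuity makes the replacement cheap.
    have k2 : c * s τ + a * s τ + 3 * a ≤ M := by
      have q0 := hs0 τ
      have q1 : c * s τ ≤ |c| * (s t + 1) :=
        (mul_le_mul_of_nonneg_right hca q0).trans (by gcongr; linarith)
      have q2 : a * s τ ≤ 1 * (s t + 1) := by gcongr; linarith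
      linarith
    have k3 : |s τ - s t| ≤ b := by
      rw [abs_le]
      constructor
      · have := mul_le_mul_of_nonneg_left k2 hpos.le
        linarith
      · linarith
    have k4 : c * (s τ - s t) ≤ ε / 2 := by
      calc c * (s τ - s t) ≤ |c * (s τ - s t)| := le_abs_self _
        _ = |c| * |s τ - s t| := abs_mul _ _
        _ ≤ |c| * b := by gcongr
        _ ≤ _ := hb2
    have k5 : a * s τ + 3 * a ≤ ε / 2 := by nlinarith
    have := mul_le_mul_of_nonneg_left (show c * s τ + a * s τ + 3 * a ≤ c * s t + ε by linarith)
      hpos.le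
    linarith

end FramedFlow

/-! ### Complex matrices as real operators; numerical range of the Hermitian part. -/

section Matrices

variable {N : ℕ}

/-- The real-linear operator of a complex matrix. -/
noncomputable def matrixOp : Matrix (Fin N) (Fin N) ℂ →ₗ[ℝ]
    (EuclideanSpace ℂ (Fin N) →L[ℝ] EuclideanSpace ℂ (Fin N)) where
  toFun A := (Matrix.toEuclideanCLM (𝕜 := ℂ) A).restrictScalars ℝ
  map_add' A B := by ext v : 1; simp
  map_smul' r A := by
    ext v i
    simp [Matrix.smul_mulVec]

theorem matrixOp_apply (A : Matrix (Fin N) (Fin N) ℂ) (v : EuclideanSpace ℂ (Fin N)) :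
    matrixOp A v = WithLp.toLp 2 (A *ᵥ v.ofLp) := by
  rw [← Matrix.toEuclideanCLM_toLp]
  rfl

theorem ofLp_matrixOp (A : Matrix (Fin N) (Fin N) ℂ) (v : EuclideanSpace ℂ (Fin N)) :
    (matrixOp A v).ofLp = A *ᵥ v.ofLp := by
  rw [matrixOp_apply]

theorem matrixOp_mul (A B : Matrix (Fin N) (Fin N) ℂ) :
    matrixOp (A * B) = (matrixOp A).comp (matrixOp B) := by
  ext v : 1
  rw [ContinuousLinearMap.comp_apply, matrixOp_apply, matrixOp_apply, ofLp_matrixOp,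
    Matrix.mulVec_mulVec]

theorem matrixOp_one : matrixOp (1 : Matrix (Fin N) (Fin N) ℂ) = ContinuousLinearMap.id ℝ _ := by
  ext v : 1
  simp [matrixOp_apply]

/-- `matrixOp` as a continuous linear map on families of entries. -/
noncomputable def entriesOp : (Fin N → Fin N → ℂ) →L[ℝ]
    (EuclideanSpace ℂ (Fin N) →L[ℝ] EuclideanSpace ℂ (Fin N)) :=
  LinearMap.toContinuousLinearMap
    ((matrixOp (N := N)).comp (Matrix.ofLinearEquiv ℝ : (Fin N → Fin N → ℂ) ≃ₗ[ℝ] _).toLinearMap)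

theorem continuous_matrixOp {X : Type*} [TopologicalSpace X] {A : X → Matrix (Fin N) (Fin N) ℂ}
    (hA : Continuous A) : Continuous fun x => matrixOp (A x) :=
  entriesOp.continuous.comp hA

theorem real_inner_eq_re (w v : EuclideanSpace ℂ (Fin N)) :
    inner ℝ w v = (inner ℂ w v).re := by
  simp [PiLp.inner_apply]

theorem quadForm_conjTranspose_mul (A : Matrix (Fin N) (Fin N) ℂ) (v : EuclideanSpace ℂ (Fin N)) :
    quadForm (Aᴴ * A) v = ‖matrixOp A v‖ ^ 2 := by
  rw [← real_inner_self_eq_norm_sq, real_inner_eq_re, EuclideanSpace.inner_eq_star_dotProduct,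
    ofLp_matrixOp, quadForm, ← Matrix.mulVec_mulVec, Matrix.dotProduct_mulVec,
    ← Matrix.star_mulVec, dotProduct_comm]

theorem quadForm_one (v : EuclideanSpace ℂ (Fin N)) : quadForm 1 v = ‖v‖ ^ 2 := by
  have := quadForm_conjTranspose_mul (1 : Matrix (Fin N) (Fin N) ℂ) v
  simpa [matrixOp_one] using this

/-- The real part of `w*ᵀ A w` sees only the Hermitian part, which is diagonal in its orthonormal
eigenbasis. -/
theorem inner_matrixOp_eq_sum (A : Matrix (Fin N) (Fin N) ℂ) (w : EuclideanSpace ℂ (Fin N)) :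
    inner ℝ w (matrixOp A w) = ∑ i, hermEig A i *
      ‖inner ℂ ((hermPart_isHermitian A).eigenvectorBasis i) w‖ ^ 2 := by
  set b := (hermPart_isHermitian A).eigenvectorBasis with hb
  have hre : (star w.ofLp ⬝ᵥ (A *ᵥ w.ofLp)).re = (star w.ofLp ⬝ᵥ (hermPart A *ᵥ w.ofLp)).re := by
    have h1 : star w.ofLp ⬝ᵥ (Aᴴ *ᵥ w.ofLp) = star (star w.ofLp ⬝ᵥ (A *ᵥ w.ofLp)) := by
      rw [Matrix.star_dotProduct, Matrix.star_mulVec, Matrix.dotProduct_mulVec, dotProduct_comm,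
        ← Matrix.dotProduct_mulVec, Matrix.dotProduct_mulVec, dotProduct_comm,
        Matrix.conjTranspose_conjTranspose]
    rw [hermPart, Matrix.smul_mulVec, dotProduct_smul, Matrix.add_mulVec, dotProduct_add, h1]
    simp [Complex.add_re]
    ring
  have h2 : inner ℝ w (matrixOp A w) = (inner ℂ w (matrixOp (hermPart A) w)).re := by
    rw [real_inner_eq_re, EuclideanSpace.inner_eq_star_dotProduct,
      EuclideanSpace.inner_eq_star_dotProduct, ofLp_matrixOp, ofLp_matrixOp, dotProduct_comm, hre,
      dotProduct_comm]
  have h3 : ∀ i, inner ℂ (b i) (matrixOp (hermPart A) w) = hermEig A i * inner ℂ (b i) w := by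
    intro i
    have hH := hermPart_isHermitian A
    rw [EuclideanSpace.inner_eq_star_dotProduct, EuclideanSpace.inner_eq_star_dotProduct,
      ofLp_matrixOp, dotProduct_comm, Matrix.dotProduct_mulVec]
    have h4 : star (b i).ofLp ᵥ* hermPart A = (hermEig A i : ℂ) • star (b i).ofLp := by
      have h5 := congrArg star (hH.mulVec_eigenvectorBasis i)
      rw [Matrix.star_mulVec, hH.eq] at h5
      rw [hb, h5]
      ext j
      simp [hermEig]
    rw [h4, smul_dotProduct, dotProduct_comm, smul_eq_mul]
  rw [h2, ← b.sum_inner_mul_inner, Complex.re_sum]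
  refine Finset.sum_congr rfl fun i _ => ?_
  rw [h3, ← inner_conj_symm w (b i), mul_left_comm, mul_comm ((starRingEnd ℂ) _), Complex.mul_conj,
    Complex.re_ofReal_mul, Complex.ofReal_re, Complex.normSq_eq_norm_sq]

theorem mul_hermEig_le_iff (A : Matrix (Fin N) (Fin N) ℂ) (σ c : ℝ) :
    (∀ i, σ * hermEig A i ≤ c) ↔ ∀ w, σ * inner ℝ w (matrixOp A w) ≤ c * ‖w‖ ^ 2 := by
  set b := (hermPart_isHermitian A).eigenvectorBasis with hb
  constructor
  · intro h w
    rw [inner_matrixOp_eq_sum, ← b.sum_sq_norm_inner_right w, Finset.mul_sum, Finset.mul_sum]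
    refine Finset.sum_le_sum fun i _ => ?_
    rw [← mul_assoc]
    exact mul_le_mul_of_nonneg_right (h i) (by positivity)
  · intro h i
    have := h (b i)
    rw [inner_matrixOp_eq_sum, Finset.sum_eq_single i] at this
    · rw [← hb] at this
      simpa [b.norm_eq_one] using this
    · intro j _ hj
      rw [← hb, b.inner_eq_zero hj]
      simp
    · simp

end Matrices

/-! ### Joint continuity of the complex Jacobian. -/

section Jacobian

variable {N : ℕ} {f : EuclideanSpace ℂ (Fin N) → ℝ → EuclideanSpace ℂ (Fin N)}

theorem matrixOp_jacobian (x : EuclideanSpace ℂ (Fin N)) (t : ℝ) :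
    matrixOp (jacobian f x t) = (fderiv ℂ (fun y => f y t) x).restrictScalars ℝ := by
  have : Matrix.toEuclideanCLM (𝕜 := ℂ) (jacobian f x t) = fderiv ℂ (fun y => f y t) x := by
    refine ContinuousLinearMap.coe_injective ?_
    refine (EuclideanSpace.basisFun (Fin N) ℂ).toBasis.ext fun j => ?_
    ext i
    simp [jacobian]
  rw [← this]
  rfl

/-- By Weierstrass, locally uniform limits of holomorphic functions may be differentiated. Hence
mere continuity in the parameter gives a continuous derivative; it suffices to look along complex
lines `p + z v`. -/
theorem continuous_fderiv_of_holomorphic {E F X : Type*} [NormedAddCommGroup E] [NormedSpace ℂ E]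
    [NormedAddCommGroup F] [NormedSpace ℂ F] [CompleteSpace F] [FiniteDimensional ℂ E]
    [TopologicalSpace X] {f : E → X → F} (hf : Continuous fun p : E × X => f p.1 p.2)
    (hf' : ∀ t, Differentiable ℂ fun x => f x t) :
    Continuous fun p : E × X => fderiv ℂ (fun y => f y p.2) p.1 := by
  rw [continuous_clm_apply]
  intro v
  have hline : ∀ p : E × X, HasDerivAt (fun z : ℂ => p.1 + z • v) v 0 := fun p => by
    simpa using ((hasDerivAt_id (0 : ℂ)).smul_const v).const_add p.1
  have heq : ∀ p : E × X, fderiv ℂ (fun y => f y p.2) p.1 v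
      = deriv (fun z : ℂ => f (p.1 + z • v) p.2) 0 := fun p => by
    have h1 : HasFDerivAt (fun y => f y p.2) (fderiv ℂ (fun y => f y p.2) p.1)
        (p.1 + (0 : ℂ) • v) := by
      rw [zero_smul, add_zero]
      exact (hf' p.2 p.1).hasFDerivAt
    exact (h1.comp_hasDerivAt (0 : ℂ) (hline p)).deriv.symm
  simp only [heq]
  rw [continuous_iff_continuousAt]
  intro p
  -- Currying a jointly continuous map gives continuity for the compact-open topology, that is,
  -- locally uniform convergence in `z`.
  set g : C((E × X) × ℂ, F) := ⟨fun q => f (q.1.1 + q.2 • v) q.1.2,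
    hf.comp (f := fun q : (E × X) × ℂ => (q.1.1 + q.2 • v, q.1.2)) (by fun_prop)⟩ with hg
  have h1 := (g.curry.continuous.tendsto p)
  rw [ContinuousMap.tendsto_iff_tendstoLocallyUniformly, ← tendstoLocallyUniformlyOn_univ] at h1
  have hline' : ∀ q : E × X, Differentiable ℂ fun z : ℂ => q.1 + z • v := fun q => by fun_prop
  have h2 := h1.deriv (Filter.Eventually.of_forall fun q =>
    ((hf' q.2).comp (hline' q)).differentiableOn) isOpen_univ
  exact h2.tendsto_at (Set.mem_univ 0)

end Jacobian

/-! ### The framed flow given by `f` and `Θ`. -/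

section FramedFlowOfMatrix

variable {N : ℕ} {f : EuclideanSpace ℂ (Fin N) → ℝ → EuclideanSpace ℂ (Fin N)}
  {Θ : EuclideanSpace ℂ (Fin N) → ℝ → Matrix (Fin N) (Fin N) ℂ}

theorem continuous_frame
    (hΘ : ∀ i j, ContDiff ℝ 1 (fun p : EuclideanSpace ℂ (Fin N) × ℝ => Θ p.1 p.2 i j)) :
    Continuous fun p : EuclideanSpace ℂ (Fin N) × ℝ => Θ p.1 p.2 :=
  continuous_matrix fun i j => (hΘ i j).continuous

/-- The framed flow of a holomorphic vector field and a matrix-valued frame. -/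
noncomputable def framedFlow
    (hf : Continuous (fun p : EuclideanSpace ℂ (Fin N) × ℝ => f p.1 p.2))
    (hf' : ∀ t, Differentiable ℂ (fun x => f x t))
    (hΘ : ∀ i j, ContDiff ℝ 1 (fun p : EuclideanSpace ℂ (Fin N) × ℝ => Θ p.1 p.2 i j))
    (hΘ' : ∀ x t, IsUnit (Θ x t).det) :
    FramedFlow (EuclideanSpace ℂ (Fin N)) (EuclideanSpace ℂ (Fin N)) where
  f := f
  A x t := matrixOp (jacobian f x t)
  T x t := matrixOp (Θ x t)
  S x t := matrixOp (Θ x t)⁻¹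
  continuous_f := hf
  hasFDerivAt_f x t := by
    rw [matrixOp_jacobian]
    exact (hf' t x).hasFDerivAt.restrictScalars ℝ
  continuous_A := by
    simp only [matrixOp_jacobian]
    exact (ContinuousLinearMap.restrictScalarsL ℂ _ _ ℝ ℝ).continuous.comp
      (continuous_fderiv_of_holomorphic hf hf')
  contDiff_T := entriesOp.contDiff.comp
    (contDiff_pi.2 fun i => contDiff_pi.2 fun j => hΘ i j)
  continuous_S := by
    refine continuous_matrixOp ?_
    have hc := continuous_frame hΘ
    have : (fun p : EuclideanSpace ℂ (Fin N) × ℝ => (Θ p.1 p.2)⁻¹)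
        = fun p => (Θ p.1 p.2).det⁻¹ • (Θ p.1 p.2).adjugate := by
      ext1 p
      rw [Matrix.inv_def, Ring.inverse_eq_inv']
    rw [this]
    exact (hc.matrix_det.inv₀ fun p => (hΘ' p.1 p.2).ne_zero).smul hc.matrix_adjugate
  S_T x t v := by
    rw [← ContinuousLinearMap.comp_apply, ← matrixOp_mul, Matrix.nonsing_inv_mul _ (hΘ' x t),
      matrixOp_one]
    rfl

variable
    (hf : Continuous (fun p : EuclideanSpace ℂ (Fin N) × ℝ => f p.1 p.2))
    (hf' : ∀ t, Differentiable ℂ (fun x => f x t))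
    (hΘ : ∀ i j, ContDiff ℝ 1 (fun p : EuclideanSpace ℂ (Fin N) × ℝ => Θ p.1 p.2 i j))
    (hΘ' : ∀ x t, IsUnit (Θ x t).det)

theorem framedFlow_F (x : EuclideanSpace ℂ (Fin N)) (t : ℝ) :
    (framedFlow hf hf' hΘ hΘ').F x t = matrixOp (genJacobian f Θ x t) := by
  have hT : (framedFlow hf hf' hΘ hΘ').Tdot x t
      = matrixOp (Matrix.of (fun i j => flowDeriv f (fun y τ => Θ y τ i j) x t)) := by
    have h1 : HasFDerivAt (fun p : EuclideanSpace ℂ (Fin N) × ℝ => fun i j => Θ p.1 p.2 i j)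
        (ContinuousLinearMap.pi fun i => ContinuousLinearMap.pi fun j =>
          fderiv ℝ (fun p : EuclideanSpace ℂ (Fin N) × ℝ => Θ p.1 p.2 i j) (x, t)) (x, t) :=
      hasFDerivAt_pi.2 fun i => hasFDerivAt_pi.2 fun j =>
        ((hΘ i j).differentiable one_ne_zero (x, t)).hasFDerivAt
    have h2 := (entriesOp.hasFDerivAt.comp (x, t) h1).fderiv
    have h3 : (framedFlow hf hf' hΘ hΘ').Tdot x t
      = fderiv ℝ (entriesOp ∘ fun p : EuclideanSpace ℂ (Fin N) × ℝ => fun i j => Θ p.1 p.2 i j)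
        (x, t) (f x t, 1) := rfl
    rw [h3, h2]
    rfl
  rw [FramedFlow.F, hT, genJacobian, matrixOp_mul, map_add, matrixOp_mul]
  rfl

theorem sqrt_quadForm_metricOf (x v : EuclideanSpace ℂ (Fin N)) (t : ℝ) :
    √(quadForm (metricOf Θ x t) v) = ‖matrixOp (Θ x t) v‖ := by
  rw [metricOf, quadForm_conjTranspose_mul, Real.sqrt_sq (norm_nonneg _)]

theorem pathDist_eq_curveDist {M : EuclideanSpace ℂ (Fin N) → Matrix (Fin N) (Fin N) ℂ}
    {T : EuclideanSpace ℂ (Fin N) → EuclideanSpace ℂ (Fin N) →L[ℝ] EuclideanSpace ℂ (Fin N)}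
    (h : ∀ x v, √(quadForm (M x) v) = ‖T x v‖) (x y : EuclideanSpace ℂ (Fin N)) :
    pathDist M x y = curveDist T x y := by
  simp only [pathDist, curveDist, pathLength, IsPath, curveSpeed, h]

theorem pathLength_metricOf (γ : ℝ → EuclideanSpace ℂ (Fin N)) (t : ℝ) :
    pathLength (fun x => metricOf Θ x t) γ
      = ∫ u in (0 : ℝ)..1, curveSpeed (fun x => matrixOp (Θ x t)) γ u := by
  simp only [pathLength, curveSpeed, sqrt_quadForm_metricOf]

theorem pathDist_metricOf (x y : EuclideanSpace ℂ (Fin N)) (t : ℝ) :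
    pathDist (fun x => metricOf Θ x t) x y = curveDist (fun x => matrixOp (Θ x t)) x y :=
  pathDist_eq_curveDist (fun _ _ => sqrt_quadForm_metricOf _ _ _) x y

theorem framedFlow_dist (x₁ x₂ : ℝ → EuclideanSpace ℂ (Fin N)) :
    (framedFlow hf hf' hΘ hΘ').dist x₁ x₂ = trajDist Θ x₁ x₂ := by
  ext t
  exact (pathDist_metricOf _ _ _).symm

theorem framedFlow_ball (x₁ x₂ : ℝ → EuclideanSpace ℂ (Fin N)) (t : ℝ) :
    (framedFlow hf hf' hΘ hΘ').ball x₁ x₂ t = trajBall Θ x₁ x₂ t := by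
  ext y
  simp only [FramedFlow.ball, framedFlow_dist, trajBall, pathBall, pathDist_metricOf]
  rfl

end FramedFlowOfMatrix

/-! ### From difference quotients to exponential bounds; measurability of semicontinuous rates. -/

section RealAnalysis

open Set MeasureTheory

/-- Mean value inequality for right difference quotients, applied to `s` and to `-s`. -/
theorem abs_sub_le_of_eventually_slope_le {s : ℝ → ℝ} {a b L : ℝ} (hs : ContinuousOn s (Icc a b))
    (h : ∀ τ ∈ Icc a b, ∀ ε > 0, ∀ᶠ τ' in 𝓝[Icc a b \ {τ}] τ,
      |(s τ' - s τ) / (τ' - τ)| ≤ L + ε) {x y : ℝ} (hx : x ∈ Icc a b) (hy : y ∈ Icc a b)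
    (hxy : x ≤ y) : |s y - s x| ≤ L * (y - x) := by
  have hsub : Icc x y ⊆ Icc a b := Icc_subset_Icc hx.1 hy.2
  have key : ∀ g : ℝ → ℝ, ContinuousOn g (Icc x y) → (∀ u v, |g u - g v| = |s u - s v|) →
      g y ≤ g x + L * (y - x) := by
    intro g hg hgs
    refine image_le_of_liminf_slope_right_le_deriv_boundary (f := g)
      (B := fun z => g x + L * (z - x)) (B' := fun _ => L) hg (by simp) (by fun_prop)
      (fun z _ => ?_) (fun z hz r hr => ?_) (right_mem_Icc.2 hxy)
    · have := ((((hasDerivAt_id z).sub_const x).const_mul L).const_add (g x)).hasDerivWithinAt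
        (s := Ici z)
      simpa using this
    · have h1 := h z (hsub ⟨hz.1, hz.2.le⟩) ((r - L) / 2) (by linarith)
      have h2 : 𝓝[>] z ≤ 𝓝[Icc a b \ {z}] z := by
        rw [← nhdsWithin_Ioo_eq_nhdsGT hz.2]
        refine nhdsWithin_mono _ fun w hw => ⟨hsub ⟨hz.1.trans hw.1.le, hw.2.le⟩, ?_⟩
        exact hw.1.ne'
      refine ((Filter.Eventually.filter_mono h2 h1).and self_mem_nhdsWithin).frequently.mono fun w hw => ?_
      obtain ⟨hw1, hw2⟩ := hw
      rw [slope_def_field]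
      have : |(g w - g z) / (w - z)| ≤ L + (r - L) / 2 := by
        rwa [abs_div, hgs, ← abs_div]
      have := (le_abs_self _).trans this
      linarith
  rw [abs_le]
  have k1 := key s (hs.mono hsub) (fun _ _ => rfl)
  have k2 := key (fun u => -s u) (hs.mono hsub).neg
    (fun u v => by rw [abs_sub_comm]; congr 1; ring)
  constructor <;> linarith

theorem continuousOn_of_eventually_slope_le {s L : ℝ → ℝ} {I : Set ℝ}
    (h : ∀ τ ∈ I, ∀ᶠ τ' in 𝓝[I \ {τ}] τ, |(s τ' - s τ) / (τ' - τ)| ≤ L τ) :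
    ContinuousOn s I := by
  intro τ hτ
  rw [← continuousWithinAt_sdiff_self, ContinuousWithinAt, tendsto_iff_dist_tendsto_zero]
  have h0 : Filter.Tendsto (fun τ' => L τ * |τ' - τ|) (𝓝[I \ {τ}] τ) (𝓝 0) := by
    have : Continuous fun τ' => L τ * |τ' - τ| := by fun_prop
    simpa using (this.tendsto τ).mono_left nhdsWithin_le_nhds
  refine squeeze_zero' (Filter.Eventually.of_forall fun _ => dist_nonneg) ?_ h0
  filter_upwards [h τ hτ, self_mem_nhdsWithin] with τ' h1 h2
  have h3 : 0 < |τ' - τ| := abs_pos.2 (sub_ne_zero.2 h2.2)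
  rwa [abs_div, div_le_iff₀ h3] at h1

theorem abs_log_sub_log_le {m a b : ℝ} (hm : 0 < m) (ha : m ≤ a) (hb : m ≤ b) :
    |Real.log a - Real.log b| ≤ |a - b| / m := by
  have key : ∀ a b : ℝ, m ≤ a → m ≤ b → Real.log a - Real.log b ≤ |a - b| / m := by
    intro a b ha hb
    have ha0 := hm.trans_le ha
    have hb0 := hm.trans_le hb
    rw [← Real.log_div ha0.ne' hb0.ne']
    calc Real.log (a / b) ≤ a / b - 1 := Real.log_le_sub_one_of_pos (by positivity)
      _ = (a - b) / b := by field_simp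
      _ ≤ |a - b| / b := by gcongr; exact le_abs_self _
      _ ≤ |a - b| / m := by gcongr
  rw [abs_le]
  have := key a b ha hb
  have := key b a hb ha
  rw [abs_sub_comm b a] at this
  constructor <;> linarith

/-- Exponential bounds for a positive function from bounds of its logarithmic derivative where it
exists, together with bounds of the difference quotients. -/
theorem exp_integral_mul_le_and_le {s lmin lmax : ℝ → ℝ} {a b C : ℝ} (hab : a ≤ b)
    (hpos : ∀ τ ∈ Icc a b, 0 < s τ)
    (hslope : ∀ τ ∈ Icc a b, ∀ ε > 0, ∀ᶠ τ' in 𝓝[Icc a b \ {τ}] τ,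
      |(s τ' - s τ) / (τ' - τ)| ≤ C * s τ + ε)
    (hmin : IntervalIntegrable lmin volume a b) (hmax : IntervalIntegrable lmax volume a b)
    (hderiv : ∀ τ ∈ Ioo a b, ∀ ds, HasDerivAt s ds τ → lmin τ ≤ ds / s τ ∧ ds / s τ ≤ lmax τ) :
    Real.exp (∫ τ in a..b, lmin τ) * s a ≤ s b ∧ s b ≤ Real.exp (∫ τ in a..b, lmax τ) * s a := by
  have hcont : ContinuousOn s (Icc a b) :=
    continuousOn_of_eventually_slope_le (L := fun τ => C * s τ + 1)
      fun τ hτ => hslope τ hτ 1 one_pos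
  have ha : a ∈ Icc a b := left_mem_Icc.2 hab
  have hb : b ∈ Icc a b := right_mem_Icc.2 hab
  obtain ⟨p, hp, hpmin⟩ := isCompact_Icc.exists_isMinOn ⟨a, ha⟩ hcont
  obtain ⟨S, hS⟩ := isCompact_Icc.exists_bound_of_continuousOn hcont
  have hm := hpos p hp
  set m := s p
  set L := |C| * S with hL
  have hS0 : 0 ≤ S := (norm_nonneg _).trans (hS a ha)
  have hL0 : 0 ≤ L := by positivity
  have hCL : ∀ τ ∈ Icc a b, C * s τ ≤ L := fun τ hτ =>
    calc C * s τ ≤ |C| * ‖s τ‖ := by rw [Real.norm_eq_abs, ← abs_mul]; exact le_abs_self _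
      _ ≤ L := by rw [hL]; gcongr; exact hS τ hτ
  have hlip : ∀ x ∈ Icc a b, ∀ y ∈ Icc a b, |s y - s x| ≤ L * |y - x| := by
    have hsl : ∀ τ ∈ Icc a b, ∀ ε > 0, ∀ᶠ τ' in 𝓝[Icc a b \ {τ}] τ,
        |(s τ' - s τ) / (τ' - τ)| ≤ L + ε := fun τ hτ ε hε =>
      (hslope τ hτ ε hε).mono fun τ' h => h.trans (by linarith [hCL τ hτ])
    intro x hx y hy
    rcases le_total x y with h | h
    · rw [abs_of_nonneg (sub_nonneg.2 h)]
      exact abs_sub_le_of_eventually_slope_le hcont hsl hx hy h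
    · rw [abs_sub_comm, abs_sub_comm y, abs_of_nonneg (sub_nonneg.2 h)]
      exact abs_sub_le_of_eventually_slope_le hcont hsl hy hx h
  -- On `[m, ∞)` the logarithm is `1/m`-Lipschitz. Absolute continuity then lets the bounds on the
  -- derivative be integrated although it exists only almost everywhere.
  have hlog : LipschitzOnWith (L / m).toNNReal (fun τ => Real.log (s τ)) (uIcc a b) := by
    rw [uIcc_of_le hab]
    refine LipschitzOnWith.of_dist_le_mul fun x hx y hy => ?_
    rw [Real.dist_eq, Real.dist_eq, Real.coe_toNNReal _ (by positivity)]
    calc _ ≤ |s x - s y| / m := abs_log_sub_log_le hm (hpmin hx) (hpmin hy)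
      _ ≤ L * |x - y| / m := by gcongr; exact hlip y hy x hx
      _ = _ := by ring
  have hac := hlog.absolutelyContinuousOnInterval
  have hftc := hac.integral_deriv_eq_sub
  have hbound : ∀ᵐ τ, τ ∈ Ioo a b →
      lmin τ ≤ deriv (fun τ => Real.log (s τ)) τ ∧ deriv (fun τ => Real.log (s τ)) τ ≤ lmax τ := by
    filter_upwards [hac.ae_differentiableAt] with τ h1 hτ
    have hτ' : τ ∈ Icc a b := Ioo_subset_Icc_self hτ
    rw [uIcc_of_le hab] at h1
    have h2 := (h1 hτ').hasDerivAt
    have h3 := h2.exp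
    have h4 : s =ᶠ[𝓝 τ] fun τ => Real.exp (Real.log (s τ)) := by
      filter_upwards [Icc_mem_nhds hτ.1 hτ.2] with w hw
      rw [Real.exp_log (hpos w hw)]
    have h5 := hderiv τ hτ _ (h3.congr_of_eventuallyEq h4)
    rwa [Real.exp_log (hpos τ hτ'), mul_div_cancel_left₀ _ (hpos τ hτ').ne'] at h5
  have hae : ∀ᵐ τ ∂(volume.restrict (Icc a b)),
      lmin τ ≤ deriv (fun τ => Real.log (s τ)) τ ∧ deriv (fun τ => Real.log (s τ)) τ ≤ lmax τ := by
    rw [← restrict_Ioo_eq_restrict_Icc]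
    exact (ae_restrict_iff' measurableSet_Ioo).2 hbound
  have i1 := intervalIntegral.integral_mono_ae_restrict hab hmin hac.intervalIntegrable_deriv
    (hae.mono fun _ h => h.1)
  have i2 := intervalIntegral.integral_mono_ae_restrict hab hac.intervalIntegrable_deriv hmax
    (hae.mono fun _ h => h.2)
  rw [hftc] at i1 i2
  constructor
  · calc _ ≤ Real.exp (Real.log (s b) - Real.log (s a)) * s a := by
          have := (hpos a ha).le
          gcongr
      _ = s b := by
        rw [Real.exp_sub, Real.exp_log (hpos a ha), Real.exp_log (hpos b hb),
          div_mul_cancel₀ _ (hpos a ha).ne']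
  · calc s b = Real.exp (Real.log (s b) - Real.log (s a)) * s a := by
          rw [Real.exp_sub, Real.exp_log (hpos a ha), Real.exp_log (hpos b hb),
            div_mul_cancel₀ _ (hpos a ha).ne']
      _ ≤ _ := by
          have := (hpos a ha).le
          gcongr

theorem intervalIntegrable_of_ae_measurable_bounded {g h : ℝ → ℝ} {a b C : ℝ} (hab : a ≤ b)
    (hh : Measurable h) (hgh : ∀ τ ∈ Icc a b, g τ = h τ) (hC : ∀ τ ∈ Icc a b, |g τ| ≤ C) :
    IntervalIntegrable g volume a b := by
  have hi : IntegrableOn h (Icc a b) := by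
    refine IntegrableOn.of_bound (by simp) hh.aestronglyMeasurable C ?_
    exact (ae_restrict_iff' measurableSet_Icc).2
      (Filter.Eventually.of_forall fun τ hτ => by rw [← hgh τ hτ]; exact hC τ hτ)
  rw [intervalIntegrable_iff_integrableOn_Icc_of_le hab]
  exact hi.congr_fun (fun τ hτ => (hgh τ hτ).symm) measurableSet_Icc

theorem intervalIntegrable_toReal_of_usc {h : ℝ → EReal} {a b C : ℝ} (hab : a ≤ b)
    (hh : ∀ τ ∈ Icc a b, ∀ z : ℝ, h τ < z → ∀ᶠ τ' in 𝓝[Icc a b] τ, h τ' ≤ z)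
    (hC : ∀ τ ∈ Icc a b, |(h τ).toReal| ≤ C) :
    IntervalIntegrable (fun τ => (h τ).toReal) volume a b := by
  -- Extending by the projection onto `[a, b]` keeps semicontinuity and yields a Borel function on
  -- the line.
  have husc : UpperSemicontinuous fun τ => h (projIcc a b hab τ) := by
    intro τ y hy
    obtain ⟨z, hz1, hz2⟩ := EReal.lt_iff_exists_real_btwn.1 hy
    have h1 := hh _ (projIcc a b hab τ).2 z hz1
    have h2 : Filter.Tendsto (fun τ => (projIcc a b hab τ : ℝ)) (𝓝 τ)
        (𝓝[Icc a b] (projIcc a b hab τ : ℝ)) :=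
      tendsto_nhdsWithin_iff.2 ⟨(continuous_subtype_val.comp continuous_projIcc).tendsto τ,
        Filter.Eventually.of_forall fun _ => Subtype.coe_prop _⟩
    exact (h2.eventually h1).mono fun _ hw => hw.trans_lt hz2
  exact intervalIntegrable_of_ae_measurable_bounded hab husc.measurable.ereal_toReal
    (fun τ hτ => by rw [projIcc_of_mem hab hτ]) hC

theorem intervalIntegrable_toReal_of_lsc {h : ℝ → EReal} {a b C : ℝ} (hab : a ≤ b)
    (hh : ∀ τ ∈ Icc a b, ∀ z : ℝ, z < h τ → ∀ᶠ τ' in 𝓝[Icc a b] τ, z ≤ h τ')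
    (hC : ∀ τ ∈ Icc a b, |(h τ).toReal| ≤ C) :
    IntervalIntegrable (fun τ => (h τ).toReal) volume a b := by
  have h1 := intervalIntegrable_toReal_of_usc (h := fun τ => -h τ) hab (C := C)
    (fun τ hτ z hz => by
      have := hh τ hτ (-z) (by rw [EReal.coe_neg]; exact EReal.neg_lt_comm.1 hz)
      filter_upwards [this] with w hw
      rw [EReal.coe_neg] at hw
      exact EReal.neg_le_of_neg_le hw)
    (fun τ hτ => by rw [EReal.toReal_neg_eq, abs_neg]; exact hC τ hτ)
  simp only [EReal.toReal_neg_eq] at h1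
  simpa only [Pi.neg_def, neg_neg] using h1.neg

end RealAnalysis

/-! ### Dini logarithmic derivatives. -/

section LogRates

variable {s : ℝ → ℝ} {S : Set ℝ} {t : ℝ} {r : EReal}

theorem upperLogRate_le (hs : 0 < s t)
    (h : ∀ z : ℝ, r < z → ∀ ε > 0, ∀ᶠ τ in 𝓝[S \ {t}] t, (s τ - s t) / (τ - t) ≤ z * s t + ε) :
    upperLogRate s S t ≤ r := by
  refine EReal.le_of_forall_lt_iff_le.1 fun z hz => ?_
  obtain ⟨z', hz', hz''⟩ := EReal.lt_iff_exists_real_btwn.1 hz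
  have hlt : z' < z := EReal.coe_lt_coe_iff.1 hz''
  refine Filter.limsup_le_of_le ?_ ?_
  · isBoundedDefault
  filter_upwards [h z' hz' ((z - z') * s t) (mul_pos (sub_pos.2 hlt) hs)] with τ hτ
  rw [EReal.coe_le_coe_iff, div_le_iff₀ hs]
  linarith

theorem le_lowerLogRate (hs : 0 < s t)
    (h : ∀ z : ℝ, z < r → ∀ ε > 0, ∀ᶠ τ in 𝓝[S \ {t}] t, z * s t - ε ≤ (s τ - s t) / (τ - t)) :
    r ≤ lowerLogRate s S t := by
  refine EReal.ge_of_forall_gt_iff_ge.1 fun z hz => ?_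
  obtain ⟨z', hz', hz''⟩ := EReal.lt_iff_exists_real_btwn.1 hz
  have hlt : z < z' := EReal.coe_lt_coe_iff.1 hz'
  refine Filter.le_liminf_of_le ?_ ?_
  · isBoundedDefault
  filter_upwards [h z' hz'' ((z' - z) * s t) (mul_pos (sub_pos.2 hlt) hs)] with τ hτ
  rw [EReal.coe_le_coe_iff, le_div_iff₀ hs]
  linarith

theorem tendsto_logRate {ds : ℝ} (h : HasDerivWithinAt s ds S t) :
    Filter.Tendsto (fun τ => (((s τ - s t) / (τ - t) / s t : ℝ) : EReal)) (𝓝[S \ {t}] t)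
      (𝓝 ((ds / s t : ℝ) : EReal)) := by
  refine (continuous_coe_real_ereal.tendsto _).comp ?_
  have := (hasDerivWithinAt_iff_tendsto_slope.1 h).div_const (s t)
  simpa only [slope_def_field] using this

theorem upperLogRate_eq {ds : ℝ} [(𝓝[S \ {t}] t).NeBot] (h : HasDerivWithinAt s ds S t) :
    upperLogRate s S t = ((ds / s t : ℝ) : EReal) := (tendsto_logRate h).limsup_eq

theorem lowerLogRate_eq {ds : ℝ} [(𝓝[S \ {t}] t).NeBot] (h : HasDerivWithinAt s ds S t) :
    lowerLogRate s S t = ((ds / s t : ℝ) : EReal) := (tendsto_logRate h).liminf_eq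

end LogRates

/-! ### Local uniformity over compact balls and uniqueness of trajectories. -/

namespace FramedFlow

variable {E G : Type*} [NormedAddCommGroup E] [NormedSpace ℝ E]
    [NormedAddCommGroup G] [InnerProductSpace ℝ G] {Φ : FramedFlow E G}

/-- The slack `c' - c` absorbs the variation of `F`, and compactness of `K` makes the neighbourhoods
in space and time uniform. -/
theorem exists_open_mul_inner_le {K : Set E} (hK : IsCompact K) {t σ c c' : ℝ} (hσ : |σ| = 1)
    (hcc : c < c') (hc : ∀ y ∈ K, ∀ w, σ * inner ℝ w (Φ.F y t w) ≤ c * ‖w‖ ^ 2) :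
    ∃ U : Set E, IsOpen U ∧ K ⊆ U ∧
      ∀ᶠ τ in 𝓝 t, ∀ y ∈ U, ∀ w, σ * inner ℝ w (Φ.F y τ w) ≤ c' * ‖w‖ ^ 2 := by
  set P : ℝ × E → Prop := fun z => ∀ w, σ * inner ℝ w (Φ.F z.2 z.1 w) ≤ c' * ‖w‖ ^ 2 with hP
  have hloc : ∀ y ∈ K, ∀ᶠ z : ℝ × E in 𝓝 (t, y), P z := fun y hy => by
    have hcont : Continuous fun z : ℝ × E => ‖Φ.F z.2 z.1 - Φ.F y t‖ :=
      ((Φ.continuous_F.comp (f := fun z : ℝ × E => (z.2, z.1)) (by fun_prop)).sub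
        continuous_const).norm
    have h1 := hcont.continuousAt.eventually_lt (x₀ := (t, y)) (continuousAt_const (y := c' - c))
      (by simpa using hcc)
    filter_upwards [h1] with z hz w
    have h2 := mul_inner_le_opNorm hσ hz.le w
    have h3 := hc y hy w
    rw [sub_apply, inner_sub_right] at h2
    linarith
  have hmem : ∀ᶠ z in 𝓝 t ×ˢ 𝓝ˢ K, P z :=
    hK.mem_prod_nhdsSet_of_forall fun y hy => nhds_prod_eq (x := t) (y := y) ▸ hloc y hy
  obtain ⟨pa, ha, pb, hb, hab⟩ := Filter.eventually_prod_iff.1 hmem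
  obtain ⟨U, hU, hKU, hUB⟩ := mem_nhdsSet_iff_exists.1 hb
  exact ⟨U, hU, hKU, ha.mono fun τ hτ y hy => hab hτ (hUB hy)⟩

/-- Each point of the ball at time `τ` is the end of a curve from `x₂ τ` of length at most `s τ +
η`, to which confinement applies. -/
theorem eventually_ball_subset [ProperSpace E] {J : Set ℝ} {x₁ x₂ : ℝ → E}
    (hx₁ : ∀ t ∈ J, HasDerivWithinAt x₁ (Φ.f (x₁ t) t) J t)
    (hx₂ : ∀ t ∈ J, HasDerivWithinAt x₂ (Φ.f (x₂ t) t) J t) {t : ℝ} (ht : t ∈ J)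
    (hB : IsCompact (Φ.ball x₁ x₂ t)) {U : Set E} (hU : IsOpen U) (hBU : Φ.ball x₁ x₂ t ⊆ U) :
    ∀ᶠ τ in 𝓝[J] t, Φ.ball x₁ x₂ τ ⊆ U := by
  obtain ⟨η, hη, h⟩ := exists_confinement hx₁ hx₂ ht hB hU hBU
  filter_upwards [h] with τ hτ y hy
  have hy' : curveDist (fun x => Φ.T x τ) (x₂ τ) y ≤ Φ.dist x₁ x₂ τ := hy
  obtain ⟨γ, h1, h2, h3, h4⟩ := exists_curve_of_curveDist_lt
    (hy'.trans_lt (lt_add_of_pos_right _ hη))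
  rw [← h3]
  exact hτ γ h1 h2 h4.le 1 ⟨zero_le_one, le_rfl⟩

theorem exists_eventually_norm_F_le [ProperSpace E] {J : Set ℝ} {x₁ x₂ : ℝ → E}
    (hx₁ : ∀ t ∈ J, HasDerivWithinAt x₁ (Φ.f (x₁ t) t) J t)
    (hx₂ : ∀ t ∈ J, HasDerivWithinAt x₂ (Φ.f (x₂ t) t) J t) {t : ℝ} (ht : t ∈ J)
    (hB : IsCompact (Φ.ball x₁ x₂ t)) :
    ∃ C, ∀ᶠ τ in 𝓝[J] t, ∀ y ∈ Φ.ball x₁ x₂ τ, ‖Φ.F y τ‖ ≤ C := by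
  obtain ⟨K, hK, hBK⟩ := exists_compact_superset hB
  obtain ⟨C, hC⟩ := (hK.prod (isCompact_Icc (a := t - 1) (b := t + 1))).exists_bound_of_continuousOn
    Φ.continuous_F.continuousOn
  refine ⟨C, ?_⟩
  filter_upwards [eventually_ball_subset hx₁ hx₂ ht hB isOpen_interior hBK,
    nhdsWithin_le_nhds (Icc_mem_nhds (show t - 1 < t by linarith) (show t < t + 1 by linarith))]
    with τ h1 h2 y hy
  exact hC (y, τ) ⟨interior_subset (h1 hy), h2⟩

theorem exists_norm_F_le [ProperSpace E] {J : Set ℝ} {x₁ x₂ : ℝ → E}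
    (hx₁ : ∀ t ∈ J, HasDerivWithinAt x₁ (Φ.f (x₁ t) t) J t)
    (hx₂ : ∀ t ∈ J, HasDerivWithinAt x₂ (Φ.f (x₂ t) t) J t) {I : Set ℝ} (hI : IsCompact I)
    (hIJ : I ⊆ J) (hB : ∀ t ∈ I, IsCompact (Φ.ball x₁ x₂ t)) :
    ∃ C, 0 ≤ C ∧ ∀ τ ∈ I, ∀ y ∈ Φ.ball x₁ x₂ τ, ‖Φ.F y τ‖ ≤ C := by
  refine hI.induction_on (p := fun S => ∃ C, 0 ≤ C ∧ ∀ τ ∈ S, ∀ y ∈ Φ.ball x₁ x₂ τ, ‖Φ.F y τ‖ ≤ C)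
    ⟨0, le_rfl, by simp⟩ ?_ ?_ ?_
  · rintro A B hAB ⟨C, h0, hC⟩
    exact ⟨C, h0, fun τ hτ => hC τ (hAB hτ)⟩
  · rintro A B ⟨C, h0, hC⟩ ⟨D, h0', hD⟩
    refine ⟨max C D, le_max_of_le_left h0, ?_⟩
    rintro τ (hτ | hτ) y hy
    · exact (hC τ hτ y hy).trans (le_max_left _ _)
    · exact (hD τ hτ y hy).trans (le_max_right _ _)
  · intro t ht
    obtain ⟨C, hC⟩ := exists_eventually_norm_F_le hx₁ hx₂ (hIJ ht) (hB t ht)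
    exact ⟨_, nhdsWithin_mono _ hIJ hC, max C 0, le_max_right _ _,
      fun τ hτ y hy => (hτ y hy).trans (le_max_left _ _)⟩

theorem lipschitzOnWith_f [ProperSpace E] (Φ : FramedFlow E G) (r : ℝ) {I : Set ℝ}
    (hI : IsCompact I) :
    ∃ K, ∀ t ∈ I, LipschitzOnWith K (fun x => Φ.f x t) (Metric.closedBall 0 r) := by
  obtain ⟨C, hC⟩ := ((isCompact_closedBall (0 : E) r).prod hI).exists_bound_of_continuousOn
    Φ.continuous_A.continuousOn
  refine ⟨C.toNNReal, fun t ht => (convex_closedBall 0 r).lipschitzOnWith_of_nnnorm_hasFDerivWithin_le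
    (f' := fun x => Φ.A x t)
    (fun x _ => (Φ.hasFDerivAt_f x t).hasFDerivWithinAt) fun x hx => ?_⟩
  rw [← NNReal.coe_le_coe, coe_nnnorm]
  exact (hC (x, t) ⟨hx, ht⟩).trans (Real.le_coe_toNNReal C)

/-- The continuous Jacobian makes `f` Lipschitz in `x` on a ball containing both trajectories over a
compact time interval. Uniqueness is applied forward and backward in time. -/
theorem eq_of_eq_at [ProperSpace E] {J : Set ℝ} (hJ : J.OrdConnected) {x₁ x₂ : ℝ → E}
    (hx₁ : ∀ t ∈ J, HasDerivWithinAt x₁ (Φ.f (x₁ t) t) J t)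
    (hx₂ : ∀ t ∈ J, HasDerivWithinAt x₂ (Φ.f (x₂ t) t) J t) {t₀ t : ℝ} (ht₀ : t₀ ∈ J) (ht : t ∈ J)
    (h : x₁ t₀ = x₂ t₀) : x₁ t = x₂ t := by
  have setup : ∀ a ∈ J, ∀ b ∈ J, ∃ K r, (∀ t ∈ Set.Icc a b,
      LipschitzOnWith K (fun x => Φ.f x t) (Metric.closedBall 0 r)) ∧
      ContinuousOn x₁ (Set.Icc a b) ∧ ContinuousOn x₂ (Set.Icc a b) ∧
      (∀ t ∈ Set.Icc a b, x₁ t ∈ Metric.closedBall 0 r) ∧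
      (∀ t ∈ Set.Icc a b, x₂ t ∈ Metric.closedBall 0 r) := by
    intro a ha b hb
    have hsub := hJ.out ha hb
    have c₁ : ContinuousOn x₁ (Set.Icc a b) := fun t ht =>
      (hx₁ t (hsub ht)).continuousWithinAt.mono hsub
    have c₂ : ContinuousOn x₂ (Set.Icc a b) := fun t ht =>
      (hx₂ t (hsub ht)).continuousWithinAt.mono hsub
    obtain ⟨r₁, h₁⟩ := isCompact_Icc.exists_bound_of_continuousOn c₁
    obtain ⟨r₂, h₂⟩ := isCompact_Icc.exists_bound_of_continuousOn c₂
    obtain ⟨K, hK⟩ := Φ.lipschitzOnWith_f (max r₁ r₂) (isCompact_Icc (a := a) (b := b))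
    refine ⟨K, max r₁ r₂, hK, c₁, c₂, fun t ht => ?_, fun t ht => ?_⟩
    · simpa using Or.inl (h₁ t ht)
    · simpa using Or.inr (h₂ t ht)
  rcases le_total t₀ t with hle | hle
  · obtain ⟨K, r, hK, c₁, c₂, m₁, m₂⟩ := setup t₀ ht₀ t ht
    have hsub := hJ.out ht₀ ht
    have hd : ∀ x : ℝ → E, (∀ t ∈ J, HasDerivWithinAt x (Φ.f (x t) t) J t) →
        ∀ τ ∈ Set.Ico t₀ t, HasDerivWithinAt x (Φ.f (x τ) τ) (Set.Ici τ) τ := fun x hx τ hτ => by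
      refine (hx τ (hsub ⟨hτ.1, hτ.2.le⟩)).mono_of_mem_nhdsWithin ?_
      exact Filter.mem_of_superset (Icc_mem_nhdsGE hτ.2) fun w hw => hsub ⟨hτ.1.trans hw.1, hw.2⟩
    exact ODE_solution_unique_of_mem_Icc_right (v := fun t x => Φ.f x t)
      (s := fun _ => Metric.closedBall 0 r) (fun τ hτ => hK τ ⟨hτ.1, hτ.2.le⟩) c₁ (hd x₁ hx₁)
      (fun τ hτ => m₁ τ ⟨hτ.1, hτ.2.le⟩) c₂ (hd x₂ hx₂) (fun τ hτ => m₂ τ ⟨hτ.1, hτ.2.le⟩) h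
      (Set.right_mem_Icc.2 hle)
  · obtain ⟨K, r, hK, c₁, c₂, m₁, m₂⟩ := setup t ht t₀ ht₀
    have hsub := hJ.out ht ht₀
    have hd : ∀ x : ℝ → E, (∀ t ∈ J, HasDerivWithinAt x (Φ.f (x t) t) J t) →
        ∀ τ ∈ Set.Ioc t t₀, HasDerivWithinAt x (Φ.f (x τ) τ) (Set.Iic τ) τ := fun x hx τ hτ => by
      refine (hx τ (hsub ⟨hτ.1.le, hτ.2⟩)).mono_of_mem_nhdsWithin ?_
      exact Filter.mem_of_superset (Icc_mem_nhdsLE hτ.1) fun w hw => hsub ⟨hw.1, hw.2.trans hτ.2⟩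
    exact ODE_solution_unique_of_mem_Icc_left (v := fun t x => Φ.f x t)
      (s := fun _ => Metric.closedBall 0 r) (fun τ hτ => hK τ ⟨hτ.1.le, hτ.2⟩) c₁ (hd x₁ hx₁)
      (fun τ hτ => m₁ τ ⟨hτ.1.le, hτ.2⟩) c₂ (hd x₂ hx₂) (fun τ hτ => m₂ τ ⟨hτ.1.le, hτ.2⟩) h
      (Set.left_mem_Icc.2 hle)

end FramedFlow

/-! ### Comparison of the length distance with the norm. -/

section CurveComparison

variable {E G : Type*} [NormedAddCommGroup E] [NormedSpace ℝ E]
  [NormedAddCommGroup G] [NormedSpace ℝ G] {T : E → E →L[ℝ] G} {γ : ℝ → E}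

/-- It places a minimizer inside the ball around its end point. -/
theorem curveDist_le_of_curve_end (hT : Continuous T) (hγ : ContDiff ℝ 1 γ) {u : ℝ}
    (hu : u ∈ Set.Icc (0 : ℝ) 1) :
    curveDist T (γ 1) (γ u) ≤ ∫ u in (0 : ℝ)..1, curveSpeed T γ u := by
  have hs := continuous_curveSpeed hT hγ
  rw [curveDist_comm]
  refine (curveDist_le_arc hT hγ hu.2).trans ?_
  rw [← intervalIntegral.integral_add_adjacent_intervals
    (hs.intervalIntegrable 0 u) (hs.intervalIntegrable u 1)]
  have := curveLength_nonneg T γ hu.1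
  linarith

theorem norm_sub_le_mul_curveDist [CompleteSpace E] (hT : Continuous T) {C : ℝ} (hC : 0 ≤ C)
    (h : ∀ x v, ‖v‖ ≤ C * ‖T x v‖) (x y : E) : ‖y - x‖ ≤ C * curveDist T x y := by
  refine le_of_forall_pos_lt_add fun ε hε => ?_
  obtain ⟨γ, h1, h2, h3, h4⟩ := exists_curve_of_curveDist_lt
    (show curveDist T x y < curveDist T x y + ε / (C + 1) by linarith [show 0 < ε / (C + 1) by positivity])
  have h5 := norm_sub_le_curveLength hT h1 zero_le_one fun u _ v => h (γ u) v
  rw [h2, h3] at h5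
  have h7 : C * (ε / (C + 1)) < ε := by
    rw [← mul_div_assoc, div_lt_iff₀ (by positivity)]
    nlinarith
  calc _ ≤ _ := h5
    _ ≤ C * (curveDist T x y + ε / (C + 1)) := by gcongr
    _ < _ := by linarith

theorem curveDist_id [CompleteSpace E] (x y : E) :
    curveDist (fun _ : E => ContinuousLinearMap.id ℝ E) x y = ‖x - y‖ := by
  refine le_antisymm ?_ ?_
  · have := curveDist_le_of_segment (T := fun _ : E => ContinuousLinearMap.id ℝ E) (x := x) (y := y)
      (C := 1) fun z _ => ContinuousLinearMap.norm_id_le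
    rwa [one_mul, norm_sub_rev] at this
  · have := norm_sub_le_mul_curveDist (T := fun _ : E => ContinuousLinearMap.id ℝ E)
      continuous_const zero_le_one (by simp) x y
    rwa [one_mul, norm_sub_rev] at this

end CurveComparison

theorem pathDist_one {N : ℕ} (x y : EuclideanSpace ℂ (Fin N)) :
    pathDist (fun _ => 1) x y = ‖x - y‖ := by
  rw [← curveDist_id, pathDist_eq_curveDist]
  intro x v
  rw [quadForm_one, Real.sqrt_sq (norm_nonneg _)]
  rfl

/-! ### Rate bounds at a fixed time. -/

section Rates

variable {N : ℕ} {f : EuclideanSpace ℂ (Fin N) → ℝ → EuclideanSpace ℂ (Fin N)}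
  {Θ : EuclideanSpace ℂ (Fin N) → ℝ → Matrix (Fin N) (Fin N) ℂ}
  {x₁ x₂ : ℝ → EuclideanSpace ℂ (Fin N)} {t : ℝ}

theorem hermEig_le_rateMax {y : EuclideanSpace ℂ (Fin N)} (hy : y ∈ trajBall Θ x₁ x₂ t)
    (i : Fin N) : ((hermEig (genJacobian f Θ y t) i : ℝ) : EReal) ≤ rateMax f Θ x₁ x₂ t :=
  le_iSup₂_of_le y hy (le_iSup (fun i => ((hermEig (genJacobian f Θ y t) i : ℝ) : EReal)) i)

theorem rateMin_le_hermEig {y : EuclideanSpace ℂ (Fin N)} (hy : y ∈ trajBall Θ x₁ x₂ t)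
    (i : Fin N) : rateMin f Θ x₁ x₂ t ≤ ((hermEig (genJacobian f Θ y t) i : ℝ) : EReal) :=
  iInf₂_le_of_le y hy (iInf_le (fun i => ((hermEig (genJacobian f Θ y t) i : ℝ) : EReal)) i)

theorem rateMax_le {r : EReal} (h : ∀ y ∈ trajBall Θ x₁ x₂ t, ∀ i,
    ((hermEig (genJacobian f Θ y t) i : ℝ) : EReal) ≤ r) : rateMax f Θ x₁ x₂ t ≤ r :=
  iSup₂_le fun y hy => iSup_le (h y hy)

theorem le_rateMin {r : EReal} (h : ∀ y ∈ trajBall Θ x₁ x₂ t, ∀ i,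
    r ≤ ((hermEig (genJacobian f Θ y t) i : ℝ) : EReal)) : r ≤ rateMin f Θ x₁ x₂ t :=
  le_iInf₂ fun y hy => le_iInf (h y hy)

variable
    (hf : Continuous (fun p : EuclideanSpace ℂ (Fin N) × ℝ => f p.1 p.2))
    (hf' : ∀ t, Differentiable ℂ (fun x => f x t))
    (hΘ : ∀ i j, ContDiff ℝ 1 (fun p : EuclideanSpace ℂ (Fin N) × ℝ => Θ p.1 p.2 i j))
    (hΘ' : ∀ x t, IsUnit (Θ x t).det)

theorem mul_inner_F_le_iff (y : EuclideanSpace ℂ (Fin N)) (t σ c : ℝ) :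
    (∀ w, σ * inner ℝ w ((framedFlow hf hf' hΘ hΘ').F y t w) ≤ c * ‖w‖ ^ 2)
      ↔ ∀ i, σ * hermEig (genJacobian f Θ y t) i ≤ c := by
  rw [framedFlow_F, mul_hermEig_le_iff]

/-- Working with reals above the rate covers the infinite values too. The strict gap `c < z` is what
the compactness argument consumes. -/
theorem inner_F_le_of_rateMax_lt {z : ℝ} (h : rateMax f Θ x₁ x₂ t < z) :
    ∃ c < z, ∀ y ∈ trajBall Θ x₁ x₂ t, ∀ w,
      1 * inner ℝ w ((framedFlow hf hf' hΘ hΘ').F y t w) ≤ c * ‖w‖ ^ 2 := by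
  obtain ⟨c, h1, h2⟩ := EReal.lt_iff_exists_real_btwn.1 h
  refine ⟨c, EReal.coe_lt_coe_iff.1 h2, fun y hy => ?_⟩
  rw [mul_inner_F_le_iff]
  intro i
  rw [one_mul]
  exact EReal.coe_le_coe_iff.1 ((hermEig_le_rateMax hy i).trans h1.le)

theorem neg_inner_F_le_of_lt_rateMin {z : ℝ} (h : z < rateMin f Θ x₁ x₂ t) :
    ∃ c < -z, ∀ y ∈ trajBall Θ x₁ x₂ t, ∀ w,
      -1 * inner ℝ w ((framedFlow hf hf' hΘ hΘ').F y t w) ≤ c * ‖w‖ ^ 2 := by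
  obtain ⟨c, h1, h2⟩ := EReal.lt_iff_exists_real_btwn.1 h
  refine ⟨-c, neg_lt_neg (EReal.coe_lt_coe_iff.1 h1), fun y hy => ?_⟩
  rw [mul_inner_F_le_iff]
  intro i
  rw [neg_one_mul]
  exact neg_le_neg (EReal.coe_le_coe_iff.1 (h2.le.trans (rateMin_le_hermEig hy i)))

include hf hf' hΘ hΘ' in
theorem trajDist_pos (h : x₁ t ≠ x₂ t) : 0 < trajDist Θ x₁ x₂ t := by
  rw [← framedFlow_dist hf hf' hΘ hΘ']
  exact curveDist_pos ((framedFlow hf hf' hΘ hΘ').continuous_T_left t)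
    ((framedFlow hf hf' hΘ hΘ').continuous_S_left t)
    (fun x v => (framedFlow hf hf' hΘ hΘ').S_T x t v) h

theorem trajDist_eq_zero (h : x₁ t = x₂ t) : trajDist Θ x₁ x₂ t = 0 := by
  rw [trajDist, pathDist_metricOf, h, curveDist_self]

theorem trajDist_nonneg : 0 ≤ trajDist Θ x₁ x₂ t := by
  rw [trajDist, pathDist_metricOf]
  exact curveDist_nonneg _ _ _

variable {J : Set ℝ}
    (hx₁ : ∀ t ∈ J, HasDerivWithinAt x₁ (f (x₁ t) t) J t)
    (hx₂ : ∀ t ∈ J, HasDerivWithinAt x₂ (f (x₂ t) t) J t)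

include hf hf' hΘ hΘ' in
theorem HasMinimizer.exists_curve (h : HasMinimizer (fun x => metricOf Θ x t) (x₁ t) (x₂ t)) :
    ∃ γ : ℝ → EuclideanSpace ℂ (Fin N), ContDiff ℝ 1 γ ∧ γ 0 = x₁ t ∧ γ 1 = x₂ t ∧
      ∫ u in (0 : ℝ)..1, curveSpeed (fun x => (framedFlow hf hf' hΘ hΘ').T x t) γ u
        = trajDist Θ x₁ x₂ t ∧ ∀ u ∈ Set.Icc (0 : ℝ) 1, γ u ∈ trajBall Θ x₁ x₂ t := by
  obtain ⟨γ, ⟨h1, h2, h3⟩, h4⟩ := h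
  have h5 : ∫ u in (0 : ℝ)..1, curveSpeed (fun x => (framedFlow hf hf' hΘ hΘ').T x t) γ u
        = trajDist Θ x₁ x₂ t := by
    rw [pathLength_metricOf] at h4
    exact h4
  refine ⟨γ, h1, h2, h3, h5, fun u hu => ?_⟩
  have h6 := curveDist_le_of_curve_end ((framedFlow hf hf' hΘ hΘ').continuous_T_left t) h1 hu
  rw [h5, h3] at h6
  rw [trajBall, pathBall, Set.mem_ofPred_eq, pathDist_metricOf]
  exact h6

include hf hf' hΘ hΘ' hx₁ hx₂ in
theorem upperLogRate_right_le (ht : t ∈ J) (hne : x₁ t ≠ x₂ t)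
    (h : HasMinimizer (fun x => metricOf Θ x t) (x₁ t) (x₂ t)) :
    upperLogRate (trajDist Θ x₁ x₂) (J ∩ Set.Ici t) t ≤ rateMax f Θ x₁ x₂ t := by
  obtain ⟨γ, h1, h2, h3, h4, h5⟩ := h.exists_curve hf hf' hΘ hΘ'
  have hpos := trajDist_pos hf hf' hΘ hΘ' hne
  refine upperLogRate_le hpos fun z hz ε hε => ?_
  obtain ⟨c, hc, hcF⟩ := inner_F_le_of_rateMax_lt hf hf' hΘ hΘ' hz
  have key := FramedFlow.eventually_dist_le_of_curve (Φ := framedFlow hf hf' hΘ hΘ') hx₁ hx₂ ht h1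
    -- The multiplicative and additive errors sum to `ε' s + ε' = ε`.
    h2 h3 (σ := 1) (c := c) (ε := ε / (trajDist Θ x₁ x₂ t + 1)) (by simp) (by positivity)
    (fun u hu => hcF _ (h5 u hu))
  rw [h4, framedFlow_dist] at key
  have hsub : 𝓝[(J ∩ Set.Ici t) \ {t}] t ≤ 𝓝[J] t :=
    nhdsWithin_mono _ fun τ hτ => hτ.1.1
  filter_upwards [hsub key, self_mem_nhdsWithin] with τ k1 hτ
  have hτ0 : 0 < τ - t := sub_pos.2 (lt_of_le_of_ne hτ.1.2 (Ne.symm hτ.2))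
  have k2 := k1 (by linarith)
  rw [abs_of_pos hτ0] at k2
  rw [div_le_iff₀ hτ0]
  set s := trajDist Θ x₁ x₂ t
  have e : ε / (s + 1) * s + ε / (s + 1) = ε := by field_simp
  calc _ ≤ (c * s + (ε / (s + 1) * s + ε / (s + 1))) * (τ - t) := by linarith
    _ ≤ _ := by rw [e]; gcongr

include hf hf' hΘ hΘ' hx₁ hx₂ in
theorem le_lowerLogRate_left (ht : t ∈ J) (hne : x₁ t ≠ x₂ t)
    (h : HasMinimizer (fun x => metricOf Θ x t) (x₁ t) (x₂ t)) :
    rateMin f Θ x₁ x₂ t ≤ lowerLogRate (trajDist Θ x₁ x₂) (J ∩ Set.Iic t) t := by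
  obtain ⟨γ, h1, h2, h3, h4, h5⟩ := h.exists_curve hf hf' hΘ hΘ'
  have hpos := trajDist_pos hf hf' hΘ hΘ' hne
  refine le_lowerLogRate hpos fun z hz ε hε => ?_
  obtain ⟨c, hc, hcF⟩ := neg_inner_F_le_of_lt_rateMin hf hf' hΘ hΘ' hz
  have key := FramedFlow.eventually_dist_le_of_curve (Φ := framedFlow hf hf' hΘ hΘ') hx₁ hx₂ ht h1
    h2 h3 (σ := -1) (c := c) (ε := ε / (trajDist Θ x₁ x₂ t + 1)) (by simp) (by positivity)
    (fun u hu => hcF _ (h5 u hu))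
  rw [h4, framedFlow_dist] at key
  have hsub : 𝓝[(J ∩ Set.Iic t) \ {t}] t ≤ 𝓝[J] t :=
    nhdsWithin_mono _ fun τ hτ => hτ.1.1
  filter_upwards [hsub key, self_mem_nhdsWithin] with τ k1 hτ
  have hτ0 : τ - t < 0 := sub_neg.2 (lt_of_le_of_ne hτ.1.2 hτ.2)
  have k2 := k1 (by linarith)
  rw [abs_of_neg hτ0] at k2
  rw [le_div_iff_of_neg hτ0]
  set s := trajDist Θ x₁ x₂ t
  have e : ε / (s + 1) * s + ε / (s + 1) = ε := by field_simp
  have hcs : c * s ≤ -z * s := by gcongr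
  have := mul_le_mul_of_nonneg_right hcs (neg_pos.2 hτ0).le
  calc _ ≤ (c * s + (ε / (s + 1) * s + ε / (s + 1))) * -(τ - t) := by linarith
    _ ≤ _ := by rw [e]; linarith

include hf hf' hΘ hΘ' hx₁ hx₂ in
theorem rate_bounds_of_minimizer (ht : t ∈ J) (hne : x₁ t ≠ x₂ t)
    (h : HasMinimizer (fun x => metricOf Θ x t) (x₁ t) (x₂ t)) :
    upperLogRate (trajDist Θ x₁ x₂) (J ∩ Set.Ici t) t ≤ rateMax f Θ x₁ x₂ t ∧
      rateMin f Θ x₁ x₂ t ≤ lowerLogRate (trajDist Θ x₁ x₂) (J ∩ Set.Iic t) t ∧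
      (t ∈ interior J → ∀ ds, HasDerivAt (trajDist Θ x₁ x₂) ds t →
        rateMin f Θ x₁ x₂ t ≤ ((ds / trajDist Θ x₁ x₂ t : ℝ) : EReal) ∧
        ((ds / trajDist Θ x₁ x₂ t : ℝ) : EReal) ≤ rateMax f Θ x₁ x₂ t) := by
  have hu := upperLogRate_right_le hf hf' hΘ hΘ' hx₁ hx₂ ht hne h
  have hl := le_lowerLogRate_left hf hf' hΘ hΘ' hx₁ hx₂ ht hne h
  refine ⟨hu, hl, fun hint ds hds => ?_⟩
  have hJt : J ∈ 𝓝 t := mem_interior_iff_mem_nhds.1 hint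
  -- The one-sided Dini derivatives equal the derivative only if `J` has points on that side, hence
  -- the interior condition.
  have n1 : (𝓝[(J ∩ Set.Ici t) \ {t}] t).NeBot := by
    refine Filter.NeBot.mono (inferInstance : (𝓝[>] t).NeBot) (nhdsWithin_le_iff.2 ?_)
    filter_upwards [nhdsWithin_le_nhds hJt, self_mem_nhdsWithin] with w h1 h2
    exact ⟨⟨h1, (Set.mem_Ioi.1 h2).le⟩, (Set.mem_Ioi.1 h2).ne'⟩
  have n2 : (𝓝[(J ∩ Set.Iic t) \ {t}] t).NeBot := by
    refine Filter.NeBot.mono (inferInstance : (𝓝[<] t).NeBot) (nhdsWithin_le_iff.2 ?_)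
    filter_upwards [nhdsWithin_le_nhds hJt, self_mem_nhdsWithin] with w h1 h2
    exact ⟨⟨h1, (Set.mem_Iio.1 h2).le⟩, (Set.mem_Iio.1 h2).ne⟩
  rw [upperLogRate_eq hds.hasDerivWithinAt] at hu
  rw [lowerLogRate_eq hds.hasDerivWithinAt] at hl
  exact ⟨hl, hu⟩

include hf hf' hΘ hΘ' hx₁ hx₂ in
theorem eventually_slope_trajDist_le (ht : t ∈ J) (hB : IsCompact (trajBall Θ x₁ x₂ t))
    {σ c c' ε : ℝ} (hσ : |σ| = 1) (hcc : c < c') (hε : 0 < ε)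
    (hc : ∀ y ∈ trajBall Θ x₁ x₂ t, ∀ w,
      σ * inner ℝ w ((framedFlow hf hf' hΘ hΘ').F y t w) ≤ c * ‖w‖ ^ 2) :
    ∀ᶠ τ in 𝓝[J \ {t}] t, σ * ((trajDist Θ x₁ x₂ τ - trajDist Θ x₁ x₂ t) / (τ - t))
      ≤ c' * trajDist Θ x₁ x₂ t + ε := by
  obtain ⟨U, hU, hBU, hUF⟩ := FramedFlow.exists_open_mul_inner_le hB hσ hcc hc
  rw [← framedFlow_ball hf hf' hΘ hΘ'] at hB hBU
  have := FramedFlow.eventually_slope_le (Φ := framedFlow hf hf' hΘ hΘ') hx₁ hx₂ ht hB hU hBU hσ hε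
    (nhdsWithin_le_nhds hUF)
  rwa [framedFlow_dist] at this

include hf hf' hΘ hΘ' hx₁ hx₂ in
theorem rate_bounds_of_isCompact (hJ : J.OrdConnected) (hJ' : J.Nontrivial) (ht : t ∈ J)
    (hne : x₁ t ≠ x₂ t) (hB : IsCompact (trajBall Θ x₁ x₂ t)) :
    0 < trajDist Θ x₁ x₂ t ∧
      upperLogRate (trajDist Θ x₁ x₂) J t ≤ rateMax f Θ x₁ x₂ t ∧
      rateMin f Θ x₁ x₂ t ≤ lowerLogRate (trajDist Θ x₁ x₂) J t ∧
      (∀ ds, HasDerivWithinAt (trajDist Θ x₁ x₂) ds J t →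
        rateMin f Θ x₁ x₂ t ≤ ((ds / trajDist Θ x₁ x₂ t : ℝ) : EReal) ∧
        ((ds / trajDist Θ x₁ x₂ t : ℝ) : EReal) ≤ rateMax f Θ x₁ x₂ t) := by
  have hpos := trajDist_pos hf hf' hΘ hΘ' hne
  have hu : upperLogRate (trajDist Θ x₁ x₂) J t ≤ rateMax f Θ x₁ x₂ t := by
    refine upperLogRate_le hpos fun z hz ε hε => ?_
    obtain ⟨c, hc, hcF⟩ := inner_F_le_of_rateMax_lt hf hf' hΘ hΘ' hz
    simpa using eventually_slope_trajDist_le hf hf' hΘ hΘ' hx₁ hx₂ ht hB (by simp) hc hε hcF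
  have hl : rateMin f Θ x₁ x₂ t ≤ lowerLogRate (trajDist Θ x₁ x₂) J t := by
    refine le_lowerLogRate hpos fun z hz ε hε => ?_
    obtain ⟨c, hc, hcF⟩ := neg_inner_F_le_of_lt_rateMin hf hf' hΘ hΘ' hz
    filter_upwards [eventually_slope_trajDist_le hf hf' hΘ hΘ' hx₁ hx₂ ht hB (by simp) hc hε hcF]
      with τ hτ
    linarith
  refine ⟨hpos, hu, hl, fun ds hds => ?_⟩
  have n : (𝓝[J \ {t}] t).NeBot := by
    obtain ⟨b, hb, hbt⟩ := hJ'.exists_ne t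
    rcases lt_or_gt_of_ne hbt with h | h
    · refine Filter.NeBot.mono (inferInstance : (𝓝[<] t).NeBot) (nhdsWithin_le_iff.2 ?_)
      filter_upwards [Ioo_mem_nhdsLT h] with w hw
      exact ⟨hJ.out hb ht ⟨hw.1.le, hw.2.le⟩, hw.2.ne⟩
    · refine Filter.NeBot.mono (inferInstance : (𝓝[>] t).NeBot) (nhdsWithin_le_iff.2 ?_)
      filter_upwards [Ioo_mem_nhdsGT h] with w hw
      exact ⟨hJ.out ht hb ⟨hw.1.le, hw.2.le⟩, hw.1.ne'⟩
  rw [upperLogRate_eq hds] at hu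
  rw [lowerLogRate_eq hds] at hl
  exact ⟨hl, hu⟩

end Rates

theorem abs_toReal_le_of_bounds {r : EReal} {C : ℝ} (hC : 0 ≤ C) (h1 : r = ⊥ ∨ r = ⊤ ∨
    ((-C : ℝ) : EReal) ≤ r ∧ r ≤ (C : EReal)) : |r.toReal| ≤ C := by
  rcases h1 with rfl | rfl | ⟨h1, h2⟩
  · simpa using hC
  · simpa using hC
  · induction r with
    | bot => simpa using hC
    | top => simpa using hC
    | coe r =>
      rw [EReal.coe_le_coe_iff] at h1 h2
      simpa using abs_le.2 ⟨h1, h2⟩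

/-! ### Exponential bounds, contraction and the identity metric. -/

section ExponentialBounds

variable {N : ℕ} {f : EuclideanSpace ℂ (Fin N) → ℝ → EuclideanSpace ℂ (Fin N)}
  {Θ : EuclideanSpace ℂ (Fin N) → ℝ → Matrix (Fin N) (Fin N) ℂ}
  {x₁ x₂ : ℝ → EuclideanSpace ℂ (Fin N)} {t : ℝ}

theorem self_mem_trajBall : x₂ t ∈ trajBall Θ x₁ x₂ t := by
  rw [trajBall, pathBall, Set.mem_ofPred_eq, pathDist_metricOf, curveDist_self]
  exact trajDist_nonneg

/-- In dimension 0 there are no eigenvalues and the supremum is `⊥`, which `toReal` sends to 0.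
Otherwise the centre of the ball supplies a lower bound. -/
theorem rateMax_bounds {C : ℝ} (h : ∀ y ∈ trajBall Θ x₁ x₂ t, ∀ i,
    |hermEig (genJacobian f Θ y t) i| ≤ C) :
    (rateMax f Θ x₁ x₂ t = ⊥ ∧ N = 0) ∨
      ((-C : ℝ) : EReal) ≤ rateMax f Θ x₁ x₂ t ∧ rateMax f Θ x₁ x₂ t ≤ (C : EReal) := by
  rcases Nat.eq_zero_or_pos N with rfl | hN
  · left
    refine ⟨le_bot_iff.1 (rateMax_le fun y _ i => i.elim0), rfl⟩
  · right
    have i : Fin N := ⟨0, hN⟩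
    refine ⟨le_trans ?_ (hermEig_le_rateMax self_mem_trajBall i), rateMax_le fun y hy i => ?_⟩
    · exact EReal.coe_le_coe_iff.2 (abs_le.1 (h _ self_mem_trajBall i)).1
    · exact EReal.coe_le_coe_iff.2 (abs_le.1 (h y hy i)).2

theorem rateMin_bounds {C : ℝ} (h : ∀ y ∈ trajBall Θ x₁ x₂ t, ∀ i,
    |hermEig (genJacobian f Θ y t) i| ≤ C) :
    (rateMin f Θ x₁ x₂ t = ⊤ ∧ N = 0) ∨
      ((-C : ℝ) : EReal) ≤ rateMin f Θ x₁ x₂ t ∧ rateMin f Θ x₁ x₂ t ≤ (C : EReal) := by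
  rcases Nat.eq_zero_or_pos N with rfl | hN
  · left
    refine ⟨top_le_iff.1 (le_rateMin fun y _ i => i.elim0), rfl⟩
  · right
    have i : Fin N := ⟨0, hN⟩
    refine ⟨le_rateMin fun y hy i => ?_, le_trans (rateMin_le_hermEig self_mem_trajBall i) ?_⟩
    · exact EReal.coe_le_coe_iff.2 (abs_le.1 (h y hy i)).1
    · exact EReal.coe_le_coe_iff.2 (abs_le.1 (h _ self_mem_trajBall i)).2

variable
    (hf : Continuous (fun p : EuclideanSpace ℂ (Fin N) × ℝ => f p.1 p.2))
    (hf' : ∀ t, Differentiable ℂ (fun x => f x t))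
    (hΘ : ∀ i j, ContDiff ℝ 1 (fun p : EuclideanSpace ℂ (Fin N) × ℝ => Θ p.1 p.2 i j))
    (hΘ' : ∀ x t, IsUnit (Θ x t).det)
    {J : Set ℝ} (hJ : J.OrdConnected) (hJ' : J.Nontrivial)
    (hx₁ : ∀ t ∈ J, HasDerivWithinAt x₁ (f (x₁ t) t) J t)
    (hx₂ : ∀ t ∈ J, HasDerivWithinAt x₂ (f (x₂ t) t) J t)

include hf hf' hΘ hΘ' hx₁ hx₂ in
theorem exists_abs_hermEig_le {I : Set ℝ} (hI : IsCompact I) (hIJ : I ⊆ J)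
    (hB : ∀ τ ∈ I, IsCompact (trajBall Θ x₁ x₂ τ)) :
    ∃ C, 0 ≤ C ∧ ∀ τ ∈ I, ∀ y ∈ trajBall Θ x₁ x₂ τ, ∀ i,
      |hermEig (genJacobian f Θ y τ) i| ≤ C := by
  simp only [← framedFlow_ball hf hf' hΘ hΘ'] at hB ⊢
  obtain ⟨C, hC0, hC⟩ := FramedFlow.exists_norm_F_le (Φ := framedFlow hf hf' hΘ hΘ') hx₁ hx₂ hI hIJ hB
  refine ⟨C, hC0, fun τ hτ y hy i => ?_⟩
  have h := hC τ hτ y hy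
  have h1 := (mul_inner_F_le_iff hf hf' hΘ hΘ' y τ 1 C).1
    (FramedFlow.mul_inner_le_opNorm (by simp) h) i
  have h2 := (mul_inner_F_le_iff hf hf' hΘ hΘ' y τ (-1) C).1
    (FramedFlow.mul_inner_le_opNorm (by simp) h) i
  rw [abs_le]
  constructor <;> linarith

include hf hf' hΘ hΘ' hx₁ hx₂ in
theorem eventually_rateMax_le (ht : t ∈ J) (hB : IsCompact (trajBall Θ x₁ x₂ t)) {z : ℝ}
    (hz : rateMax f Θ x₁ x₂ t < z) : ∀ᶠ τ in 𝓝[J] t, rateMax f Θ x₁ x₂ τ ≤ z := by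
  obtain ⟨c, hc, hcF⟩ := inner_F_le_of_rateMax_lt hf hf' hΘ hΘ' hz
  obtain ⟨U, hU, hBU, hUF⟩ := FramedFlow.exists_open_mul_inner_le hB (by simp) hc hcF
  rw [← framedFlow_ball hf hf' hΘ hΘ'] at hB hBU
  filter_upwards [nhdsWithin_le_nhds hUF,
    FramedFlow.eventually_ball_subset (Φ := framedFlow hf hf' hΘ hΘ') hx₁ hx₂ ht hB hU hBU]
    with τ h1 h2
  rw [framedFlow_ball] at h2
  refine rateMax_le fun y hy i => EReal.coe_le_coe_iff.2 ?_
  simpa using (mul_inner_F_le_iff hf hf' hΘ hΘ' y τ 1 z).1 (h1 y (h2 hy)) i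

include hf hf' hΘ hΘ' hx₁ hx₂ in
theorem eventually_le_rateMin (ht : t ∈ J) (hB : IsCompact (trajBall Θ x₁ x₂ t)) {z : ℝ}
    (hz : z < rateMin f Θ x₁ x₂ t) : ∀ᶠ τ in 𝓝[J] t, z ≤ rateMin f Θ x₁ x₂ τ := by
  obtain ⟨c, hc, hcF⟩ := neg_inner_F_le_of_lt_rateMin hf hf' hΘ hΘ' hz
  obtain ⟨U, hU, hBU, hUF⟩ := FramedFlow.exists_open_mul_inner_le hB (by simp) hc hcF
  rw [← framedFlow_ball hf hf' hΘ hΘ'] at hB hBU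
  filter_upwards [nhdsWithin_le_nhds hUF,
    FramedFlow.eventually_ball_subset (Φ := framedFlow hf hf' hΘ hΘ') hx₁ hx₂ ht hB hU hBU]
    with τ h1 h2
  rw [framedFlow_ball] at h2
  refine le_rateMin fun y hy i => EReal.coe_le_coe_iff.2 ?_
  have := (mul_inner_F_le_iff hf hf' hΘ hΘ' y τ (-1) (-z)).1 (h1 y (h2 hy)) i
  linarith

include hf hf' hJ hx₁ hx₂ in
theorem trajectories_eq_of_eq_at {t₀ : ℝ} (ht₀ : t₀ ∈ J) (ht : t ∈ J) (h : x₁ t₀ = x₂ t₀) :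
    x₁ t = x₂ t :=
  FramedFlow.eq_of_eq_at
    -- Uniqueness does not involve the metric, so the trivial frame serves.
    (Φ := framedFlow (Θ := fun _ _ => 1) hf hf' (fun _ _ => contDiff_const) (by simp))
    hJ hx₁ hx₂ ht₀ ht h

include hf hf' hΘ hΘ' hJ hJ' hx₁ hx₂ in
theorem exponential_bounds {t₀ : ℝ} (ht₀ : t₀ ∈ J) (ht : t ∈ J) (hle : t₀ ≤ t)
    (hB : ∀ τ ∈ Set.Icc t₀ t, IsCompact (trajBall Θ x₁ x₂ τ)) :
    IntervalIntegrable (fun τ => (rateMax f Θ x₁ x₂ τ).toReal) MeasureTheory.volume t₀ t ∧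
      IntervalIntegrable (fun τ => (rateMin f Θ x₁ x₂ τ).toReal) MeasureTheory.volume t₀ t ∧
      Real.exp (∫ τ in t₀..t, (rateMin f Θ x₁ x₂ τ).toReal) * trajDist Θ x₁ x₂ t₀
        ≤ trajDist Θ x₁ x₂ t ∧
      trajDist Θ x₁ x₂ t
        ≤ Real.exp (∫ τ in t₀..t, (rateMax f Θ x₁ x₂ τ).toReal) * trajDist Θ x₁ x₂ t₀ := by
  have hsub : Set.Icc t₀ t ⊆ J := hJ.out ht₀ ht
  obtain ⟨C, hC0, hC⟩ := exists_abs_hermEig_le hf hf' hΘ hΘ' hx₁ hx₂ isCompact_Icc hsub hB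
  have hmaxb : ∀ τ ∈ Set.Icc t₀ t, _ := fun τ hτ => rateMax_bounds (hC τ hτ)
  have hminb : ∀ τ ∈ Set.Icc t₀ t, _ := fun τ hτ => rateMin_bounds (hC τ hτ)
  have imax := intervalIntegrable_toReal_of_usc (h := rateMax f Θ x₁ x₂) hle (C := C)
    (fun τ hτ z hz => nhdsWithin_mono _ hsub
      (eventually_rateMax_le hf hf' hΘ hΘ' hx₁ hx₂ (hsub hτ) (hB τ hτ) hz))
    (fun τ hτ => abs_toReal_le_of_bounds hC0
      ((hmaxb τ hτ).elim (fun h => Or.inl h.1) fun h => Or.inr (Or.inr h)))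
  have imin := intervalIntegrable_toReal_of_lsc (h := rateMin f Θ x₁ x₂) hle (C := C)
    (fun τ hτ z hz => nhdsWithin_mono _ hsub
      (eventually_le_rateMin hf hf' hΘ hΘ' hx₁ hx₂ (hsub hτ) (hB τ hτ) hz))
    (fun τ hτ => abs_toReal_le_of_bounds hC0
      ((hminb τ hτ).elim (fun h => Or.inr (Or.inl h.1)) fun h => Or.inr (Or.inr h)))
  refine ⟨imax, imin, ?_⟩
  -- Trajectories that meet once coincide, and both distances vanish. Otherwise they never meet, and
  -- the logarithm is available on the whole interval.
  by_cases heq : x₁ t₀ = x₂ t₀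
  · rw [trajDist_eq_zero heq, trajDist_eq_zero
      (trajectories_eq_of_eq_at hf hf' hJ hx₁ hx₂ ht₀ ht heq)]
    simp
  have hne : ∀ τ ∈ J, x₁ τ ≠ x₂ τ := fun τ hτ h =>
    heq (trajectories_eq_of_eq_at hf hf' hJ hx₁ hx₂ hτ ht₀ h)
  have hN : N ≠ 0 := by
    rintro rfl
    exact heq (Subsingleton.elim _ _)
  refine exp_integral_mul_le_and_le (C := C + 1) hle
    (fun τ hτ => trajDist_pos hf hf' hΘ hΘ' (hne τ (hsub hτ))) (fun τ hτ ε hε => ?_) imin imax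
    (fun τ hτ ds hds => ?_)
  · have hF : ∀ σ : ℝ, |σ| = 1 → ∀ y ∈ trajBall Θ x₁ x₂ τ, ∀ w,
        σ * inner ℝ w ((framedFlow hf hf' hΘ hΘ').F y τ w) ≤ C * ‖w‖ ^ 2 := fun σ hσ y hy => by
      rw [mul_inner_F_le_iff]
      intro i
      refine (le_abs_self _).trans ?_
      rw [abs_mul, hσ, one_mul]
      exact hC τ hτ y hy i
    have hs : ∀ σ : ℝ, |σ| = 1 → _ := fun σ hσ =>
      eventually_slope_trajDist_le hf hf' hΘ hΘ' hx₁ hx₂ (hsub hτ) (hB τ hτ) hσ (lt_add_one C) hε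
        (hF σ hσ)
    have hmono : 𝓝[Set.Icc t₀ t \ {τ}] τ ≤ 𝓝[J \ {τ}] τ :=
      nhdsWithin_mono _ (Set.sdiff_subset_sdiff_left hsub)
    filter_upwards [hmono (hs 1 (by simp)), hmono (hs (-1) (by simp))] with w h1 h2
    rw [abs_le]
    constructor <;> linarith
  · have hτ' : τ ∈ Set.Icc t₀ t := Set.Ioo_subset_Icc_self hτ
    have hb := (rate_bounds_of_isCompact hf hf' hΘ hΘ' hx₁ hx₂ hJ hJ' (hsub hτ') (hne τ (hsub hτ'))
      (hB τ hτ')).2.2.2 ds hds.hasDerivWithinAt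
    obtain ⟨l1, l2⟩ := (hminb τ hτ').resolve_left fun h => hN h.2
    obtain ⟨u1, u2⟩ := (hmaxb τ hτ').resolve_left fun h => hN h.2
    rw [← EReal.coe_toReal (ne_top_of_le_ne_top (EReal.coe_ne_top C) l2)
      (ne_bot_of_le_ne_bot (EReal.coe_ne_bot _) l1),
      ← EReal.coe_toReal (ne_top_of_le_ne_top (EReal.coe_ne_top C) u2)
      (ne_bot_of_le_ne_bot (EReal.coe_ne_bot _) u1), EReal.coe_le_coe_iff,
      EReal.coe_le_coe_iff] at hb
    exact hb

include hf hf' hΘ hΘ' hJ hJ' hx₁ hx₂ in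
theorem trajDist_le_of_hermEig_le {t₀ c : ℝ} (ht₀ : t₀ ∈ J) (ht : t ∈ J) (hle : t₀ ≤ t)
    (hB : ∀ τ ∈ J, IsCompact (trajBall Θ x₁ x₂ τ))
    (hc : ∀ τ ∈ J, ∀ x i, hermEig (genJacobian f Θ x τ) i ≤ c) :
    trajDist Θ x₁ x₂ t ≤ Real.exp (c * (t - t₀)) * trajDist Θ x₁ x₂ t₀ := by
  rcases Nat.eq_zero_or_pos N with rfl | hN
  -- Separate because the rate then has real value 0, which need not be at most `c`.
  · simp [trajDist_eq_zero (Subsingleton.elim (x₁ _) (x₂ _))]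
  have hsub : Set.Icc t₀ t ⊆ J := hJ.out ht₀ ht
  obtain ⟨i1, -, -, h⟩ := exponential_bounds hf hf' hΘ hΘ' hJ hJ' hx₁ hx₂ ht₀ ht hle
    fun τ hτ => hB τ (hsub hτ)
  refine h.trans (mul_le_mul_of_nonneg_right (Real.exp_le_exp.2 ?_) trajDist_nonneg)
  have : ∫ _ in t₀..t, c = c * (t - t₀) := by simp [mul_comm]
  rw [← this]
  refine intervalIntegral.integral_mono_on hle i1 (by simp) fun τ hτ => ?_
  have h1 : rateMax f Θ x₁ x₂ τ ≤ c := rateMax_le fun y _ i =>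
    EReal.coe_le_coe_iff.2 (hc τ (hsub hτ) y i)
  have h2 := hermEig_le_rateMax (f := f) (self_mem_trajBall (Θ := Θ) (x₁ := x₁) (x₂ := x₂) (t := τ)) ⟨0, hN⟩
  rwa [← EReal.coe_toReal (ne_top_of_le_ne_top (EReal.coe_ne_top c) h1)
    (ne_bot_of_le_ne_bot (EReal.coe_ne_bot _) h2), EReal.coe_le_coe_iff] at h1

include hf hf' hΘ hΘ' hJ hJ' hx₁ hx₂ in
theorem le_trajDist_of_le_hermEig {t₀ c : ℝ} (ht₀ : t₀ ∈ J) (ht : t ∈ J) (hle : t₀ ≤ t)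
    (hB : ∀ τ ∈ J, IsCompact (trajBall Θ x₁ x₂ τ))
    (hc : ∀ τ ∈ J, ∀ x i, c ≤ hermEig (genJacobian f Θ x τ) i) :
    Real.exp (c * (t - t₀)) * trajDist Θ x₁ x₂ t₀ ≤ trajDist Θ x₁ x₂ t := by
  rcases Nat.eq_zero_or_pos N with rfl | hN
  · simp [trajDist_eq_zero (Subsingleton.elim (x₁ _) (x₂ _))]
  have hsub : Set.Icc t₀ t ⊆ J := hJ.out ht₀ ht
  obtain ⟨-, i1, h, -⟩ := exponential_bounds hf hf' hΘ hΘ' hJ hJ' hx₁ hx₂ ht₀ ht hle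
    fun τ hτ => hB τ (hsub hτ)
  refine le_trans (mul_le_mul_of_nonneg_right (Real.exp_le_exp.2 ?_) trajDist_nonneg) h
  have : ∫ _ in t₀..t, c = c * (t - t₀) := by simp [mul_comm]
  rw [← this]
  refine intervalIntegral.integral_mono_on hle (by simp) i1 fun τ hτ => ?_
  have h1 : c ≤ rateMin f Θ x₁ x₂ τ := le_rateMin fun y _ i =>
    EReal.coe_le_coe_iff.2 (hc τ (hsub hτ) y i)
  have h2 := rateMin_le_hermEig (f := f) (self_mem_trajBall (Θ := Θ) (x₁ := x₁) (x₂ := x₂) (t := τ)) ⟨0, hN⟩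
  rwa [← EReal.coe_toReal (ne_top_of_le_ne_top (EReal.coe_ne_top _) h2)
    (ne_bot_of_le_ne_bot (EReal.coe_ne_bot _) h1), EReal.coe_le_coe_iff] at h1

include hf hf' hΘ hΘ' hJ hJ' hx₁ hx₂ in
theorem contraction_of_isCompact (hB : ∀ t ∈ J, IsCompact (trajBall Θ x₁ x₂ t)) :
    (IsContracting f Θ J → ∃ β : ℝ, 0 < β ∧ ∀ t₀ ∈ J, ∀ t ∈ J, t₀ ≤ t →
        trajDist Θ x₁ x₂ t ≤ Real.exp (-β * (t - t₀)) * trajDist Θ x₁ x₂ t₀) ∧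
      (IsDiverging f Θ J → ∃ β : ℝ, 0 < β ∧ ∀ t₀ ∈ J, ∀ t ∈ J, t₀ ≤ t →
        Real.exp (β * (t - t₀)) * trajDist Θ x₁ x₂ t₀ ≤ trajDist Θ x₁ x₂ t) ∧
      (IsSemiContracting f Θ J → AntitoneOn (trajDist Θ x₁ x₂) J) ∧
      (IsSemiDiverging f Θ J → MonotoneOn (trajDist Θ x₁ x₂) J) ∧
      (IsIndifferent f Θ J → ∀ t₀ ∈ J, ∀ t ∈ J,
        trajDist Θ x₁ x₂ t = trajDist Θ x₁ x₂ t₀) := by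
  have semi : IsSemiContracting f Θ J → AntitoneOn (trajDist Θ x₁ x₂) J := fun h t₀ ht₀ t ht hle => by
    simpa using trajDist_le_of_hermEig_le hf hf' hΘ hΘ' hJ hJ' hx₁ hx₂ ht₀ ht hle hB h
  have semi' : IsSemiDiverging f Θ J → MonotoneOn (trajDist Θ x₁ x₂) J := fun h t₀ ht₀ t ht hle => by
    simpa using le_trajDist_of_le_hermEig hf hf' hΘ hΘ' hJ hJ' hx₁ hx₂ ht₀ ht hle hB h
  refine ⟨?_, ?_, semi, semi', ?_⟩
  · rintro ⟨β, hβ, h⟩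
    exact ⟨β, hβ, fun t₀ ht₀ t ht hle =>
      trajDist_le_of_hermEig_le hf hf' hΘ hΘ' hJ hJ' hx₁ hx₂ ht₀ ht hle hB h⟩
  · rintro ⟨β, hβ, h⟩
    exact ⟨β, hβ, fun t₀ ht₀ t ht hle =>
      le_trajDist_of_le_hermEig hf hf' hΘ hΘ' hJ hJ' hx₁ hx₂ ht₀ ht hle hB h⟩
  · intro h t₀ ht₀ t ht
    have h1 := semi fun t ht x i => (h t ht x i).le
    have h2 := semi' fun t ht x i => (h t ht x i).ge
    rcases le_total t₀ t with hle | hle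
    · exact le_antisymm (h1 ht₀ ht hle) (h2 ht₀ ht hle)
    · exact le_antisymm (h2 ht ht₀ hle) (h1 ht ht₀ hle)

include hΘ in
-- The ball is closed by continuity of the distance, and lies in a Euclidean ball because lengths
-- dominate `√a` times Euclidean lengths.
theorem isCompact_trajBall_of_le {a : ℝ} (ha : 0 < a)
    (h : ∀ x v, a * quadForm 1 v ≤ quadForm (metricOf Θ x t) v) :
    IsCompact (trajBall Θ x₁ x₂ t) := by
  have hT : Continuous fun x => matrixOp (Θ x t) :=
    continuous_matrixOp ((continuous_frame hΘ).comp (by fun_prop : Continuous fun x => (x, t)))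
  have hlow : ∀ x v, ‖v‖ ≤ (√a)⁻¹ * ‖matrixOp (Θ x t) v‖ := fun x v => by
    rw [← sqrt_quadForm_metricOf, le_inv_mul_iff₀ (Real.sqrt_pos.2 ha), ← Real.sqrt_sq (norm_nonneg v),
      ← quadForm_one, ← Real.sqrt_mul ha.le]
    exact Real.sqrt_le_sqrt (h x v)
  have heq : trajBall Θ x₁ x₂ t
      = {y | curveDist (fun x => matrixOp (Θ x t)) (x₂ t) y ≤ trajDist Θ x₁ x₂ t} := by
    ext y
    simp only [trajBall, pathBall, pathDist_metricOf]
  rw [heq]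
  refine (isCompact_closedBall (x₂ t) ((√a)⁻¹ * trajDist Θ x₁ x₂ t)).of_isClosed_subset
    (isClosed_le (continuous_curveDist hT _) continuous_const) fun y hy => ?_
  rw [Metric.mem_closedBall, dist_eq_norm]
  refine (norm_sub_le_mul_curveDist hT (by positivity) hlow _ _).trans ?_
  gcongr
  exact hy

include hΘ in
theorem norm_sub_le_trajDist {a : ℝ} (ha : 0 < a)
    (h : ∀ x v, a * quadForm 1 v ≤ quadForm (metricOf Θ x t) v) :
    √a * ‖x₁ t - x₂ t‖ ≤ trajDist Θ x₁ x₂ t := by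
  have hT : Continuous fun x => matrixOp (Θ x t) :=
    continuous_matrixOp ((continuous_frame hΘ).comp (by fun_prop : Continuous fun x => (x, t)))
  have hlow : ∀ x v, ‖v‖ ≤ (√a)⁻¹ * ‖matrixOp (Θ x t) v‖ := fun x v => by
    rw [← sqrt_quadForm_metricOf, le_inv_mul_iff₀ (Real.sqrt_pos.2 ha), ← Real.sqrt_sq (norm_nonneg v),
      ← quadForm_one, ← Real.sqrt_mul ha.le]
    exact Real.sqrt_le_sqrt (h x v)
  have := norm_sub_le_mul_curveDist hT (by positivity) hlow (x₁ t) (x₂ t)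
  rw [le_inv_mul_iff₀ (Real.sqrt_pos.2 ha), norm_sub_rev] at this
  rwa [trajDist, pathDist_metricOf]

theorem trajDist_le_norm_sub {b : ℝ} (hb : 0 < b)
    (h : ∀ x v, quadForm (metricOf Θ x t) v ≤ b * quadForm 1 v) :
    trajDist Θ x₁ x₂ t ≤ √b * ‖x₁ t - x₂ t‖ := by
  rw [trajDist, pathDist_metricOf, norm_sub_rev]
  refine curveDist_le_of_segment fun z _ =>
    ContinuousLinearMap.opNorm_le_bound _ (by positivity) fun v => ?_
  rw [← sqrt_quadForm_metricOf, ← Real.sqrt_sq (norm_nonneg v), ← quadForm_one, ← Real.sqrt_mul hb.le]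
  exact Real.sqrt_le_sqrt (h z v)

include hf hf' hΘ hΘ' hJ hJ' hx₁ hx₂ in
theorem identity_metric_bounds {a b : ℝ} (ha : 0 < a)
    (hab : ∀ t ∈ J, ∀ x v, a * quadForm 1 v ≤ quadForm (metricOf Θ x t) v ∧
        quadForm (metricOf Θ x t) v ≤ b * quadForm 1 v)
    {t₀ : ℝ} (ht₀ : t₀ ∈ J) (ht : t ∈ J) (hle : t₀ ≤ t) :
    (∀ τ ∈ Set.Icc t₀ t, IsCompact (trajBall Θ x₁ x₂ τ)) ∧
      √(a / b) * Real.exp (∫ τ in t₀..t, (rateMin f Θ x₁ x₂ τ).toReal)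
          * pathDist (fun _ => 1) (x₁ t₀) (x₂ t₀)
        ≤ pathDist (fun _ => 1) (x₁ t) (x₂ t) ∧
      pathDist (fun _ => 1) (x₁ t) (x₂ t)
        ≤ √(b / a) * Real.exp (∫ τ in t₀..t, (rateMax f Θ x₁ x₂ τ).toReal)
          * pathDist (fun _ => 1) (x₁ t₀) (x₂ t₀) := by
  have hsub : Set.Icc t₀ t ⊆ J := hJ.out ht₀ ht
  have hB : ∀ τ ∈ Set.Icc t₀ t, IsCompact (trajBall Θ x₁ x₂ τ) := fun τ hτ =>
    isCompact_trajBall_of_le hΘ ha fun x v => (hab τ (hsub hτ) x v).1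
  refine ⟨hB, ?_⟩
  simp only [pathDist_one]
  by_cases heq : x₁ t₀ = x₂ t₀
  · rw [heq, trajectories_eq_of_eq_at hf hf' hJ hx₁ hx₂ ht₀ ht heq]
    simp
  -- Positivity of `b` needs a nonzero vector, which distinct trajectories provide.
  have hb : 0 < b := by
    have h1 := (hab t₀ ht₀ (x₁ t₀) (x₁ t₀ - x₂ t₀)).1.trans (hab t₀ ht₀ (x₁ t₀) (x₁ t₀ - x₂ t₀)).2
    have h2 : 0 < quadForm 1 (x₁ t₀ - x₂ t₀) := by
      rw [quadForm_one]
      have := norm_pos_iff.2 (sub_ne_zero.2 heq)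
      positivity
    exact ha.trans_le (le_of_mul_le_mul_right h1 h2)
  obtain ⟨-, -, h1, h2⟩ := exponential_bounds hf hf' hΘ hΘ' hJ hJ' hx₁ hx₂ ht₀ ht hle hB
  have l₀ := norm_sub_le_trajDist (x₁ := x₁) (x₂ := x₂) hΘ ha fun x v => (hab t₀ ht₀ x v).1
  have l := norm_sub_le_trajDist (x₁ := x₁) (x₂ := x₂) hΘ ha fun x v => (hab t ht x v).1
  have u₀ := trajDist_le_norm_sub (x₁ := x₁) (x₂ := x₂) hb fun x v => (hab t₀ ht₀ x v).2
  have u := trajDist_le_norm_sub (x₁ := x₁) (x₂ := x₂) hb fun x v => (hab t ht x v).2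
  have ha' := Real.sqrt_pos.2 ha
  have hb' := Real.sqrt_pos.2 hb
  rw [Real.sqrt_div ha.le, Real.sqrt_div hb.le]
  constructor
  · set e := Real.exp (∫ τ in t₀..t, (rateMin f Θ x₁ x₂ τ).toReal)
    rw [div_mul_eq_mul_div, div_mul_eq_mul_div, div_le_iff₀ hb']
    calc √a * e * ‖x₁ t₀ - x₂ t₀‖ = e * (√a * ‖x₁ t₀ - x₂ t₀‖) := by ring
      _ ≤ e * trajDist Θ x₁ x₂ t₀ := by gcongr
      _ ≤ trajDist Θ x₁ x₂ t := h1
      _ ≤ √b * ‖x₁ t - x₂ t‖ := u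
      _ = _ := mul_comm _ _
  · set e := Real.exp (∫ τ in t₀..t, (rateMax f Θ x₁ x₂ τ).toReal)
    rw [div_mul_eq_mul_div, div_mul_eq_mul_div, le_div_iff₀ ha']
    calc ‖x₁ t - x₂ t‖ * √a = √a * ‖x₁ t - x₂ t‖ := mul_comm _ _
      _ ≤ trajDist Θ x₁ x₂ t := l
      _ ≤ e * trajDist Θ x₁ x₂ t₀ := h2
      _ ≤ e * (√b * ‖x₁ t₀ - x₂ t₀‖) := by gcongr
      _ = _ := by ring

end ExponentialBounds

/-! ### Orthonormal Cartesian coordinates. -/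

/-- A continuous lift of a `C¹` curve through a `C¹` immersion of finite-dimensional spaces is
`C¹`. -/
theorem contDiff_of_comp_immersion {E F : Type*} [NormedAddCommGroup E] [NormedSpace ℝ E]
    [FiniteDimensional ℝ E] [NormedAddCommGroup F] [NormedSpace ℝ F] [FiniteDimensional ℝ F]
    {z : E → F} (hz : ContDiff ℝ 1 z) (hinj : ∀ x, Function.Injective (fderiv ℝ z x))
    {γ : ℝ → E} (hγ : Continuous γ) (hzγ : ContDiff ℝ 1 fun u => z (γ u)) : ContDiff ℝ 1 γ := by
  have : CompleteSpace E := FiniteDimensional.complete ℝ E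
  rw [contDiff_iff_contDiffAt]
  intro u₀
  obtain ⟨B, hB⟩ := (fderiv ℝ z (γ u₀)).toLinearMap.exists_leftInverse_of_injective
    (LinearMap.ker_eq_bot.2 (hinj (γ u₀)))
  set L : F →L[ℝ] E := LinearMap.toContinuousLinearMap B with hL
  -- With `L` a left inverse of the derivative at `γ u₀`, the map `L ∘ z` has identity derivative
  -- there and is locally invertible. Continuity of `γ` keeps it in that neighbourhood, where it is
  -- the local inverse applied to the `C¹` curve `L ∘ z ∘ γ`.
  have hG : ContDiffAt ℝ 1 (fun x => L (z x)) (γ u₀) := (L.contDiff.comp hz).contDiffAt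
  have hG' : HasFDerivAt (fun x => L (z x))
      ((ContinuousLinearEquiv.refl ℝ E : E ≃L[ℝ] E) : E →L[ℝ] E) (γ u₀) := by
    have h1 := L.hasFDerivAt.comp (γ u₀) ((hz.differentiable one_ne_zero) (γ u₀)).hasFDerivAt
    refine h1.congr_fderiv (ContinuousLinearMap.ext fun v => ?_)
    exact LinearMap.congr_fun hB v
  have h1 : ContDiffAt ℝ 1 (hG.localInverse hG' one_ne_zero) (L (z (γ u₀))) :=
    hG.to_localInverse hG' one_ne_zero
  have h2 : ContDiffAt ℝ 1 (fun u => L (z (γ u))) u₀ := (L.contDiff.comp hzγ).contDiffAt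
  refine (h1.comp u₀ h2).congr_of_eventuallyEq ?_
  have h3 := (hG.hasStrictFDerivAt' hG' one_ne_zero).eventually_left_inverse
  filter_upwards [(hγ.tendsto u₀).eventually h3] with u hu
  exact hu.symm

section Coordinates

variable {N K : ℕ} {f : EuclideanSpace ℂ (Fin N) → ℝ → EuclideanSpace ℂ (Fin N)}
  {Θ : EuclideanSpace ℂ (Fin N) → ℝ → Matrix (Fin N) (Fin N) ℂ}
  {J : Set ℝ} {z : EuclideanSpace ℂ (Fin N) → ℝ → EuclideanSpace ℂ (Fin K)}
  {x x₁ x₂ : ℝ → EuclideanSpace ℂ (Fin N)} {t : ℝ}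

theorem coordDist_eq_norm (t : ℝ) : coordDist z x₁ x₂ t = ‖z (x₁ t) t - z (x₂ t) t‖ :=
  pathDist_one _ _

theorem IsOrthonormalCoord.contDiff_left (hz : IsOrthonormalCoord Θ J z) (t : ℝ) :
    ContDiff ℝ 1 fun x => z x t :=
  hz.contDiff.comp (contDiff_id.prodMk contDiff_const)

theorem IsOrthonormalCoord.norm_fderiv (hz : IsOrthonormalCoord Θ J z) (ht : t ∈ J)
    (x v : EuclideanSpace ℂ (Fin N)) :
    ‖fderiv ℝ (fun y => z y t) x v‖ = ‖matrixOp (Θ x t) v‖ := by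
  rw [← sqrt_quadForm_metricOf, ← hz.orthonormal t ht, quadForm_one,
    Real.sqrt_sq (norm_nonneg _)]

theorem IsOrthonormalCoord.curveSpeed_comp (hz : IsOrthonormalCoord Θ J z) (ht : t ∈ J)
    {γ : ℝ → EuclideanSpace ℂ (Fin N)} (hγ : ContDiff ℝ 1 γ) (u : ℝ) :
    curveSpeed (fun x => matrixOp (Θ x t)) γ u = ‖deriv (fun u => z (γ u) t) u‖ := by
  have h1 := ((hz.contDiff_left t).differentiable one_ne_zero (γ u)).hasFDerivAt
  have h2 := (hγ.differentiable one_ne_zero u).hasDerivAt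
  have h3 : deriv (fun u => z (γ u) t) u = fderiv ℝ (fun y => z y t) (γ u) (deriv γ u) :=
    (h1.comp_hasDerivAt u h2).deriv
  rw [h3, hz.norm_fderiv ht]
  rfl

/-- Coordinates map curves to curves of equal length, and the infimum in `ℂ^K` runs over more
curves. -/
theorem IsOrthonormalCoord.coordDist_le (hz : IsOrthonormalCoord Θ J z) (ht : t ∈ J) :
    coordDist z x₁ x₂ t ≤ trajDist Θ x₁ x₂ t := by
  rw [trajDist, pathDist_metricOf, coordDist_eq_norm]
  refine le_of_forall_gt fun r hr => ?_
  obtain ⟨γ, h1, h2, h3, h4⟩ := exists_curve_of_curveDist_lt hr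
  refine lt_of_le_of_lt ?_ h4
  have h5 : ContDiff ℝ 1 fun u => z (γ u) t := (hz.contDiff_left t).comp h1
  have h6 := curveDist_le (T := fun _ => ContinuousLinearMap.id ℝ _) h5
  rw [curveDist_id] at h6
  simp only [h2, h3] at h6
  refine h6.trans_eq (intervalIntegral.integral_congr fun u _ => ?_)
  exact (hz.curveSpeed_comp ht h1 u).symm

theorem IsOrthonormalCoord.coordDist_pos (hz : IsOrthonormalCoord Θ J z) (ht : t ∈ J)
    (hne : x₁ t ≠ x₂ t) : 0 < coordDist z x₁ x₂ t := by
  rw [coordDist_eq_norm, norm_pos_iff, sub_ne_zero]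
  exact fun h => hne ((hz.embedding t ht).injective h)

theorem IsOrthonormalCoord.hasDerivWithinAt (hz : IsOrthonormalCoord Θ J z)
    (hx : HasDerivWithinAt x (f (x t) t) J t) :
    HasDerivWithinAt (fun τ => z (x τ) τ) (flowDeriv f z (x t) t) J t :=
  HasFDerivAt.comp_hasDerivWithinAt (f := fun τ => (x τ, τ)) t
    (hz.contDiff.differentiable one_ne_zero (x t, t)).hasFDerivAt
    (hx.prodMk (hasDerivWithinAt_id t J))

theorem coordRate_eq (t : ℝ) : coordRate f z x₁ x₂ t =
    inner ℝ (z (x₁ t) t - z (x₂ t) t) (flowDeriv f z (x₁ t) t - flowDeriv f z (x₂ t) t)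
      / ‖z (x₁ t) t - z (x₂ t) t‖ ^ 2 := by
  rw [coordRate, quadForm_one, real_inner_comm, real_inner_eq_re,
    EuclideanSpace.inner_eq_star_dotProduct, dotProduct_comm]

/-- The square is differentiable even where `z₁ = z₂`; there both the derivative and the stated
value are 0. -/
theorem hasDerivWithinAt_coordDist_sq (hz : IsOrthonormalCoord Θ J z)
    (hx₁ : HasDerivWithinAt x₁ (f (x₁ t) t) J t) (hx₂ : HasDerivWithinAt x₂ (f (x₂ t) t) J t) :
    HasDerivWithinAt (fun τ => coordDist z x₁ x₂ τ ^ 2)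
      (2 * coordRate f z x₁ x₂ t * coordDist z x₁ x₂ t ^ 2) J t := by
  simp only [coordDist_eq_norm]
  have h := ((hz.hasDerivWithinAt hx₁).sub (hz.hasDerivWithinAt hx₂)).norm_sq
  refine h.congr_deriv ?_
  rw [coordRate_eq, mul_assoc]
  congr 1
  rcases eq_or_ne (z (x₁ t) t - z (x₂ t) t) 0 with h0 | h0
  · simp [h0]
  · rw [div_mul_cancel₀]
    · rfl
    · exact pow_ne_zero 2 (norm_ne_zero_iff.2 h0)

theorem exists_hasDerivWithinAt_coordDist (hz : IsOrthonormalCoord Θ J z) (ht : t ∈ J)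
    (hx₁ : HasDerivWithinAt x₁ (f (x₁ t) t) J t) (hx₂ : HasDerivWithinAt x₂ (f (x₂ t) t) J t)
    (hne : x₁ t ≠ x₂ t) :
    ∃ ds, HasDerivWithinAt (coordDist z x₁ x₂) ds J t ∧
      ds / coordDist z x₁ x₂ t = coordRate f z x₁ x₂ t := by
  have hpos := hz.coordDist_pos ht hne
  have h := (hasDerivWithinAt_coordDist_sq hz hx₁ hx₂).sqrt (by positivity)
  have hnn : ∀ τ, 0 ≤ coordDist z x₁ x₂ τ := fun τ => by
    rw [coordDist_eq_norm]; exact norm_nonneg _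
  simp only [Real.sqrt_sq (hnn _)] at h
  refine ⟨_, h, ?_⟩
  field_simp

theorem coordDist_exp_bounds (hJ : J.OrdConnected) (hz : IsOrthonormalCoord Θ J z)
    (hx₁ : ∀ t ∈ J, HasDerivWithinAt x₁ (f (x₁ t) t) J t)
    (hx₂ : ∀ t ∈ J, HasDerivWithinAt x₂ (f (x₂ t) t) J t) {r t₀ : ℝ} (ht₀ : t₀ ∈ J) (ht : t ∈ J)
    (hle : t₀ ≤ t) :
    ((∀ τ ∈ Set.Icc t₀ t, coordRate f z x₁ x₂ τ ≤ r) →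
      coordDist z x₁ x₂ t ≤ Real.exp (r * (t - t₀)) * coordDist z x₁ x₂ t₀) ∧
    ((∀ τ ∈ Set.Icc t₀ t, r ≤ coordRate f z x₁ x₂ τ) →
      Real.exp (r * (t - t₀)) * coordDist z x₁ x₂ t₀ ≤ coordDist z x₁ x₂ t) := by
  have hsub : Set.Icc t₀ t ⊆ J := hJ.out ht₀ ht
  set s := coordDist z x₁ x₂ with hs
  have hnn : ∀ τ, 0 ≤ s τ := fun τ => by
    rw [hs, coordDist_eq_norm]; exact norm_nonneg _
  -- Its derivative is `2 (ρ - r) g`, so the sign of `ρ - r` decides monotonicity, without assuming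
  -- `s > 0`.
  set g : ℝ → ℝ := fun τ => Real.exp (-(2 * r) * τ) * s τ ^ 2 with hg
  have hd : ∀ τ ∈ Set.Icc t₀ t, HasDerivWithinAt g
      (Real.exp (-(2 * r) * τ) * s τ ^ 2 * (2 * (coordRate f z x₁ x₂ τ - r))) (Set.Icc t₀ t) τ := by
    intro τ hτ
    have h1 := (hasDerivWithinAt_coordDist_sq hz (hx₁ τ (hsub hτ)) (hx₂ τ (hsub hτ))).mono hsub
    have h2 : HasDerivWithinAt (fun τ : ℝ => Real.exp (-(2 * r) * τ))
        (Real.exp (-(2 * r) * τ) * (-(2 * r))) (Set.Icc t₀ t) τ := by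
      have := ((hasDerivAt_id τ).const_mul (-(2 * r))).exp.hasDerivWithinAt (s := Set.Icc t₀ t)
      simpa using this
    refine (h2.mul h1).congr_deriv ?_
    ring
  have hc : ContinuousOn g (Set.Icc t₀ t) := fun τ hτ => (hd τ hτ).continuousWithinAt
  have hd' : ∀ τ ∈ interior (Set.Icc t₀ t), HasDerivWithinAt g
      (Real.exp (-(2 * r) * τ) * s τ ^ 2 * (2 * (coordRate f z x₁ x₂ τ - r)))
      (interior (Set.Icc t₀ t)) τ := fun τ hτ =>
    (hd τ (interior_subset hτ)).mono interior_subset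
  have l := Set.left_mem_Icc.2 hle
  have u := Set.right_mem_Icc.2 hle
  have e1 : Real.exp (-(2 * r) * t₀) = Real.exp (-(2 * r) * t) * Real.exp (r * (t - t₀)) ^ 2 := by
    rw [← Real.exp_nat_mul, ← Real.exp_add]
    congr 1
    push_cast
    ring
  have hE := Real.exp_pos (-(2 * r) * t)
  constructor
  · intro hr
    have := antitoneOn_of_hasDerivWithinAt_nonpos (convex_Icc t₀ t) hc hd' (fun τ hτ =>
      mul_nonpos_of_nonneg_of_nonpos (by positivity)
        (by linarith [hr τ (interior_subset hτ)])) l u hle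
    simp only [hg, e1, mul_assoc] at this
    have := le_of_mul_le_mul_left this hE
    rw [← mul_pow] at this
    exact le_of_sq_le_sq this (mul_nonneg (Real.exp_pos _).le (hnn _))
  · intro hr
    have := monotoneOn_of_hasDerivWithinAt_nonneg (convex_Icc t₀ t) hc hd' (fun τ hτ =>
      mul_nonneg (by positivity) (by linarith [hr τ (interior_subset hτ)])) l u hle
    simp only [hg, e1, mul_assoc] at this
    have := le_of_mul_le_mul_left this hE
    rw [← mul_pow] at this
    exact le_of_sq_le_sq this (hnn _)

/-- The straight segment is lifted to the chart. The lift is continuous by the embedding and `C¹` by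
the immersion property, which invertibility of `Θ` gives; its length is `|z₁ - z₂|`. -/
theorem IsOrthonormalCoord.trajDist_le (hΘ' : ∀ x t, IsUnit (Θ x t).det)
    (hz : IsOrthonormalCoord Θ J z) (ht : t ∈ J)
    (hseg : segment ℝ (z (x₁ t) t) (z (x₂ t) t) ⊆ Set.range (fun x => z x t)) :
    trajDist Θ x₁ x₂ t ≤ coordDist z x₁ x₂ t := by
  rw [trajDist, pathDist_metricOf, coordDist_eq_norm]
  set z₁ := z (x₁ t) t with hz₁
  set z₂ := z (x₂ t) t with hz₂
  -- A path must be `C¹` on all of `ℝ`. This parametrization never leaves the segment and moves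
  -- monotonically, so no length is added.
  set φ := Real.smoothTransition with hφ
  have hφc : ContDiff ℝ 1 φ := Real.smoothTransition.contDiff
  have hmem : ∀ u, ∃ x, z x t = z₁ + φ u • (z₂ - z₁) := fun u => by
    refine hseg ?_
    rw [segment_eq_image']
    exact ⟨φ u, ⟨Real.smoothTransition.nonneg u, Real.smoothTransition.le_one u⟩, rfl⟩
  choose γ hγ using hmem
  have hemb := hz.embedding t ht
  have hzγ : ContDiff ℝ 1 fun u => z (γ u) t := by
    simp only [hγ]
    fun_prop
  have hγc : Continuous γ := hemb.continuous_iff.2 hzγ.continuous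
  have hinj : ∀ x, Function.Injective (fderiv ℝ (fun y => z y t) x) := fun x => by
    rw [injective_iff_map_eq_zero]
    intro v hv
    have h1 := hz.norm_fderiv ht x v
    rw [hv, norm_zero, eq_comm, norm_eq_zero] at h1
    have h2 : matrixOp (Θ x t)⁻¹ (matrixOp (Θ x t) v) = v := by
      rw [← ContinuousLinearMap.comp_apply, ← matrixOp_mul, Matrix.nonsing_inv_mul _ (hΘ' x t),
        matrixOp_one]
      rfl
    rw [← h2, h1, map_zero]
  have hγ1 := contDiff_of_comp_immersion (hz.contDiff_left t) hinj hγc hzγ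
  have g0 : γ 0 = x₁ t := hemb.injective (by simp [hγ, hφ, hz₁])
  have g1 : γ 1 = x₂ t := hemb.injective (by simp [hγ, hφ, hz₂])
  have h := curveDist_le (T := fun x => matrixOp (Θ x t)) hγ1
  rw [g0, g1] at h
  refine h.trans_eq ?_
  have hφd : ∀ u, HasDerivAt φ (deriv φ u) u := fun u =>
    (hφc.differentiable one_ne_zero u).hasDerivAt
  have hsp : ∀ u, curveSpeed (fun x => matrixOp (Θ x t)) γ u = deriv φ u * ‖z₁ - z₂‖ := fun u => by
    rw [hz.curveSpeed_comp ht hγ1]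
    simp only [hγ]
    rw [(((hφd u).smul_const (z₂ - z₁)).const_add z₁).deriv, norm_smul,
      Real.norm_of_nonneg (deriv_smoothTransition_nonneg u), norm_sub_rev]
  simp only [hsp]
  rw [intervalIntegral.integral_mul_const, intervalIntegral.integral_eq_sub_of_hasDerivAt
    (fun u _ => hφd u) ((hφc.continuous_deriv le_rfl).intervalIntegrable _ _)]
  simp [hφ]

end Coordinates

/-! ### The main theorem. -/

theorem theorem1 {N : ℕ}
    (f : EuclideanSpace ℂ (Fin N) → ℝ → EuclideanSpace ℂ (Fin N))
    (hf : Continuous (fun p : EuclideanSpace ℂ (Fin N) × ℝ => f p.1 p.2))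
    (hf' : ∀ t, Differentiable ℂ (fun x => f x t))
    (Θ : EuclideanSpace ℂ (Fin N) → ℝ → Matrix (Fin N) (Fin N) ℂ)
    (hΘ : ∀ i j, ContDiff ℝ 1 (fun p : EuclideanSpace ℂ (Fin N) × ℝ => Θ p.1 p.2 i j))
    (hΘ' : ∀ x t, IsUnit (Θ x t).det)
    (J : Set ℝ) (hJ : J.OrdConnected) (hJ' : J.Nontrivial)
    (x₁ x₂ : ℝ → EuclideanSpace ℂ (Fin N))
    (hx₁ : ∀ t ∈ J, HasDerivWithinAt x₁ (f (x₁ t) t) J t)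
    (hx₂ : ∀ t ∈ J, HasDerivWithinAt x₂ (f (x₂ t) t) J t) :
    -- the rate bounds at a time at which the distance is attained by a connecting path
    (∀ t ∈ J, x₁ t ≠ x₂ t → HasMinimizer (fun x => metricOf Θ x t) (x₁ t) (x₂ t) →
      upperLogRate (trajDist Θ x₁ x₂) (J ∩ Set.Ici t) t ≤ rateMax f Θ x₁ x₂ t ∧
      rateMin f Θ x₁ x₂ t ≤ lowerLogRate (trajDist Θ x₁ x₂) (J ∩ Set.Iic t) t ∧
      (t ∈ interior J → ∀ ds, HasDerivAt (trajDist Θ x₁ x₂) ds t →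
        rateMin f Θ x₁ x₂ t ≤ ((ds / trajDist Θ x₁ x₂ t : ℝ) : EReal) ∧
        ((ds / trajDist Θ x₁ x₂ t : ℝ) : EReal) ≤ rateMax f Θ x₁ x₂ t)) ∧
    -- the rate bounds at a time at which the ball of radius `s` is compact
    (∀ t ∈ J, x₁ t ≠ x₂ t → IsCompact (trajBall Θ x₁ x₂ t) →
      0 < trajDist Θ x₁ x₂ t ∧
      upperLogRate (trajDist Θ x₁ x₂) J t ≤ rateMax f Θ x₁ x₂ t ∧
      rateMin f Θ x₁ x₂ t ≤ lowerLogRate (trajDist Θ x₁ x₂) J t ∧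
      (∀ ds, HasDerivWithinAt (trajDist Θ x₁ x₂) ds J t →
        rateMin f Θ x₁ x₂ t ≤ ((ds / trajDist Θ x₁ x₂ t : ℝ) : EReal) ∧
        ((ds / trajDist Θ x₁ x₂ t : ℝ) : EReal) ≤ rateMax f Θ x₁ x₂ t)) ∧
    -- exponential convergence within these bounds
    (∀ t₀ ∈ J, ∀ t ∈ J, t₀ ≤ t → (∀ τ ∈ Set.Icc t₀ t, IsCompact (trajBall Θ x₁ x₂ τ)) →
      IntervalIntegrable (fun τ => (rateMax f Θ x₁ x₂ τ).toReal) MeasureTheory.volume t₀ t ∧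
      IntervalIntegrable (fun τ => (rateMin f Θ x₁ x₂ τ).toReal) MeasureTheory.volume t₀ t ∧
      Real.exp (∫ τ in t₀..t, (rateMin f Θ x₁ x₂ τ).toReal) * trajDist Θ x₁ x₂ t₀
        ≤ trajDist Θ x₁ x₂ t ∧
      trajDist Θ x₁ x₂ t
        ≤ Real.exp (∫ τ in t₀..t, (rateMax f Θ x₁ x₂ τ).toReal) * trajDist Θ x₁ x₂ t₀) ∧
    -- contracting, diverging, semi-contracting, semi-diverging and indifferent systems
    ((∀ t ∈ J, IsCompact (trajBall Θ x₁ x₂ t)) →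
      (IsContracting f Θ J → ∃ β : ℝ, 0 < β ∧ ∀ t₀ ∈ J, ∀ t ∈ J, t₀ ≤ t →
        trajDist Θ x₁ x₂ t ≤ Real.exp (-β * (t - t₀)) * trajDist Θ x₁ x₂ t₀) ∧
      (IsDiverging f Θ J → ∃ β : ℝ, 0 < β ∧ ∀ t₀ ∈ J, ∀ t ∈ J, t₀ ≤ t →
        Real.exp (β * (t - t₀)) * trajDist Θ x₁ x₂ t₀ ≤ trajDist Θ x₁ x₂ t) ∧
      (IsSemiContracting f Θ J → AntitoneOn (trajDist Θ x₁ x₂) J) ∧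
      (IsSemiDiverging f Θ J → MonotoneOn (trajDist Θ x₁ x₂) J) ∧
      (IsIndifferent f Θ J → ∀ t₀ ∈ J, ∀ t ∈ J,
        trajDist Θ x₁ x₂ t = trajDist Θ x₁ x₂ t₀)) ∧
    -- a uniformly positive definite and bounded metric: the distance in the identity metric
    (∀ a b : ℝ, 0 < a →
      (∀ t ∈ J, ∀ x v, a * quadForm 1 v ≤ quadForm (metricOf Θ x t) v ∧
        quadForm (metricOf Θ x t) v ≤ b * quadForm 1 v) →
      ∀ t₀ ∈ J, ∀ t ∈ J, t₀ ≤ t →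
      (∀ τ ∈ Set.Icc t₀ t, IsCompact (trajBall Θ x₁ x₂ τ)) ∧
      √(a / b) * Real.exp (∫ τ in t₀..t, (rateMin f Θ x₁ x₂ τ).toReal)
          * pathDist (fun _ => 1) (x₁ t₀) (x₂ t₀)
        ≤ pathDist (fun _ => 1) (x₁ t) (x₂ t) ∧
      pathDist (fun _ => 1) (x₁ t) (x₂ t)
        ≤ √(b / a) * Real.exp (∫ τ in t₀..t, (rateMax f Θ x₁ x₂ τ).toReal)
          * pathDist (fun _ => 1) (x₁ t₀) (x₂ t₀)) ∧
    -- explicit orthonormal Cartesian coordinates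
    (∀ (K : ℕ) (z : EuclideanSpace ℂ (Fin N) → ℝ → EuclideanSpace ℂ (Fin K)),
      IsOrthonormalCoord Θ J z →
      (∀ t ∈ J, coordDist z x₁ x₂ t = ‖z (x₁ t) t - z (x₂ t) t‖ ∧
        coordDist z x₁ x₂ t ≤ trajDist Θ x₁ x₂ t) ∧
      (∀ t ∈ J, x₁ t ≠ x₂ t → 0 < coordDist z x₁ x₂ t ∧
        ∃ ds, HasDerivWithinAt (coordDist z x₁ x₂) ds J t ∧
          ds / coordDist z x₁ x₂ t = coordRate f z x₁ x₂ t) ∧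
      (∀ r : ℝ, ∀ t₀ ∈ J, ∀ t ∈ J, t₀ ≤ t →
        ((∀ τ ∈ Set.Icc t₀ t, coordRate f z x₁ x₂ τ ≤ r) →
          coordDist z x₁ x₂ t ≤ Real.exp (r * (t - t₀)) * coordDist z x₁ x₂ t₀) ∧
        ((∀ τ ∈ Set.Icc t₀ t, r ≤ coordRate f z x₁ x₂ τ) →
          Real.exp (r * (t - t₀)) * coordDist z x₁ x₂ t₀ ≤ coordDist z x₁ x₂ t)) ∧
      -- the coordinate distance is the distance `s` if the straight segments are in the chart
      ((∀ t ∈ J, segment ℝ (z (x₁ t) t) (z (x₂ t) t) ⊆ Set.range (fun x => z x t)) →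
        (∀ t ∈ J, trajDist Θ x₁ x₂ t = coordDist z x₁ x₂ t) ∧
        (∀ t ∈ J, x₁ t ≠ x₂ t → ∃ ds, HasDerivWithinAt (trajDist Θ x₁ x₂) ds J t ∧
          ds / trajDist Θ x₁ x₂ t = coordRate f z x₁ x₂ t))) := by
  refine ⟨fun t ht hne h => rate_bounds_of_minimizer hf hf' hΘ hΘ' hx₁ hx₂ ht hne h,
    fun t ht hne hB => rate_bounds_of_isCompact hf hf' hΘ hΘ' hx₁ hx₂ hJ hJ' ht hne hB,
    fun t₀ ht₀ t ht hle hB =>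
      exponential_bounds hf hf' hΘ hΘ' hJ hJ' hx₁ hx₂ ht₀ ht hle hB,
    fun hB => contraction_of_isCompact hf hf' hΘ hΘ' hJ hJ' hx₁ hx₂ hB,
    fun a b ha hab t₀ ht₀ t ht hle =>
      identity_metric_bounds hf hf' hΘ hΘ' hJ hJ' hx₁ hx₂ ha hab ht₀ ht hle,
    fun K z hz => ⟨fun t ht => ⟨coordDist_eq_norm t, hz.coordDist_le ht⟩,
      fun t ht hne => ⟨hz.coordDist_pos ht hne,
        exists_hasDerivWithinAt_coordDist hz ht (hx₁ t ht) (hx₂ t ht) hne⟩,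
      fun r t₀ ht₀ t ht hle => coordDist_exp_bounds hJ hz hx₁ hx₂ ht₀ ht hle,
      fun hseg => ?_⟩⟩
  have heq : ∀ t ∈ J, trajDist Θ x₁ x₂ t = coordDist z x₁ x₂ t := fun t ht =>
    le_antisymm (hz.trajDist_le hΘ' ht (hseg t ht)) (hz.coordDist_le ht)
  refine ⟨heq, fun t ht hne => ?_⟩
  obtain ⟨ds, hds, hrate⟩ :=
    exists_hasDerivWithinAt_coordDist hz ht (hx₁ t ht) (hx₂ t ht) hne
  exact ⟨ds, hds.congr heq (heq t ht), by rw [heq t ht, hrate]⟩
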